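/- Let $G$ be a finite group. \textbf{Trees.} For a set $E$ let $E^+$ be the free commutative monoid on $E$ (finite unordered tuples). A \emph{pre-broad poset} structure on $E$ is a relation $\underline{f}\le e$ between $E^+$ and $E$ with $e\le e$, and such that $f_1\cdots f_n\le e$ and $\underline{g}_i\le f_i$ imply $\underline{g}_1\cdots\underline{g}_n\le e$. Write $f\le_d e$ if $f$ occurs in some $\underline{f}\le e$, write $\underline f<e$ if $\underline f\le e$ and $\underline f\ne e$, and write $\underline{f}\le e_1\cdots e_k$ if $\underline{f}=\underline{f}_1\cdots\underline{f}_k$ with $\underline{f}_i\le e_i$. An edge $e\in E$ is a \emph{leaf} if there is no $\underline f<e$, a \emph{node} if there is a non-empty maximum $\underline f<e$, and a \emph{stump} if the empty tuple is the maximum $\underline f<e$. A \emph{forest} is a finite $E$ with such a relation which is antisymmetric on $E$, simple (no repetitions in $\underline{f}$ when $\underline f\le e$), in which each edge is a leaf, a node or a stump, and in which each edge lies $\le_d$-below a unique $\le_d$-maximal edge (a \emph{root}); a \emph{tree} is a forest with a $\le_d$-maximum. Trees and monotone maps form the category $\Omega$. The \emph{tensor product} $S\otimes T$ is the pre-broad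 poset on $S\times T$ generated by $\underline{s}\times t\le (s,t)$ and $s\times\underline{t}\le (s,t)$ for $\underline{s}\le s$ in $S$ and $\underline{t}\le t$ in $T$. A \emph{$G$-tree} is a forest with a $G$-action whose roots form a single $G$-orbit. It is \emph{open} if it has no stumps, and \emph{linear} if it is isomorphic to $G\cdot_H[n]$ for some subgroup $H\le G$ and some $n\geq 0$, where $[n]$ is the linear tree with edges $0,\dots,n$. An edge is \emph{inner} if it is neither a leaf nor a root. \textbf{Presheaves.} Let $\mathsf{dSet}^G$ be the category of presheaves of sets on $\Omega$ with a $G$-action. Let $\otimes$ be the tensor product on presheaves on $\Omega$ that preserves colimits in each variable and satisfies $\Omega[S]\otimes\Omega[T]=\mathrm{Hom}(-,S\otimes T)$ for $S,T\in\Omega$; on $\mathsf{dSet}^G$ use the diagonal action. For a $G$-tree $T$ with tree components $T_i$ put $\Omega[T]=\coprod_i\Omega[T_i]$. A face of $T_i$ is an injective map from a tree to $T_i$. The boundary $\partial\Omega[T]\subset\Omega[T]$ is the union of the non-invertible faces of the $T_i$. For an orbit $G\xi$ of inner edges of $T$, the horn $\Lambda^{G\xi}[T]\subset\Omega[T]$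 is the union of the faces of the $T_i$ other than those of the form $T_i-E'$ for a (possibly empty) set $E'\subseteq G\xi\cap T_i$, where $T_i-E'$ is $T_i$ with the edges of $E'$ removed and all relations of $T_i$ between the remaining edges. A map of $\mathsf{dSet}^G$ is \emph{$G$-inner anodyne} if it lies in the smallest class of maps that contains all inclusions $\Lambda^{G\zeta}[U]\to\Omega[U]$, for $U$ a $G$-tree and $\zeta$ an inner edge of $U$, and is closed under pushouts, transfinite compositions and retracts. \textbf{Theorem.} Let $S$ and $T$ be $G$-trees and let $G\xi$ be the orbit of an inner edge $\xi$ of $T$. Then the map $$\partial\Omega[S]\otimes\Omega[T]\coprod_{\partial\Omega[S]\otimes\Lambda^{G\xi}[T]}\Omega[S]\otimes\Lambda^{G\xi}[T]\longrightarrow\Omega[S]\otimes\Omega[T]$$ is a $G$-inner anodyne extension if either (i) both $S$ and $T$ are open, or (ii) at least one of $S$, $T$ is linear. -/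

import Mathlib

open CategoryTheory Opposite

universe u v w

/-! ### Broad posets -/

/-- A (commutative) pre-broad poset structure on `E`: a relation between finite unordered tuples
of elements of `E` (multisets, the free commutative monoid on `E`) and elements of `E`,
which is reflexive and broadly transitive.
In `trans`, the multiset `m` lists the relations `g₁ ≤ f₁, …, gₙ ≤ fₙ` that are composed with
`f₁ ⋯ fₙ ≤ e`. -/
structure PreBroadPoset (E : Type u) where
  rel : Multiset E → E → Prop
  refl : ∀ e, rel {e} e
  trans : ∀ (m : Multiset (Multiset E × E)) (e : E), (∀ p ∈ m, rel p.1 p.2) →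
    rel (m.map Prod.snd) e → rel (m.map Prod.fst).sum e

namespace PreBroadPoset

section Basic

variable {E : Type u} (P : PreBroadPoset E)

/-- A broad poset is a pre-broad poset which is antisymmetric. -/
def IsAntisymm : Prop := ∀ e f, P.rel {e} f → P.rel {f} e → e = f

/-- No element is repeated in the tuple of a broad relation. -/
def IsSimple : Prop := ∀ s e, P.rel s e → s.Nodup

/-- The descendant relation `f ≤_d e`. -/
def Desc (f e : E) : Prop := ∃ s, f ∈ s ∧ P.rel s e

/-- The induced relation on tuples: `s = s₁ ⋯ sₖ`, `t = e₁ ⋯ eₖ` and `sᵢ ≤ eᵢ` for all `i`. -/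
def TupleLE (s t : Multiset E) : Prop :=
  ∃ m : Multiset (Multiset E × E), (∀ p ∈ m, P.rel p.1 p.2) ∧
    s = (m.map Prod.fst).sum ∧ t = m.map Prod.snd

/-- The strict relation `s < e`. -/
def Lt (s : Multiset E) (e : E) : Prop := P.rel s e ∧ s ≠ {e}

/-- `e` is a leaf: there is no `s < e`. -/
def IsLeaf (e : E) : Prop := ∀ s, ¬ P.Lt s e

/-- `e` is a node: there is a nonempty maximum `s < e`. -/
def IsNode (e : E) : Prop := ∃ s, s ≠ 0 ∧ P.Lt s e ∧ ∀ t, P.Lt t e → P.TupleLE t s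

/-- `e` is a stump: the empty tuple is the maximum `s < e`. -/
def IsStump (e : E) : Prop := P.Lt 0 e ∧ ∀ t, P.Lt t e → P.TupleLE t 0

/-- Each edge is a leaf, a node or a stump. -/
def IsNodal : Prop := ∀ e, P.IsLeaf e ∨ P.IsNode e ∨ P.IsStump e

/-- `r` is a root: it is maximal for `≤_d`. -/
def IsRoot (r : E) : Prop := ∀ e, P.Desc r e → e = r

/-- Trees, i.e. dendroidally ordered sets. -/
structure IsTree : Prop where
  finite : Finite E
  antisymm : P.IsAntisymm
  simple : P.IsSimple
  nodal : P.IsNodal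
  root : ∃ r, ∀ e, P.Desc e r

/-- Forests, i.e. forestially ordered sets. -/
structure IsForest : Prop where
  finite : Finite E
  antisymm : P.IsAntisymm
  simple : P.IsSimple
  nodal : P.IsNodal
  root : ∀ e, ∃! r, P.IsRoot r ∧ P.Desc e r

end Basic

/-- Monotone maps of pre-broad posets. -/
@[ext]
structure Hom {E : Type u} {F : Type v} (P : PreBroadPoset E) (Q : PreBroadPoset F) where
  toFun : E → F
  map_rel : ∀ s e, P.rel s e → Q.rel (s.map toFun) (toFun e)

namespace Hom

/-- The identity map. -/
def id {E : Type u} (P : PreBroadPoset E) : Hom P P where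
  toFun e := e
  map_rel s e h := by simpa using h

/-- `f.comp g` is `g` followed by `f`. -/
def comp {E : Type u} {F : Type v} {D : Type w} {P : PreBroadPoset E} {Q : PreBroadPoset F}
    {R : PreBroadPoset D} (f : Hom Q R) (g : Hom P Q) : Hom P R where
  toFun e := f.toFun (g.toFun e)
  map_rel s e h := by
    have := f.map_rel _ _ (g.map_rel _ _ h)
    rw [Multiset.map_map] at this
    exact this

end Hom

/-- The broad relations generated by a family `R` of relations. -/
inductive Gen {E : Type u} (R : Multiset E → E → Prop) : Multiset E → E → Prop
  | refl (e : E) : Gen R {e} e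
  | of (s : Multiset E) (e : E) : R s e → Gen R s e
  | trans (m : Multiset (Multiset E × E)) (e : E) : (∀ p ∈ m, Gen R p.1 p.2) →
      Gen R (m.map Prod.snd) e → Gen R (m.map Prod.fst).sum e

/-- The pre-broad poset generated by a family `R` of relations. -/
def generate {E : Type u} (R : Multiset E → E → Prop) : PreBroadPoset E where
  rel := Gen R
  refl := Gen.refl
  trans := Gen.trans

/-- A map out of a generated pre-broad poset is monotone if it respects the generators. -/
def Hom.ofGen {E : Type u} {F : Type v} {R : Multiset E → E → Prop} {Q : PreBroadPoset F}
    (f : E → F) (hf : ∀ s e, R s e → Q.rel (s.map f) (f e)) : Hom (generate R) Q where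
  toFun := f
  map_rel s e h := by
    have h' : Gen R s e := h
    clear h
    induction h' with
    | refl e => simpa using Q.refl (f e)
    | of s e h => exact hf s e h
    | trans m e _ _ ih₁ ih₂ =>
      have := Q.trans (m.map (fun p => (p.1.map f, f p.2))) (f e)
        (by
          intro p hp
          obtain ⟨q, hq, rfl⟩ := Multiset.mem_map.1 hp
          exact ih₁ q hq)
        (by simpa [Multiset.map_map, Function.comp_def] using ih₂)
      have key : ∀ m : Multiset (Multiset E × E),
          ((m.map Prod.fst).sum).map f = (m.map (fun p => p.1.map f)).sum := by
        intro m
        induction m using Multiset.induction_on with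
        | empty => simp
        | cons a m ih => simp [ih]
      rw [key]
      simpa [Multiset.map_map, Function.comp_def] using this

/-- The generating relations of the tensor product: `s × b ≤ (a, b)` for `s ≤ a` in `P`, and
`a × t ≤ (a, b)` for `t ≤ b` in `Q`. -/
inductive TensorRel {E : Type u} {F : Type v} (P : PreBroadPoset E) (Q : PreBroadPoset F) :
    Multiset (E × F) → E × F → Prop
  | left (s : Multiset E) (a : E) (b : F) :
      P.rel s a → TensorRel P Q (s.map (fun x => (x, b))) (a, b)
  | right (a : E) (t : Multiset F) (b : F) :
      Q.rel t b → TensorRel P Q (t.map (fun y => (a, y))) (a, b)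

/-- The tensor product of two pre-broad posets. -/
def tensor {E : Type u} {F : Type v} (P : PreBroadPoset E) (Q : PreBroadPoset F) :
    PreBroadPoset (E × F) :=
  generate (TensorRel P Q)

/-- Functoriality of the tensor product of pre-broad posets. -/
def tensorMap {E E' F F' : Type*} {P : PreBroadPoset E} {P' : PreBroadPoset E'}
    {Q : PreBroadPoset F} {Q' : PreBroadPoset F'} (f : Hom P P') (g : Hom Q Q') :
    Hom (tensor P Q) (tensor P' Q') :=
  Hom.ofGen (fun x => (f.toFun x.1, g.toFun x.2)) (by
    rintro _ _ (⟨s, a, b, h⟩ | ⟨a, t, b, h⟩)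
    · have := Gen.of _ _ (TensorRel.left (Q := Q') _ _ (g.toFun b) (f.map_rel _ _ h))
      simp only [Multiset.map_map, Function.comp_def] at this ⊢
      exact this
    · have := Gen.of _ _ (TensorRel.right (P := P') (f.toFun a) _ _ (g.map_rel _ _ h))
      simp only [Multiset.map_map, Function.comp_def] at this ⊢
      exact this)

/-- The linear tree `[n]` with edges `0, …, n`: its only broad relations are the
relations `i ≤ j` between single edges. -/
def linear (n : ℕ) : PreBroadPoset (Fin (n + 1)) where
  rel s j := ∃ i, i ≤ j ∧ s = {i}
  refl e := ⟨e, le_rfl, rfl⟩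
  trans := by
    rintro m e hm ⟨i, hi, h⟩
    obtain ⟨p, rfl, rfl⟩ := Multiset.map_eq_singleton.1 h
    obtain ⟨k, hk, hk'⟩ := hm p (by simp)
    exact ⟨k, hk.trans hi, by simp [hk']⟩

/-- The disjoint union of copies of `P` indexed by `I`. -/
def copies (I : Type u) {E : Type v} (P : PreBroadPoset E) : PreBroadPoset (I × E) where
  rel s e := P.rel (s.map Prod.snd) e.2 ∧ ∀ x ∈ s, x.1 = e.1
  refl e := ⟨by simpa using P.refl e.2, by simp⟩
  trans := by
    rintro m e hm ⟨h, h'⟩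
    refine ⟨?_, ?_⟩
    · have := P.trans (m.map (fun p => (p.1.map Prod.snd, p.2.2))) e.2
        (by
          intro p hp
          obtain ⟨q, hq, rfl⟩ := Multiset.mem_map.1 hp
          exact (hm q hq).1)
        (by simpa [Multiset.map_map, Function.comp_def] using h)
      have key : ∀ m : Multiset (Multiset (I × E) × (I × E)),
          ((m.map Prod.fst).sum).map Prod.snd = (m.map (fun p => p.1.map Prod.snd)).sum := by
        intro m
        induction m using Multiset.induction_on with
        | empty => simp
        | cons a m ih => simp [ih]
      rw [key]
      simpa [Multiset.map_map, Function.comp_def] using this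
    · intro x hx
      have key : ∀ m : Multiset (Multiset (I × E) × (I × E)),
          x ∈ (m.map Prod.fst).sum → ∃ p ∈ m, x ∈ p.1 := by
        intro m
        induction m using Multiset.induction_on with
        | empty => simp
        | cons a m ih =>
          simp only [Multiset.map_cons, Multiset.sum_cons, Multiset.mem_add, Multiset.mem_cons]
          rintro (h | h)
          · exact ⟨a, Or.inl rfl, h⟩
          · obtain ⟨p, hp, h⟩ := ih h
            exact ⟨p, Or.inr hp, h⟩
      obtain ⟨p, hp, hx⟩ := key m hx
      rw [(hm p hp).2 x hx]
      exact h' _ (Multiset.mem_map_of_mem _ hp)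

end PreBroadPoset

open PreBroadPoset

/-! ### The category of trees and dendroidal sets -/

/-- The category `Ω` of trees. As every finite set is in bijection with some `Fin n`, restricting
to trees whose set of edges is some `Fin n` gives a small model of the category of all trees. -/
structure Omega : Type where
  card : ℕ
  broad : PreBroadPoset (Fin card)
  isTree : broad.IsTree

instance : Category.{0} Omega where
  Hom U V := Hom U.broad V.broad
  id U := Hom.id U.broad
  comp f g := g.comp f

/-- The category of dendroidal sets. -/
abbrev DSet : Type (u + 1) := Omegaᵒᵖ ⥤ Type u

/-- The category of dendroidal sets with an action of `G`. -/
abbrev DSetG (G : Type u) [Group G] : Type (u + 1) := Action DSet.{u} G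

/-- The dendroidal set `Hom(-, P)` of monotone maps from trees to `P`. -/
def homPresheaf {E : Type u} (P : PreBroadPoset E) : DSet.{u} where
  obj U := Hom U.unop.broad P
  map a := TypeCat.ofHom (fun φ => φ.comp a.unop)
  map_id _ := rfl
  map_comp _ _ := rfl

/-- The map `Hom(-, P) → Hom(-, Q)` given by postcomposition. -/
def homPresheafMap {E F : Type u} {P : PreBroadPoset E} {Q : PreBroadPoset F} (f : Hom P Q) :
    homPresheaf P ⟶ homPresheaf Q where
  app _ := TypeCat.ofHom (fun φ => f.comp φ)
  naturality _ _ _ := rfl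

/-! ### The tensor product of dendroidal sets

The unique extension of `Ω[S] ⊗ Ω[T] = Hom(-, S ⊗ T)` which preserves colimits in each variable,
namely the coend `∫^{S,T} X(S) × Y(T) × Hom(-, S ⊗ T)`. -/

/-- The elements of `∐_{S,T} X(S) × Y(T) × Hom(U, S ⊗ T)`. -/
structure PreTensor (X Y : DSet.{u}) (U : Omega) : Type u where
  S : Omega
  T : Omega
  x : X.obj (op S)
  y : Y.obj (op T)
  h : Hom U.broad (tensor S.broad T.broad)

/-- The identifications made in the coend: `(a^* x, b^* y, h) ~ (x, y, (a ⊗ b) ∘ h)`. -/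
inductive PreTensor.Step (X Y : DSet.{u}) (U : Omega) : PreTensor X Y U → PreTensor X Y U → Prop
  | mk {S S' T T' : Omega} (a : S ⟶ S') (b : T ⟶ T') (x : X.obj (op S')) (y : Y.obj (op T'))
      (h : Hom U.broad (tensor S.broad T.broad)) :
      PreTensor.Step X Y U ⟨S, T, X.map a.op x, Y.map b.op y, h⟩ ⟨S', T', x, y, (tensorMap a b).comp h⟩

/-- The tensor product of two dendroidal sets. -/
def tensorObj (X Y : DSet.{u}) : DSet.{u} where
  obj U := Quot (PreTensor.Step X Y U.unop)
  map c := TypeCat.ofHom (Quot.map (fun z => ⟨z.S, z.T, z.x, z.y, z.h.comp c.unop⟩) (by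
    rintro _ _ ⟨a, b, x, y, h⟩
    exact PreTensor.Step.mk a b x y (h.comp _)))
  map_id _ := by
    ext z
    obtain ⟨z⟩ := z
    rfl
  map_comp c d := by
    ext z
    obtain ⟨z⟩ := z
    rfl

/-- Functoriality of the tensor product of dendroidal sets. -/
def tensorHom {X X' Y Y' : DSet.{u}} (f : X ⟶ X') (g : Y ⟶ Y') :
    tensorObj X Y ⟶ tensorObj X' Y' where
  app U := TypeCat.ofHom (Quot.map
    (fun z => ⟨z.S, z.T, f.app (op z.S) z.x, g.app (op z.T) z.y, z.h⟩) (by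
      rintro _ _ ⟨a, b, x, y, h⟩
      have hx := NatTrans.naturality_apply f a.op x
      have hy := NatTrans.naturality_apply g b.op y
      dsimp only
      rw [hx, hy]
      exact PreTensor.Step.mk a b _ _ h))
  naturality _ _ c := by
    ext z
    obtain ⟨z⟩ := z
    rfl

theorem tensorHom_id (X Y : DSet.{u}) : tensorHom (𝟙 X) (𝟙 Y) = 𝟙 (tensorObj X Y) := by
  ext U z
  obtain ⟨z⟩ := z
  rfl

theorem tensorHom_comp {X X' X'' Y Y' Y'' : DSet.{u}} (f : X ⟶ X') (f' : X' ⟶ X'')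
    (g : Y ⟶ Y') (g' : Y' ⟶ Y'') :
    tensorHom (f ≫ f') (g ≫ g') = tensorHom f g ≫ tensorHom f' g' := by
  ext U z
  obtain ⟨z⟩ := z
  rfl

/-- The tensor product of two dendroidal sets with `G`-action, with the diagonal action. -/
def tensorObjG {G : Type u} [Group G] (X Y : DSetG G) : DSetG G where
  V := tensorObj X.V Y.V
  ρ :=
    { toFun := fun g => tensorHom (X.ρ g) (Y.ρ g)
      map_one' := by
        rw [map_one, map_one]
        exact tensorHom_id _ _
      map_mul' := fun g h => by
        rw [map_mul, map_mul]
        exact tensorHom_comp _ _ _ _ }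

/-- The tensor product on dendroidal sets with `G`-action, as a bifunctor. -/
def tensorG (G : Type u) [Group G] : DSetG G ⥤ DSetG G ⥤ DSetG G where
  obj X :=
    { obj := fun Y => tensorObjG X Y
      map := fun {Y Y'} g =>
        { hom := tensorHom (𝟙 X.V) g.hom
          comm := fun k => by
            change tensorHom (X.ρ k) (Y.ρ k) ≫ tensorHom (𝟙 X.V) g.hom =
              tensorHom (𝟙 X.V) g.hom ≫ tensorHom (X.ρ k) (Y'.ρ k)
            rw [← tensorHom_comp, ← tensorHom_comp, g.comm k, Category.comp_id, Category.id_comp] }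
      map_id := fun Y => Action.hom_ext _ _ (tensorHom_id _ _)
      map_comp := fun f g => Action.hom_ext _ _ (by
        change tensorHom (𝟙 X.V) (f.hom ≫ g.hom) =
          tensorHom (𝟙 X.V) f.hom ≫ tensorHom (𝟙 X.V) g.hom
        rw [← tensorHom_comp, Category.comp_id]) }
  map {X X'} f :=
    { app := fun Y =>
        { hom := tensorHom f.hom (𝟙 Y.V)
          comm := fun k => by
            change tensorHom (X.ρ k) (Y.ρ k) ≫ tensorHom f.hom (𝟙 Y.V) =
              tensorHom f.hom (𝟙 Y.V) ≫ tensorHom (X'.ρ k) (Y.ρ k)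
            rw [← tensorHom_comp, ← tensorHom_comp, f.comm k, Category.comp_id, Category.id_comp] }
      naturality := fun Y Y' g => Action.hom_ext _ _ (by
        change tensorHom (𝟙 X.V) g.hom ≫ tensorHom f.hom (𝟙 Y'.V) =
          tensorHom f.hom (𝟙 Y.V) ≫ tensorHom (𝟙 X'.V) g.hom
        rw [← tensorHom_comp, ← tensorHom_comp, Category.comp_id, Category.id_comp,
          Category.comp_id, Category.id_comp]) }
  map_id X := by
    ext Y : 2
    exact Action.hom_ext _ _ (tensorHom_id _ _)
  map_comp f g := by
    ext Y : 2
    exact Action.hom_ext _ _ (by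
      change tensorHom (f.hom ≫ g.hom) (𝟙 Y.V) =
        tensorHom f.hom (𝟙 Y.V) ≫ tensorHom g.hom (𝟙 Y.V)
      rw [← tensorHom_comp, Category.comp_id])

/-! ### `G`-trees -/

/-- A `G`-tree: a forest with an action of `G` whose roots form a single `G`-orbit. -/
structure GTree (G : Type u) [Group G] : Type (u + 1) where
  carrier : Type u
  broad : PreBroadPoset carrier
  isForest : broad.IsForest
  [action : MulAction G carrier]
  smul_rel : ∀ (g : G) (s : Multiset carrier) (e : carrier),
    broad.rel s e → broad.rel (s.map (fun x => g • x)) (g • e)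
  root_orbit : ∃ r, {e | broad.IsRoot e} = MulAction.orbit G r

namespace GTree

attribute [instance] GTree.action

variable {G : Type u} [Group G] (T : GTree G)

/-- An open `G`-tree has no stumps. -/
def IsOpen : Prop := ∀ e, ¬ T.broad.IsStump e

/-- A linear `G`-tree is one that is isomorphic to `G ·_H [n]`, i.e. to `G/H × [n]` with `G`
permuting the copies of `[n]` (the only automorphism of `[n]` is the identity, so `H` acts
trivially on `[n]`). -/
def IsLinear : Prop :=
  ∃ (H : Subgroup G) (n : ℕ) (φ : T.carrier ≃ (G ⧸ H) × Fin (n + 1)),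
    (∀ (g : G) (e : T.carrier), φ (g • e) = (g • (φ e).1, (φ e).2)) ∧
    ∀ (s : Multiset T.carrier) (e : T.carrier),
      T.broad.rel s e ↔ (copies (G ⧸ H) (linear n)).rel (s.map φ) (φ e)

/-- An inner edge is an edge that is neither a leaf nor a root. -/
def IsInnerEdge (e : T.carrier) : Prop := ¬ T.broad.IsLeaf e ∧ ¬ T.broad.IsRoot e

/-- The action of an element of `G` on a `G`-tree. -/
def smulHom (g : G) : Hom T.broad T.broad where
  toFun e := g • e
  map_rel := T.smul_rel g

/-- The dendroidal set with `G`-action `Ω[T]`. As a tree is connected, `Ω[∐ᵢ Tᵢ] = ∐ᵢ Ω[Tᵢ]` is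
the presheaf of all monotone maps to the forest `∐ᵢ Tᵢ`. -/
def omega : DSetG G where
  V := homPresheaf T.broad
  ρ :=
    { toFun := fun g => homPresheafMap (T.smulHom g)
      map_one' := by
        refine NatTrans.ext (funext fun U => ?_)
        ext φ
        exact Hom.ext (funext fun x => one_smul G (φ.toFun x))
      map_mul' := fun g h => by
        refine NatTrans.ext (funext fun U => ?_)
        ext φ
        exact Hom.ext (funext fun x => mul_smul g h (φ.toFun x)) }

variable {T}

/-- The map `ψ : V → T` identifies `V` with the set of edges `A`, endowed with all the broad
relations of `T` between its elements. -/
def IsFullOn {V : Omega} (ψ : Hom V.broad T.broad) (A : Set T.carrier) : Prop :=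
  Set.range ψ.toFun = A ∧
    ∀ s e, V.broad.rel s e ↔ T.broad.rel (s.map ψ.toFun) (ψ.toFun e)

/-- Up to isomorphism, `ψ` is the inclusion of the inner face `R - E'`, where `R` is the tree
component of `T` with root `r`, i.e. the set of the edges `e ≤_d r`. For `E' = ∅` this is the
inclusion of the whole component. -/
def IsComponentMinus {V : Omega} (ψ : Hom V.broad T.broad) (r : T.carrier)
    (E' : Set T.carrier) : Prop :=
  T.broad.IsRoot r ∧ IsFullOn ψ {e | T.broad.Desc e r ∧ e ∉ E'}

theorem rel_smul_iff (g : G) (s : Multiset T.carrier) (e : T.carrier) :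
    T.broad.rel (s.map (fun x => g • x)) (g • e) ↔ T.broad.rel s e := by
  refine ⟨fun h => ?_, T.smul_rel g s e⟩
  simpa [Multiset.map_map, Function.comp_def] using T.smul_rel g⁻¹ _ _ h

theorem desc_smul_iff (g : G) (f e : T.carrier) :
    T.broad.Desc (g • f) (g • e) ↔ T.broad.Desc f e := by
  have key : ∀ (g : G) (f e : T.carrier), T.broad.Desc f e → T.broad.Desc (g • f) (g • e) := by
    rintro g f e ⟨s, hs, h⟩
    exact ⟨_, Multiset.mem_map_of_mem (fun x => g • x) hs, T.smul_rel g _ _ h⟩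
  exact ⟨fun h => by simpa using key g⁻¹ _ _ h, key g f e⟩

theorem isRoot_smul (g : G) {r : T.carrier} (h : T.broad.IsRoot r) : T.broad.IsRoot (g • r) := by
  intro e he
  have h' := h (g⁻¹ • e) ((desc_smul_iff g _ _).1 (by simpa using he))
  rw [← h', smul_inv_smul]

theorem isComponentMinus_smul (g : G) {V : Omega} {ψ : Hom V.broad T.broad} {r : T.carrier}
    {E' : Set T.carrier} (h : IsComponentMinus ((T.smulHom g).comp ψ) r E') :
    IsComponentMinus ψ (g⁻¹ • r) {e | g • e ∈ E'} := by
  obtain ⟨hr, h₁, h₂⟩ := h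
  refine ⟨isRoot_smul _ hr, ?_, ?_⟩
  · ext e
    have := Set.ext_iff.1 h₁ (g • e)
    have hd := desc_smul_iff g e (g⁻¹ • r)
    rw [smul_inv_smul] at hd
    simp only [Set.mem_ofPred_eq] at this ⊢
    rw [← hd, ← this]
    constructor
    · rintro ⟨x, rfl⟩
      exact ⟨x, rfl⟩
    · rintro ⟨x, hx⟩
      exact ⟨x, smul_left_cancel g hx⟩
  · intro s e
    rw [h₂ s e, ← rel_smul_iff g (s.map ψ.toFun), Multiset.map_map]
    rfl

variable (T)

/-- The union of the faces of `T` (injective maps `ψ : V → T` from trees) which satisfy `Q`: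
the maps to `T` that factor through one of these faces. -/
def faceUnion (Q : ∀ V : Omega, Hom V.broad T.broad → Prop) : Subfunctor (homPresheaf T.broad) where
  obj U := {φ | ∃ (V : Omega) (ψ : Hom V.broad T.broad) (a : U.unop ⟶ V),
    Function.Injective ψ.toFun ∧ Q V ψ ∧ φ = ψ.comp a}
  map c := by
    rintro _ ⟨V, ψ, a, h, hQ, rfl⟩
    exact ⟨V, ψ, c.unop ≫ a, h, hQ, rfl⟩

/-- A union of faces as a subobject of `Ω[T]`, if `G` permutes the faces. -/
def faceUnionG (Q : ∀ V : Omega, Hom V.broad T.broad → Prop)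
    (hQ : ∀ (g : G) (V : Omega) (ψ : Hom V.broad T.broad), Q V ψ → Q V ((T.smulHom g).comp ψ)) :
    DSetG G where
  V := (T.faceUnion Q).toFunctor
  ρ :=
    { toFun := fun g =>
        { app := fun U => TypeCat.ofHom (fun φ => ⟨(T.smulHom g).comp φ.1, by
            obtain ⟨_, V, ψ, a, h, hψ, rfl⟩ := φ
            exact ⟨V, (T.smulHom g).comp ψ, a, fun x y hxy => h (smul_left_cancel g hxy),
              hQ g V ψ hψ, rfl⟩⟩)
          naturality := fun _ _ _ => rfl }
      map_one' := by
        refine NatTrans.ext (funext fun U => ?_)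
        ext φ
        exact Subtype.ext (Hom.ext (funext fun x => one_smul G (φ.1.toFun x)))
      map_mul' := fun g h => by
        refine NatTrans.ext (funext fun U => ?_)
        ext φ
        exact Subtype.ext (Hom.ext (funext fun x => mul_smul g h (φ.1.toFun x))) }

/-- The inclusion of a union of faces in `Ω[T]`. -/
def faceUnionι (Q : ∀ V : Omega, Hom V.broad T.broad → Prop)
    (hQ : ∀ (g : G) (V : Omega) (ψ : Hom V.broad T.broad), Q V ψ → Q V ((T.smulHom g).comp ψ)) :
    T.faceUnionG Q hQ ⟶ T.omega where
  hom := (T.faceUnion Q).ι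
  comm _ := rfl

/-- The faces in the boundary: those that are not (isomorphic to) a whole component of `T`. -/
def BoundaryFace (V : Omega) (ψ : Hom V.broad T.broad) : Prop :=
  ¬ ∃ r, IsComponentMinus ψ r ∅

/-- The faces in the horn `Λ^E[T]`: those that are not of the form `R - E'` for `R` a component
of `T` and `E' ⊆ E`. -/
def HornFace (E : Set T.carrier) (V : Omega) (ψ : Hom V.broad T.broad) : Prop :=
  ¬ ∃ r E', E' ⊆ E ∧ IsComponentMinus ψ r E'

theorem boundaryFace_smul (g : G) (V : Omega) (ψ : Hom V.broad T.broad)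
    (h : T.BoundaryFace V ψ) : T.BoundaryFace V ((T.smulHom g).comp ψ) := by
  rintro ⟨r, hr⟩
  exact h ⟨_, by simpa using isComponentMinus_smul g hr⟩

theorem hornFace_smul {E : Set T.carrier} (hE : ∀ (g : G), ∀ e ∈ E, g • e ∈ E) (g : G)
    (V : Omega) (ψ : Hom V.broad T.broad) (h : T.HornFace E V ψ) :
    T.HornFace E V ((T.smulHom g).comp ψ) := by
  rintro ⟨r, E', hE', hr⟩
  refine h ⟨_, _, fun e he => ?_, isComponentMinus_smul g hr⟩
  simpa using hE g⁻¹ _ (hE' he)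

/-- The boundary `∂Ω[T]`. -/
def boundary : DSetG G := T.faceUnionG T.BoundaryFace T.boundaryFace_smul

/-- The boundary inclusion `∂Ω[T] → Ω[T]`. -/
def boundaryι : T.boundary ⟶ T.omega := T.faceUnionι T.BoundaryFace T.boundaryFace_smul

theorem smul_mem_orbit (ξ : T.carrier) (g : G) (e : T.carrier) (h : e ∈ MulAction.orbit G ξ) :
    g • e ∈ MulAction.orbit G ξ :=
  MulAction.mem_orbit_of_mem_orbit g h

/-- The horn `Λ^{Gξ}[T]`. -/
def horn (ξ : T.carrier) : DSetG G :=
  T.faceUnionG (T.HornFace (MulAction.orbit G ξ)) (T.hornFace_smul (T.smul_mem_orbit ξ))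

/-- The horn inclusion `Λ^{Gξ}[T] → Ω[T]`. -/
def hornι (ξ : T.carrier) : T.horn ξ ⟶ T.omega :=
  T.faceUnionι (T.HornFace (MulAction.orbit G ξ)) (T.hornFace_smul (T.smul_mem_orbit ξ))

end GTree

/-! ### `G`-inner anodyne extensions -/

/-- The generating `G`-inner horn inclusions `Λ^{Gξ}[T] → Ω[T]`, for `T` a `G`-tree and `ξ` an
inner edge of `T`. -/
def innerHorns (G : Type u) [Group G] : MorphismProperty (DSetG G) :=
  MorphismProperty.ofHoms
    (fun p : (T : GTree G) × {ξ : T.carrier // T.IsInnerEdge ξ} => p.1.hornι p.2.1)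

/-- The `G`-inner anodyne extensions: the smallest class of maps that contains the generating
`G`-inner horn inclusions and is closed under pushouts, transfinite compositions and retracts. -/
def innerAnodyne (G : Type u) [Group G] : MorphismProperty (DSetG G) := fun _ _ f =>
  ∀ W : MorphismProperty (DSetG G), innerHorns G ≤ W → W.IsStableUnderCobaseChange →
    MorphismProperty.IsStableUnderTransfiniteComposition.{u} W → W.IsStableUnderRetracts → W f

open CategoryTheory Opposite PreBroadPoset

/-! A forest is determined by its edges ordered by `Desc`, with incomparability as disjointness and
with its leaves marked: a tuple is below `e` exactly if its members are pairwise disjoint, lie below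
`e`, and cover the leaves below `e` (`IsForest.rel_iff`). This description survives tensor products.
In `S ⊗ T` pairs are ordered coordinatewise, two pairs are disjoint as soon as one coordinate is,
and pairs of leaves are marked (`tensor_rel_iff`). Maps from trees into `S ⊗ T` and their images
thus become order-theoretic objects.

Under (i) or (ii), in the form of `Amenable`, every map from a tree to `S ⊗ T` factors through a
smallest pair of faces of `S` and `T` (`exists_minimal_faces`). Hence an element of the coend is
determined by its image in `Hom(-, S ⊗ T)`, also when the factors are replaced by unions of faces,
and the pushout product is the inclusion of a subpresheaf (`GTree.nonempty_arrow_iso`). The maps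
outside of it are the saturated ones whose image is in `fullSubtrees`: it projects onto a component
of `S`, and onto a component of `T` up to edges in the orbit of `ξ` (`inPushoutProduct_iff`).

The missing cells are attached along a pairing. This assigns to each missing subtree `V` a nonempty
set `c V` of inner edges of `V ∪ c V`, equivariantly and without being affected when edges of `c V`
are added or removed, so that the cells fall into intervals from `V \ c V` to `V ∪ c V`. If the
stabilizer of a top `X` permutes `c X` transitively, all translates of the interval are attached by
one pushout of the horn inclusion of the `G`-tree formed by the translates of `X` (`attach_orbit`).
Otherwise one orbit is discarded from `c X`, which cuts the interval into smaller ones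
(`IsPairing.shrink`), and induction applies (`CellBase.attach`).

The toggled edges are pairs `(s, x)` with `x` in the orbit of `ξ`. If some edge lies strictly below
`ξ`, which is automatic for open `T` as `ξ` is not a leaf, then `s` is maximal such that `V`
contains some `(s, z)` with `z` strictly below `x` (`exists_isPairing_below`). If nothing lies below
`ξ`, then `ξ` is a stump, `S` has to be linear, and `s` is minimal such that `V` contains some `(s,
z)` with `z` strictly above `x` (`exists_isPairing_above`). In both cases the choice depends only on
the part of `V` that does not lie over the orbit of `ξ`. -/

/-! ### Box posets -/

/-- A partial order with a relation of disjointness and a set of marked elements. Each of them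
gives rise to a broad poset `Box.broad`; forests and tensor products of forests are of this form. -/
structure Box (E : Type u) where
  le : E → E → Prop
  refl : ∀ a, le a a
  trans : ∀ {a b c}, le a b → le b c → le a c
  antisymm : ∀ {a b}, le a b → le b a → a = b
  perp : E → E → Prop
  perp_symm : ∀ {a b}, perp a b → perp b a
  perp_mono : ∀ {a b a'}, perp a b → le a' a → perp a' b
  not_perp : ∀ {a b}, le a b → ¬ perp a b
  leaf : E → Prop

namespace Box

section Basic

variable {E : Type u} (B : Box E)

/-- The broad relation of a box poset: `s` consists of pairwise disjoint elements below `e`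
which cover all the marked elements below `e`. -/
structure Below (s : Multiset E) (e : E) : Prop where
  nodup : s.Nodup
  le : ∀ f ∈ s, B.le f e
  perp : ∀ f ∈ s, ∀ g ∈ s, f ≠ g → B.perp f g
  cover : ∀ p, B.leaf p → B.le p e → ∃ f ∈ s, B.le p f

variable {B}

theorem perp_mono₂ {a b a' b' : E} (h : B.perp a b) (ha : B.le a' a) (hb : B.le b' b) :
    B.perp a' b' :=
  B.perp_symm (B.perp_mono (B.perp_symm (B.perp_mono h ha)) hb)

theorem Below.singleton (e : E) : B.Below {e} e where
  nodup := by simp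
  le := by simp [B.refl]
  perp := by simp
  cover p _ hp := ⟨e, by simp, hp⟩

theorem not_perp_of_le {a b x : E} (ha : B.le x a) (hb : B.le x b) : ¬ B.perp a b := fun h =>
  B.not_perp (B.refl x) (perp_mono₂ h ha hb)

/-- Another member would be both below `e` and disjoint from it, and repetitions are excluded. -/
theorem Below.eq_singleton {s : Multiset E} {e : E} (h : B.Below s e) (he : e ∈ s) : s = {e} := by
  classical
  have : ∀ f ∈ s, f = e := by
    intro f hf
    by_contra hne
    exact B.not_perp (h.le f hf) (h.perp f hf e he hne)
  obtain ⟨n, rfl⟩ : ∃ n, s = Multiset.replicate n e := ⟨_, Multiset.eq_replicate_card.2 this⟩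
  have hn := Multiset.nodup_iff_count_le_one.1 h.nodup e
  rw [Multiset.count_replicate_self] at hn
  have : n ≠ 0 := by
    rintro rfl
    simp at he
  obtain rfl : n = 1 := by omega
  simp

/-- Tuples substituted under different members stay disjoint because disjointness passes downwards.
A marked element is traced first to a member of the outer tuple and then into the tuple below it. -/
theorem Below.subst (m : Multiset (Multiset E × E)) (e : E) (hm : ∀ p ∈ m, B.Below p.1 p.2)
    (h : B.Below (m.map Prod.snd) e) : B.Below (m.map Prod.fst).sum e := by
  have key : ∀ x, x ∈ (m.map Prod.fst).sum ↔ ∃ p ∈ m, x ∈ p.1 := by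
    intro x
    change x ∈ Multiset.join _ ↔ _
    simp [Multiset.mem_join]
  refine ⟨?_, ?_, ?_, ?_⟩
  · change (m.bind Prod.fst).Nodup
    rw [Multiset.nodup_bind]
    refine ⟨fun p hp => (hm p hp).nodup, ?_⟩
    have hn := h.nodup
    have hp := h.perp
    clear key
    induction m using Quotient.inductionOn with
    | h l =>
      simp only [Multiset.quot_mk_to_coe, Multiset.map_coe, Multiset.coe_nodup, Multiset.mem_coe]
        at hn hp hm
      refine ⟨l, rfl, ?_⟩
      have hn' := List.pairwise_map.1 hn
      refine List.Pairwise.imp_of_mem ?_ hn'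
      intro a b ha hb hab
      change Disjoint a.1 b.1
      rw [Multiset.disjoint_left]
      intro x hxa hxb
      exact not_perp_of_le ((hm a ha).le x hxa) ((hm b hb).le x hxb)
        (hp _ (List.mem_map_of_mem ha) _ (List.mem_map_of_mem hb) hab)
  · intro f hf
    obtain ⟨p, hp, hf⟩ := (key f).1 hf
    exact B.trans ((hm p hp).le f hf) (h.le _ (Multiset.mem_map_of_mem _ hp))
  · intro f hf g hg hfg
    obtain ⟨p, hp, hf⟩ := (key f).1 hf
    obtain ⟨q, hq, hg⟩ := (key g).1 hg
    by_cases hpq : p.2 = q.2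
    · have hpq' : p = q := by
        exact Multiset.inj_on_of_nodup_map h.nodup p hp q hq hpq
      subst hpq'
      exact (hm p hp).perp f hf g hg hfg
    · exact perp_mono₂ (h.perp _ (Multiset.mem_map_of_mem _ hp) _ (Multiset.mem_map_of_mem _ hq) hpq)
        ((hm p hp).le f hf) ((hm q hq).le g hg)
  · intro x hx hxe
    obtain ⟨f, hf, hxf⟩ := h.cover x hx hxe
    obtain ⟨p, hp, rfl⟩ := Multiset.mem_map.1 hf
    obtain ⟨g, hg, hxg⟩ := (hm p hp).cover x hx hxf
    exact ⟨g, (key g).2 ⟨p, hp, hg⟩, hxg⟩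

variable (B)

/-- The broad poset of a box poset. -/
def broad : PreBroadPoset E where
  rel := B.Below
  refl := Below.singleton
  trans := Below.subst

/-- The product of two box posets. -/
def prod {F : Type v} (B : Box E) (C : Box F) : Box (E × F) where
  le a b := B.le a.1 b.1 ∧ C.le a.2 b.2
  refl a := ⟨B.refl _, C.refl _⟩
  trans h h' := ⟨B.trans h.1 h'.1, C.trans h.2 h'.2⟩
  antisymm h h' := Prod.ext (B.antisymm h.1 h'.1) (C.antisymm h.2 h'.2)
  perp a b := B.perp a.1 b.1 ∨ C.perp a.2 b.2
  perp_symm h := h.imp B.perp_symm C.perp_symm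
  perp_mono h h' := h.imp (fun h => B.perp_mono h h'.1) (fun h => C.perp_mono h h'.2)
  not_perp h := fun h' => h'.elim (B.not_perp h.1) (C.not_perp h.2)
  leaf a := B.leaf a.1 ∧ C.leaf a.2

/-- The disjoint union of copies of a box poset. -/
def copies (I : Type v) : Box (I × E) where
  le a b := a.1 = b.1 ∧ B.le a.2 b.2
  refl a := ⟨rfl, B.refl _⟩
  trans h h' := ⟨h.1.trans h'.1, B.trans h.2 h'.2⟩
  antisymm h h' := Prod.ext h.1 (B.antisymm h.2 h'.2)
  perp a b := a.1 ≠ b.1 ∨ B.perp a.2 b.2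
  perp_symm h := h.imp Ne.symm B.perp_symm
  perp_mono h h' := h.imp (fun h => by rwa [h'.1]) (fun h => B.perp_mono h h'.2)
  not_perp h := fun h' => h'.elim (fun h' => h' h.1) (B.not_perp h.2)
  leaf a := B.leaf a.2

/-- A box poset with another set of marked elements. -/
def withLeaf (L : E → Prop) : Box E where
  __ := B
  leaf := L

theorem copies_below_iff (I : Type v) (s : Multiset (I × E)) (e : I × E) :
    (B.copies I).Below s e ↔ B.Below (s.map Prod.snd) e.2 ∧ ∀ x ∈ s, x.1 = e.1 := by
  constructor
  · intro h
    have h1 : ∀ x ∈ s, x.1 = e.1 := fun x hx => (h.le x hx).1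
    refine ⟨⟨?_, ?_, ?_, ?_⟩, h1⟩
    · refine Multiset.Nodup.map_on ?_ h.nodup
      intro x hx y hy hxy
      exact Prod.ext ((h1 x hx).trans (h1 y hy).symm) hxy
    · intro f hf
      obtain ⟨x, hx, rfl⟩ := Multiset.mem_map.1 hf
      exact (h.le x hx).2
    · intro f hf g hg hfg
      obtain ⟨x, hx, rfl⟩ := Multiset.mem_map.1 hf
      obtain ⟨y, hy, rfl⟩ := Multiset.mem_map.1 hg
      rcases h.perp x hx y hy (fun h => hfg (by rw [h])) with h' | h'
      · exact absurd ((h1 x hx).trans (h1 y hy).symm) h'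
      · exact h'
    · intro p hp hpe
      obtain ⟨x, hx, hpx⟩ := h.cover (e.1, p) hp ⟨rfl, hpe⟩
      exact ⟨x.2, Multiset.mem_map_of_mem _ hx, hpx.2⟩
  · rintro ⟨h, h1⟩
    refine ⟨Multiset.Nodup.of_map _ h.nodup, ?_, ?_, ?_⟩
    · exact fun x hx => ⟨h1 x hx, h.le _ (Multiset.mem_map_of_mem _ hx)⟩
    · intro x hx y hy hxy
      refine Or.inr (h.perp _ (Multiset.mem_map_of_mem _ hx) _ (Multiset.mem_map_of_mem _ hy) ?_)
      exact fun h => hxy (Prod.ext ((h1 x hx).trans (h1 y hy).symm) h)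
    · intro p hp hpe
      obtain ⟨f, hf, hpf⟩ := h.cover p.2 hp hpe.2
      obtain ⟨x, hx, rfl⟩ := Multiset.mem_map.1 hf
      exact ⟨x, hx, hpe.1.trans (h1 x hx).symm, hpf⟩

end Basic

end Box

/-! ### The structure of forests -/

namespace PreBroadPoset

section Comap

/-- The pre-broad poset structure induced by a map. -/
def comap {E : Type u} {F : Type v} (f : E → F) (Q : PreBroadPoset F) : PreBroadPoset E where
  rel s e := Q.rel (s.map f) (f e)
  refl e := by simpa using Q.refl (f e)
  trans := by
    intro m e hm h
    have := Q.trans (m.map (fun p => (p.1.map f, f p.2))) (f e)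
      (by
        intro p hp
        obtain ⟨q, hq, rfl⟩ := Multiset.mem_map.1 hp
        exact hm q hq)
      (by simpa [Multiset.map_map, Function.comp_def] using h)
    have key : ∀ m : Multiset (Multiset E × E),
        ((m.map Prod.fst).sum).map f = (m.map (fun p => p.1.map f)).sum := by
      intro m
      induction m using Multiset.induction_on with
      | empty => simp
      | cons a m ih => simp [ih]
    rw [key]
    simpa [Multiset.map_map, Function.comp_def] using this

end Comap

variable {E : Type u} {P : PreBroadPoset E}

/-- Broad transitivity with reflexive relations in all the other slots. -/
theorem rel_subst {f e : E} {s t : Multiset E} (h : P.rel (f ::ₘ s) e) (h' : P.rel t f) :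
    P.rel (t + s) e := by
  have := P.trans ((t, f) ::ₘ s.map (fun x => ({x}, x))) e
    (by
      intro p hp
      rcases Multiset.mem_cons.1 hp with rfl | hp
      · exact h'
      · obtain ⟨x, -, rfl⟩ := Multiset.mem_map.1 hp
        exact P.refl x)
    (by simpa [Multiset.map_map, Function.comp_def] using h)
  simpa [Multiset.map_map, Function.comp_def, Multiset.sum_map_singleton] using this

theorem rel_subst' {f e : E} {s t : Multiset E} (hf : f ∈ s) (h : P.rel s e) (h' : P.rel t f) :
    ∃ r, s = f ::ₘ r ∧ P.rel (t + r) e := by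
  obtain ⟨r, rfl⟩ := Multiset.exists_cons_of_mem hf
  exact ⟨r, rfl, rel_subst h h'⟩

theorem Desc.refl (e : E) : P.Desc e e := ⟨{e}, by simp, P.refl e⟩

theorem Desc.trans {a b c : E} (h : P.Desc a b) (h' : P.Desc b c) : P.Desc a c := by
  obtain ⟨s, hs, h⟩ := h
  obtain ⟨t, ht, h'⟩ := h'
  obtain ⟨r, -, h''⟩ := rel_subst' ht h' h
  exact ⟨_, by simp [hs], h''⟩

/-- Substituting the relation into itself repeats every member of `s`, so simplicity leaves none. -/
theorem IsSimple.eq_zero (hS : P.IsSimple) {e : E} {s : Multiset E} (h : P.rel (e ::ₘ s) e) :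
    s = 0 := by
  have h' := hS _ _ (rel_subst h h)
  rw [Multiset.cons_add, Multiset.nodup_cons, Multiset.nodup_add] at h'
  exact disjoint_self.1 h'.2.2.2

/-- The composite relation has its target among its inputs, so all side inputs vanish and
antisymmetry for single edges applies. -/
theorem Desc.antisymm (hA : P.IsAntisymm) (hS : P.IsSimple) {a b : E} (h : P.Desc a b)
    (h' : P.Desc b a) : a = b := by
  obtain ⟨s, hs, h⟩ := h
  obtain ⟨t, ht, h'⟩ := h'
  obtain ⟨s, rfl⟩ := Multiset.exists_cons_of_mem hs
  obtain ⟨t, rfl⟩ := Multiset.exists_cons_of_mem ht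
  have h1 := rel_subst h h'
  rw [Multiset.cons_add] at h1
  have h2 := hS.eq_zero h1
  obtain ⟨rfl, rfl⟩ := add_eq_zero.1 h2
  exact hA _ _ h h'

theorem IsTree.isForest (h : P.IsTree) : P.IsForest where
  finite := h.finite
  antisymm := h.antisymm
  simple := h.simple
  nodal := h.nodal
  root e := by
    obtain ⟨r, hr⟩ := h.root
    refine ⟨r, ⟨fun e he => ?_, hr e⟩, fun r' h' => ?_⟩
    · exact Desc.antisymm h.antisymm h.simple (hr e) he
    · exact (h'.1 r (hr r')).symm

namespace IsForest

variable (h : P.IsForest)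
include h

theorem desc_antisymm {a b : E} (h₁ : P.Desc a b) (h₂ : P.Desc b a) : a = b :=
  Desc.antisymm h.antisymm h.simple h₁ h₂

theorem wf : WellFounded (fun a b => P.Desc a b ∧ a ≠ b) := by
  have := h.finite
  have : IsTrans E (fun a b => P.Desc a b ∧ a ≠ b) := ⟨fun a b c hab hbc =>
    ⟨hab.1.trans hbc.1, fun hac => hab.2 (h.desc_antisymm hab.1 (hac ▸ hbc.1))⟩⟩
  have : Std.Irrefl (fun a b => P.Desc a b ∧ a ≠ b) := ⟨fun a ha => ha.2 rfl⟩
  exact Finite.wellFounded_of_trans_of_irrefl _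

omit h in
theorem eq_of_desc_leaf {l x : E} (hl : P.IsLeaf l) (hx : P.Desc x l) : x = l := by
  obtain ⟨s, hs, hr⟩ := hx
  by_contra hne
  refine hl s ⟨hr, ?_⟩
  rintro rfl
  exact hne (by simpa using hs)

/-- Expanding both inputs down to a common descendant would repeat it, against simplicity. -/
theorem not_rel_desc {e f g : E} {s : Multiset E} (hs : P.rel (f ::ₘ s) e) (hg : g ∈ s)
    {x : E} (hf : P.Desc x f) (hg' : P.Desc x g) : False := by
  obtain ⟨u, hu, hf⟩ := hf
  obtain ⟨v, hv, hg'⟩ := hg'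
  obtain ⟨s, rfl⟩ := Multiset.exists_cons_of_mem hg
  have h1 := rel_subst hs hf
  rw [Multiset.add_cons] at h1
  have h2 := h.simple _ _ (rel_subst h1 hg')
  rw [Multiset.nodup_add] at h2
  exact Multiset.disjoint_left.1 h2.2.2 hv (by simp [hu])

theorem eq_of_desc {e f g : E} {s : Multiset E} (hs : P.rel s e) (hf : f ∈ s) (hg : g ∈ s)
    {x : E} (hxf : P.Desc x f) (hxg : P.Desc x g) : f = g := by
  by_contra hne
  obtain ⟨s, rfl⟩ := Multiset.exists_cons_of_mem hf
  exact h.not_rel_desc hs ((Multiset.mem_cons.1 hg).resolve_left (Ne.symm hne)) hxf hxg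

/-- The maximal relation below an edge that is not a leaf. -/
theorem exists_vertex {e : E} (he : ¬ P.IsLeaf e) :
    ∃ m, P.rel m e ∧ e ∉ m ∧ ∀ t, P.Lt t e → P.TupleLE t m := by
  have key : ∀ m, P.Lt m e → e ∉ m := by
    rintro m ⟨hm, hne⟩ hem
    obtain ⟨s, rfl⟩ := Multiset.exists_cons_of_mem hem
    rw [h.simple.eq_zero hm] at hne
    exact hne rfl
  rcases h.nodal e with h' | ⟨m, -, hm, hmax⟩ | ⟨hm, hmax⟩
  · exact absurd h' he
  · exact ⟨m, hm.1, key m hm, hmax⟩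
  · exact ⟨0, hm.1, key 0 hm, hmax⟩

omit h in
theorem desc_vertex {e : E} {m : Multiset E} (hmax : ∀ t, P.Lt t e → P.TupleLE t m) {x : E}
    (hx : P.Desc x e) (hne : x ≠ e) : ∃ i ∈ m, P.Desc x i := by
  obtain ⟨s, hs, hr⟩ := hx
  obtain ⟨q, hq, rfl, rfl⟩ := hmax s ⟨hr, by rintro rfl; exact hne (by simpa using hs)⟩
  change x ∈ Multiset.join _ at hs
  obtain ⟨t, ht, hxt⟩ := Multiset.mem_join.1 hs
  obtain ⟨p, hp, rfl⟩ := Multiset.mem_map.1 ht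
  exact ⟨p.2, Multiset.mem_map_of_mem _ hp, p.1, hxt, hq p hp⟩

/-- Induction down from `e`: both edges lie under inputs of the vertex at `e`, and these inputs
coincide because they share the descendant `x`. -/
theorem desc_total_of_desc {e x a b : E} (ha : P.Desc a e) (hb : P.Desc b e) (hxa : P.Desc x a)
    (hxb : P.Desc x b) : P.Desc a b ∨ P.Desc b a := by
  induction e using h.wf.induction with
  | _ e ih =>
    by_cases hae : a = e
    · subst hae; exact Or.inr hb
    by_cases hbe : b = e
    · subst hbe; exact Or.inl ha
    have he : ¬ P.IsLeaf e := fun hl => hae (eq_of_desc_leaf hl ha)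
    obtain ⟨m, hm, hem, hmax⟩ := h.exists_vertex he
    obtain ⟨i, hi, hai⟩ := desc_vertex hmax ha hae
    obtain ⟨j, hj, hbj⟩ := desc_vertex hmax hb hbe
    obtain rfl := h.eq_of_desc hm hi hj (hxa.trans hai) (hxb.trans hbj)
    exact ih i ⟨⟨m, hi, hm⟩, by rintro rfl; exact hem hi⟩ hai hbj

/-- Uniqueness of the root above `x` puts `a` and `b` below the same edge. -/
theorem desc_total {x a b : E} (hxa : P.Desc x a) (hxb : P.Desc x b) :
    P.Desc a b ∨ P.Desc b a := by
  obtain ⟨r, hr, -⟩ := h.root a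
  obtain ⟨r', hr', -⟩ := h.root b
  obtain ⟨q, -, hq⟩ := h.root x
  have h1 := hq r ⟨hr.1, hxa.trans hr.2⟩
  have h2 := hq r' ⟨hr'.1, hxb.trans hr'.2⟩
  subst h1
  subst h2
  exact h.desc_total_of_desc hr.2 hr'.2 hxa hxb

/-- The box poset of a forest. -/
def box : Box E where
  le := P.Desc
  refl := Desc.refl
  trans := Desc.trans
  antisymm := h.desc_antisymm
  perp a b := ¬ P.Desc a b ∧ ¬ P.Desc b a
  perp_symm h := ⟨h.2, h.1⟩
  perp_mono := by
    intro a b a' hab ha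
    refine ⟨fun h' => ?_, fun h' => hab.2 (h'.trans ha)⟩
    rcases h.desc_total ha h' with h'' | h''
    · exact hab.1 h''
    · exact hab.2 h''
  not_perp h h' := h'.1 h
  leaf := P.IsLeaf

/-- A nontrivial relation factors through the vertex at `e`, so the leaf can be followed into one
input of the vertex, where induction applies. -/
theorem cover_of_rel {l e : E} (hl : P.IsLeaf l) {s : Multiset E} (hs : P.rel s e)
    (hle : P.Desc l e) : ∃ f ∈ s, P.Desc l f := by
  induction e using h.wf.induction generalizing s with
  | _ e ih =>
    by_cases hse : s = {e}
    · exact ⟨e, by simp [hse], hle⟩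
    have he : ¬ P.IsLeaf e := fun hl => hl s ⟨hs, hse⟩
    obtain ⟨m, hm, hem, hmax⟩ := h.exists_vertex he
    obtain ⟨i, hi, hli⟩ := desc_vertex hmax hle (by rintro rfl; exact he hl)
    obtain ⟨q, hq, rfl, rfl⟩ := hmax s ⟨hs, hse⟩
    obtain ⟨p, hp, rfl⟩ := Multiset.mem_map.1 hi
    obtain ⟨f, hf, hlf⟩ := ih p.2 ⟨⟨_, hi, hm⟩, by rintro rfl; exact hem hi⟩ (hq p hp) hli
    exact ⟨f, Multiset.mem_join.2 ⟨p.1, Multiset.mem_map_of_mem _ hp, hf⟩, hlf⟩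

end IsForest

end PreBroadPoset

open PreBroadPoset

/-- Splitting a tuple along a tuple of elements above. -/
theorem Multiset.sum_filter_eq {E : Type u} {F : Type v} (r : E → F → Prop)
    [∀ j, DecidablePred (fun x => r x j)] (s : Multiset E)
    (m : Multiset F) (hm : m.Nodup) (hex : ∀ x ∈ s, ∃ i ∈ m, r x i)
    (huniq : ∀ x ∈ s, ∀ i ∈ m, ∀ j ∈ m, r x i → r x j → i = j) :
    (m.map (fun i => s.filter (fun x => r x i))).sum = s := by
  classical
  induction s using Multiset.induction_on with
  | empty => simp
  | cons a s ih =>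
    have ih := ih (fun x hx => hex x (Multiset.mem_cons_of_mem hx))
      (fun x hx => huniq x (Multiset.mem_cons_of_mem hx))
    obtain ⟨i, hi, hai⟩ := hex a (Multiset.mem_cons_self a s)
    have h1 : ∀ j ∈ m, (a ::ₘ s).filter (fun x => r x j) =
        (if j = i then {a} else 0) + s.filter (fun x => r x j) := by
      intro j hj
      by_cases hji : j = i
      · subst hji
        simp [hai]
      · have : ¬ r a j := fun haj =>
          hji (huniq a (Multiset.mem_cons_self a s) j hj i hi haj hai)
        simp [this, hji]
    rw [Multiset.map_congr rfl h1, Multiset.sum_map_add, ih]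
    have : (m.map (fun j => if j = i then ({a} : Multiset E) else 0)).sum = {a} := by
      obtain ⟨m, rfl⟩ := Multiset.exists_cons_of_mem hi
      rw [Multiset.nodup_cons] at hm
      rw [Multiset.map_cons, Multiset.sum_cons, if_pos rfl, Multiset.map_congr rfl
        (g := fun _ => (0 : Multiset E)) (fun j hj => if_neg (by rintro rfl; exact hm.1 hj))]
      simp
    rw [this, Multiset.singleton_add]

namespace PreBroadPoset.IsForest

variable {E : Type u} {P : PreBroadPoset E} (h : P.IsForest)
include h

theorem below_of_rel {s : Multiset E} {e : E} (hs : P.rel s e) : h.box.Below s e where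
  nodup := h.simple s e hs
  le f hf := ⟨s, hf, hs⟩
  perp f hf g hg hne := ⟨fun hfg => hne (h.eq_of_desc hs hf hg (Desc.refl f) hfg),
    fun hgf => hne (h.eq_of_desc hs hf hg hgf (Desc.refl g))⟩
  cover p hp hpe := h.cover_of_rel hp hs hpe

/-- The vertex below an edge that is not a leaf, splitting tuples of smaller edges. -/
theorem exists_split {e : E} (he : ¬ P.IsLeaf e) :
    ∃ m : Multiset E, P.rel m e ∧ (∀ i ∈ m, P.Desc i e ∧ i ≠ e) ∧
      (∀ x, P.Desc x e → x ≠ e → ∃ i ∈ m, P.Desc x i) ∧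
      (∀ x, ∀ i ∈ m, ∀ j ∈ m, P.Desc x i → P.Desc x j → i = j) := by
  obtain ⟨m, hm, hem, hmax⟩ := h.exists_vertex he
  refine ⟨m, hm, fun i hi => ⟨⟨m, hi, hm⟩, by rintro rfl; exact hem hi⟩,
    fun x => desc_vertex hmax, fun x i hi j hj => h.eq_of_desc hm hi hj⟩

/-- Induction on `e`: the tuple splits into the blocks under the inputs of the vertex, each block
satisfies the same conditions there, and broad transitivity reassembles them. -/
theorem rel_of_below {s : Multiset E} {e : E} (hs : h.box.Below s e) : P.rel s e := by
  classical
  induction e using h.wf.induction generalizing s with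
  | _ e ih =>
    by_cases hes : e ∈ s
    · rw [hs.eq_singleton hes]
      exact P.refl e
    have he : ¬ P.IsLeaf e := by
      intro hl
      obtain ⟨f, hf, hef⟩ := hs.cover e hl (Desc.refl e)
      exact hes (h.desc_antisymm hef (hs.le f hf) ▸ hf)
    obtain ⟨m, hm, hme, hex, huniq⟩ := h.exists_split he
    have hex' : ∀ x ∈ s, ∃ i ∈ m, P.Desc x i := fun x hx =>
      hex x (hs.le x hx) (by rintro rfl; exact hes hx)
    have key := Multiset.sum_filter_eq P.Desc s m (h.simple _ _ hm) hex'
      (fun x _ => huniq x)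
    have := P.trans (m.map (fun i => (s.filter (fun x => P.Desc x i), i))) e
      (by
        intro p hp
        obtain ⟨i, hi, rfl⟩ := Multiset.mem_map.1 hp
        refine ih i (hme i hi) ⟨hs.nodup.filter _, fun f hf => (Multiset.mem_filter.1 hf).2,
          fun f hf g hg => hs.perp f (Multiset.mem_filter.1 hf).1 g (Multiset.mem_filter.1 hg).1,
          fun p hp hpi => ?_⟩
        obtain ⟨f, hf, hpf⟩ := hs.cover p hp (Desc.trans hpi (hme i hi).1)
        obtain ⟨j, hj, hfj⟩ := hex' f hf
        obtain rfl := huniq p i hi j hj hpi (Desc.trans hpf hfj)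
        exact ⟨f, Multiset.mem_filter.2 ⟨hf, hfj⟩, hpf⟩)
      (by simpa [Multiset.map_map, Function.comp_def] using hm)
    simp only [Multiset.map_map, Function.comp_def] at this
    rwa [key] at this

theorem rel_iff {s : Multiset E} {e : E} : P.rel s e ↔ h.box.Below s e :=
  ⟨h.below_of_rel, h.rel_of_below⟩

end PreBroadPoset.IsForest


/-! ### Forests spanned by nested families in a box poset -/

namespace Box

theorem exists_maximal {E : Type u} [Finite E] (B : Box E) (p : E → Prop) {a : E} (ha : p a) :
    ∃ b, B.le a b ∧ p b ∧ ∀ c, p c → B.le b c → c = b := by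
  let _ : PartialOrder E :=
    { le := B.le, le_refl := B.refl, le_trans := fun _ _ _ => B.trans,
      le_antisymm := fun _ _ => B.antisymm }
  obtain ⟨b, hab, hb, hmax⟩ := (Set.toFinite {x | p x}).exists_le_maximal ha
  exact ⟨b, hab, hb, fun c hc hbc => le_antisymm (hmax hc hbc) hbc⟩

theorem exists_minimal {E : Type u} [Finite E] (B : Box E) (p : E → Prop) {a : E} (ha : p a) :
    ∃ b, B.le b a ∧ p b ∧ ∀ c, p c → B.le c b → c = b := by
  let _ : PartialOrder E :=
    { le := B.le, le_refl := B.refl, le_trans := fun _ _ _ => B.trans,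
      le_antisymm := fun _ _ => B.antisymm }
  obtain ⟨b, hab, hb, hmax⟩ := (Set.toFinite {x | p x}).exists_le_minimal ha
  exact ⟨b, hab, hb, fun c hc hbc => le_antisymm hbc (hmax hc hbc)⟩

/-- A family of elements of a box poset that spans a forest: any two of them are comparable or
disjoint, and every marked element below one of them is below a minimal one. -/
structure IsNested {D : Type u} {F : Type v} (Q : Box F) (f : D → F) : Prop where
  inj : Function.Injective f
  comp : ∀ a b, Q.le (f a) (f b) ∨ Q.le (f b) (f a) ∨ Q.perp (f a) (f b)
  cover : ∀ d p, Q.leaf p → Q.le p (f d) →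
    ∃ d', Q.le p (f d') ∧ ∀ c, Q.le (f c) (f d') → c = d'

namespace IsNested

variable {D : Type u} {F : Type v} {Q : Box F} {f : D → F} (hf : Q.IsNested f)

/-- The box poset of a nested family. -/
def box : Box D where
  le a b := Q.le (f a) (f b)
  refl a := Q.refl _
  trans h h' := Q.trans h h'
  antisymm h h' := hf.inj (Q.antisymm h h')
  perp a b := Q.perp (f a) (f b)
  perp_symm h := Q.perp_symm h
  perp_mono h h' := Q.perp_mono h h'
  not_perp h := Q.not_perp h
  leaf d := (∀ c, Q.le (f c) (f d) → c = d) ∧ ∃ p, Q.leaf p ∧ Q.le p (f d)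

include hf

theorem total {a b : D} {x : F} (ha : Q.le x (f a)) (hb : Q.le x (f b)) :
    Q.le (f a) (f b) ∨ Q.le (f b) (f a) := by
  rcases hf.comp a b with h | h | h
  · exact Or.inl h
  · exact Or.inr h
  · exact absurd h (not_perp_of_le ha hb)

theorem exists_leaf {d : D} {p : F} (hp : Q.leaf p) (hpd : Q.le p (f d)) :
    ∃ l, hf.box.leaf l ∧ hf.box.le l d ∧ Q.le p (f l) := by
  obtain ⟨l, hpl, hl⟩ := hf.cover d p hp hpd
  refine ⟨l, ⟨hl, p, hp, hpl⟩, ?_, hpl⟩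
  rcases hf.total hpl hpd with h | h
  · exact h
  · rw [hl d h]
    exact Q.refl _

/-- Marked elements of `Q` and leaves of the family impose the same covering condition: every marked
element below a member is below a leaf of the family, and every such leaf is above a marked element.
-/
theorem below_iff (s : Multiset D) (e : D) : Q.Below (s.map f) (f e) ↔ hf.box.Below s e := by
  constructor
  · intro h
    refine ⟨Multiset.Nodup.of_map _ h.nodup, fun x hx => h.le _ (Multiset.mem_map_of_mem _ hx),
      fun x hx y hy hxy => h.perp _ (Multiset.mem_map_of_mem _ hx) _
        (Multiset.mem_map_of_mem _ hy) (fun h => hxy (hf.inj h)), ?_⟩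
    rintro l ⟨hl, p, hp, hpl⟩ hle
    obtain ⟨x, hx, hpx⟩ := h.cover p hp (Q.trans hpl hle)
    obtain ⟨x, hx', rfl⟩ := Multiset.mem_map.1 hx
    refine ⟨x, hx', ?_⟩
    rcases hf.total hpl hpx with h' | h'
    · exact h'
    · rw [hl x h']
      exact Q.refl _
  · intro h
    refine ⟨h.nodup.map hf.inj, ?_, ?_, ?_⟩
    · intro x hx
      obtain ⟨x, hx', rfl⟩ := Multiset.mem_map.1 hx
      exact h.le x hx'
    · intro x hx y hy hxy
      obtain ⟨x, hx', rfl⟩ := Multiset.mem_map.1 hx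
      obtain ⟨y, hy', rfl⟩ := Multiset.mem_map.1 hy
      exact h.perp x hx' y hy' (fun h => hxy (h ▸ rfl))
    · intro p hp hpe
      obtain ⟨l, hl, hle, hpl⟩ := hf.exists_leaf hp hpe
      obtain ⟨x, hx, hlx⟩ := h.cover l hl hle
      exact ⟨f x, Multiset.mem_map_of_mem _ hx, Q.trans hpl hlx⟩

variable [Finite D]

/-- The tuple consists of `a` and the leaves under `b` that are not under `a`. -/
theorem exists_below {a b : D} (hab : hf.box.le a b) : ∃ s, a ∈ s ∧ hf.box.Below s b := by
  classical
  have := Fintype.ofFinite D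
  refine ⟨(Finset.univ.filter (fun c => c = a ∨ (hf.box.leaf c ∧ hf.box.le c b ∧
    ¬ hf.box.le c a))).val, by simp, Finset.nodup _, ?_, ?_, ?_⟩
  · intro c hc
    simp only [Finset.filter_val, Multiset.mem_filter, Finset.mem_val, Finset.mem_univ, true_and]
      at hc
    rcases hc with rfl | hc
    · exact hab
    · exact hc.2.1
  · intro c hc d hd hcd
    simp only [Finset.filter_val, Multiset.mem_filter, Finset.mem_val, Finset.mem_univ, true_and]
      at hc hd
    have hcomp : hf.box.le c d ∨ hf.box.le d c ∨ hf.box.perp c d := hf.comp c d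
    rcases hc with rfl | hc <;> rcases hd with rfl | hd
    · exact absurd rfl hcd
    · rcases hcomp with h | h | h
      · exact absurd (hd.1.1 c h) hcd
      · exact absurd h hd.2.2
      · exact h
    · rcases hcomp with h | h | h
      · exact absurd h hc.2.2
      · exact absurd (hc.1.1 d h).symm hcd
      · exact h
    · rcases hcomp with h | h | h
      · exact absurd (hd.1.1 c h) hcd
      · exact absurd (hc.1.1 d h).symm hcd
      · exact h
  · intro p hp hpb
    by_cases hpa : hf.box.le p a
    · exact ⟨a, by simp, hpa⟩
    · exact ⟨p, by simp [hp, hpb, hpa], hf.box.refl p⟩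

theorem desc_iff {a b : D} : (comap f Q.broad).Desc a b ↔ Q.le (f a) (f b) := by
  constructor
  · rintro ⟨s, hs, h⟩
    exact h.le _ (Multiset.mem_map_of_mem _ hs)
  · intro hab
    obtain ⟨s, hs, h⟩ := hf.exists_below hab
    exact ⟨s, hs, (hf.below_iff s b).2 h⟩

omit [Finite D] in
theorem rel_iff {s : Multiset D} {e : D} : (comap f Q.broad).rel s e ↔ hf.box.Below s e :=
  hf.below_iff s e

/-- A minimal element with no marked element below it admits the empty tuple, so it is a stump; this
explains the second clause in the leaves of `IsNested.box`. -/
theorem isLeaf_iff {d : D} : (comap f Q.broad).IsLeaf d ↔ hf.box.leaf d := by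
  constructor
  · intro h
    have hmin : ∀ c, hf.box.le c d → c = d := by
      intro c hc
      obtain ⟨s, hs, hs'⟩ := hf.exists_below hc
      by_contra hne
      refine h s ⟨hf.rel_iff.2 hs', ?_⟩
      rintro rfl
      exact hne (by simpa using hs)
    refine ⟨hmin, ?_⟩
    by_contra hno
    refine h 0 ⟨hf.rel_iff.2 ⟨by simp, by simp, by simp, ?_⟩, by simp⟩
    rintro p ⟨hp, q, hq, hqp⟩ hpd
    exact absurd ⟨q, hq, Q.trans hqp hpd⟩ hno
  · rintro hd s ⟨hs, hne⟩
    have hs := hf.rel_iff.1 hs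
    obtain ⟨x, hx, hdx⟩ := hs.cover d hd (Q.refl _)
    obtain rfl : x = d := hd.1 x (hs.le x hx)
    exact hne (hs.eq_singleton hx)

theorem isForest : (comap f Q.broad).IsForest where
  finite := inferInstance
  antisymm a b hab hba := by
    have h1 := (hf.rel_iff.1 hab).le a (by simp)
    have h2 := (hf.rel_iff.1 hba).le b (by simp)
    exact hf.box.antisymm h1 h2
  simple s e h := (hf.rel_iff.1 h).nodup
  root e := by
    obtain ⟨r, her, -, hr⟩ := hf.box.exists_maximal (fun _ => True) (a := e) trivial
    refine ⟨r, ⟨fun x hx => hr x trivial (hf.desc_iff.1 hx), hf.desc_iff.2 her⟩, ?_⟩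
    rintro r' ⟨hr', her'⟩
    rcases hf.total her (hf.desc_iff.1 her') with h | h
    · exact hr r' trivial h
    · exact (hr' r (hf.desc_iff.2 h)).symm
  nodal e := by
    classical
    have := Fintype.ofFinite D
    by_cases he : hf.box.leaf e
    · exact Or.inl (hf.isLeaf_iff.2 he)
    -- The candidate vertex: the maximal elements strictly below `e`. If there are none, `e` is a
    -- stump.
    let m : Finset D := Finset.univ.filter (fun x => (hf.box.le x e ∧ x ≠ e) ∧
      ∀ c, (hf.box.le c e ∧ c ≠ e) → hf.box.le x c → c = x)
    have hm : ∀ x, x ∈ m.val ↔ (hf.box.le x e ∧ x ≠ e) ∧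
        ∀ c, (hf.box.le c e ∧ c ≠ e) → hf.box.le x c → c = x := by
      intro x
      simp [m]
    have hex : ∀ x, hf.box.le x e → x ≠ e → ∃ i ∈ m.val, hf.box.le x i := by
      intro x hx hne
      obtain ⟨i, hxi, hi, hi'⟩ := hf.box.exists_maximal (fun c => hf.box.le c e ∧ c ≠ e) ⟨hx, hne⟩
      exact ⟨i, (hm i).2 ⟨hi, hi'⟩, hxi⟩
    have huniq : ∀ x, ∀ i ∈ m.val, ∀ j ∈ m.val, hf.box.le x i → hf.box.le x j → i = j := by
      intro x i hi j hj hxi hxj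
      rcases hf.total hxi hxj with h | h
      · exact (((hm i).1 hi).2 j ((hm j).1 hj).1 h).symm
      · exact ((hm j).1 hj).2 i ((hm i).1 hi).1 h
    have hlt : (comap f Q.broad).Lt m.val e := by
      constructor
      · rw [hf.rel_iff]
        refine ⟨m.nodup, fun x hx => ((hm x).1 hx).1.1, ?_, ?_⟩
        · intro x hx y hy hxy
          rcases hf.comp x y with h | h | h
          · exact absurd (huniq x x hx y hy (Q.refl _) h) hxy
          · exact absurd (huniq y x hx y hy h (Q.refl _)) hxy
          · exact h
        · intro p hp hpe
          exact hex p hpe (by rintro rfl; exact he hp)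
      · intro h
        have : e ∈ m.val := by rw [h]; simp
        exact ((hm e).1 this).1.2 rfl
    have hmax : ∀ t, (comap f Q.broad).Lt t e → (comap f Q.broad).TupleLE t m.val := by
      rintro t ⟨ht, hne⟩
      have ht := hf.rel_iff.1 ht
      have het : e ∉ t := fun h => hne (ht.eq_singleton h)
      have hex' : ∀ x ∈ t, ∃ i ∈ m.val, hf.box.le x i := fun x hx =>
        hex x (ht.le x hx) (by rintro rfl; exact het hx)
      refine ⟨m.val.map (fun i => (t.filter (fun x => hf.box.le x i), i)), ?_, ?_, ?_⟩
      · intro p hp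
        obtain ⟨i, hi, rfl⟩ := Multiset.mem_map.1 hp
        have hi' := (hm i).1 hi
        refine hf.rel_iff.2 ⟨ht.nodup.filter _, fun f hf => (Multiset.mem_filter.1 hf).2,
          fun f hf g hg => ht.perp f (Multiset.mem_filter.1 hf).1 g (Multiset.mem_filter.1 hg).1,
          fun p hp hpi => ?_⟩
        obtain ⟨x, hx, hpx⟩ := ht.cover p hp (hf.box.trans hpi hi'.1.1)
        obtain ⟨j, hj, hxj⟩ := hex' x hx
        obtain rfl := huniq p i hi j hj hpi (hf.box.trans hpx hxj)
        exact ⟨x, Multiset.mem_filter.2 ⟨hx, hxj⟩, hpx⟩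
      · simp only [Multiset.map_map, Function.comp_def]
        exact (Multiset.sum_filter_eq hf.box.le t m.val m.nodup hex' (fun x _ => huniq x)).symm
      · simp [Multiset.map_map]
    by_cases h0 : m.val = 0
    · exact Or.inr (Or.inr ⟨h0 ▸ hlt, h0 ▸ hmax⟩)
    · exact Or.inr (Or.inl ⟨m.val, h0, hlt, hmax⟩)

theorem isTree (r : D) (hr : ∀ d, Q.le (f d) (f r)) : (comap f Q.broad).IsTree where
  finite := inferInstance
  antisymm := hf.isForest.antisymm
  simple := hf.isForest.simple
  nodal := hf.isForest.nodal
  root := ⟨r, fun d => hf.desc_iff.2 (hr d)⟩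

end IsNested

end Box

/-! ### The tensor product of forests as a box poset -/

namespace PreBroadPoset

section Tensor

variable {E : Type u} {F : Type v} {P : PreBroadPoset E} {Q : PreBroadPoset F}
  (hP : P.IsForest) (hQ : Q.IsForest)

include hP hQ in
theorem below_of_tensor_rel {s : Multiset (E × F)} {e : E × F} (h : (tensor P Q).rel s e) :
    (hP.box.prod hQ.box).Below s e := by
  have h' : Gen (TensorRel P Q) s e := h
  clear h
  induction h' with
  | refl e => exact Box.Below.singleton e
  | trans m e _ _ ih₁ ih₂ => exact Box.Below.subst m e ih₁ ih₂
  | of s e h =>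
    rcases h with ⟨s, a, b, h⟩ | ⟨a, t, b, h⟩
    · have h := hP.below_of_rel h
      refine ⟨h.nodup.map (fun x y hxy => congrArg Prod.fst hxy), ?_, ?_, ?_⟩
      · intro x hx
        obtain ⟨x, hx', rfl⟩ := Multiset.mem_map.1 hx
        exact ⟨h.le x hx', hQ.box.refl b⟩
      · intro x hx y hy hxy
        obtain ⟨x, hx', rfl⟩ := Multiset.mem_map.1 hx
        obtain ⟨y, hy', rfl⟩ := Multiset.mem_map.1 hy
        exact Or.inl (h.perp x hx' y hy' (by rintro rfl; exact hxy rfl))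
      · rintro p hp hpe
        obtain ⟨x, hx, hpx⟩ := h.cover p.1 hp.1 hpe.1
        exact ⟨(x, b), Multiset.mem_map_of_mem _ hx, hpx, hpe.2⟩
    · have h := hQ.below_of_rel h
      refine ⟨h.nodup.map (fun x y hxy => congrArg Prod.snd hxy), ?_, ?_, ?_⟩
      · intro x hx
        obtain ⟨x, hx', rfl⟩ := Multiset.mem_map.1 hx
        exact ⟨hP.box.refl a, h.le x hx'⟩
      · intro x hx y hy hxy
        obtain ⟨x, hx', rfl⟩ := Multiset.mem_map.1 hx
        obtain ⟨y, hy', rfl⟩ := Multiset.mem_map.1 hy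
        exact Or.inr (h.perp x hx' y hy' (by rintro rfl; exact hxy rfl))
      · rintro p hp hpe
        obtain ⟨x, hx, hpx⟩ := h.cover p.2 hp.2 hpe.2
        exact ⟨(a, x), Multiset.mem_map_of_mem _ hx, hpe.1, hpx⟩

/-- Induction on `e` in the product order: one of the two coordinates can be expanded by a vertex of
its forest so that every member of `s` lies under one of the new inputs. -/
theorem tensor_rel_of_below {s : Multiset (E × F)} {e : E × F}
    (h : (hP.box.prod hQ.box).Below s e) : (tensor P Q).rel s e := by
  classical
  have := hP.finite
  have := hQ.finite
  have hwf : WellFounded (fun a b => (hP.box.prod hQ.box).le a b ∧ a ≠ b) := by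
    have : IsTrans (E × F) (fun a b => (hP.box.prod hQ.box).le a b ∧ a ≠ b) :=
      ⟨fun a b c hab hbc => ⟨Box.trans _ hab.1 hbc.1, fun hac =>
        hab.2 (Box.antisymm _ hab.1 (hac ▸ hbc.1))⟩⟩
    have : Std.Irrefl (fun a b => (hP.box.prod hQ.box).le a b ∧ a ≠ b) := ⟨fun a ha => ha.2 rfl⟩
    exact Finite.wellFounded_of_trans_of_irrefl _
  induction e using hwf.induction generalizing s with
  | _ e ih =>
    by_cases hes : e ∈ s
    · rw [h.eq_singleton hes]
      exact (tensor P Q).refl e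
    obtain ⟨a, b⟩ := e
    -- If `x` has first coordinate `a` and `y` has second coordinate `b`, then `(y.1, x.2)` lies
    -- below both, so `x = y = (a, b)`, which is excluded.
    have hAB : (∀ x ∈ s, x.1 ≠ a) ∨ (∀ x ∈ s, x.2 ≠ b) := by
      by_contra! hcon
      obtain ⟨⟨x, hx, rfl⟩, ⟨y, hy, rfl⟩⟩ := hcon
      refine Box.not_perp_of_le (B := hP.box.prod hQ.box) (x := (y.1, x.2)) ?_ ?_
        (h.perp x hx y hy ?_)
      · exact ⟨(h.le y hy).1, hQ.box.refl _⟩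
      · exact ⟨hP.box.refl _, (h.le x hx).2⟩
      · rintro rfl
        exact hes hx
    rcases hAB with hA | hB
    · by_cases ha : P.IsLeaf a
      -- Over a leaf `a` no first coordinate can drop, so `s` is empty. The covering condition then
      -- says that no leaf lies below `b`, whence a nullary relation on `b`.
      · obtain rfl : s = 0 := by
          refine Multiset.eq_zero_of_forall_notMem (fun x hx => hA x hx ?_)
          exact IsForest.eq_of_desc_leaf ha (h.le x hx).1
        have : Q.rel 0 b := by
          refine hQ.rel_of_below ⟨by simp, by simp, by simp, fun p hp hpb => ?_⟩
          obtain ⟨f, hf, -⟩ := h.cover (a, p) ⟨ha, hp⟩ ⟨hP.box.refl a, hpb⟩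
          simp at hf
        exact Gen.of _ _ (TensorRel.right a 0 b this)
      obtain ⟨m, hm, hme, hex, huniq⟩ := hP.exists_split ha
      have hex' : ∀ x ∈ s, ∃ i ∈ m, P.Desc x.1 i := fun x hx => hex x.1 (h.le x hx).1 (hA x hx)
      have key := Multiset.sum_filter_eq (fun (x : E × F) i => P.Desc x.1 i) s m
        (hP.simple _ _ hm) hex' (fun x _ => huniq x.1)
      have := (tensor P Q).trans (m.map (fun i => (s.filter (fun x => P.Desc x.1 i), (i, b))))
        (a, b)
        (by
          intro p hp
          obtain ⟨i, hi, rfl⟩ := Multiset.mem_map.1 hp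
          refine ih (i, b) ⟨⟨(hme i hi).1, hQ.box.refl b⟩, fun h => (hme i hi).2
            (congrArg Prod.fst h)⟩ ⟨h.nodup.filter _, fun f hf =>
              ⟨(Multiset.mem_filter.1 hf).2, (h.le f (Multiset.mem_filter.1 hf).1).2⟩,
            fun f hf g hg => h.perp f (Multiset.mem_filter.1 hf).1 g (Multiset.mem_filter.1 hg).1,
            fun p hp hpi => ?_⟩
          obtain ⟨f, hf, hpf⟩ := h.cover p hp ⟨Desc.trans hpi.1 (hme i hi).1, hpi.2⟩
          obtain ⟨j, hj, hfj⟩ := hex' f hf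
          obtain rfl := huniq p.1 i hi j hj hpi.1 (Desc.trans hpf.1 hfj)
          exact ⟨f, Multiset.mem_filter.2 ⟨hf, hfj⟩, hpf⟩)
        (by
          have : (tensor P Q).rel _ _ := Gen.of _ _ (TensorRel.left (Q := Q) m a b hm)
          simpa [Multiset.map_map, Function.comp_def] using this)
      simp only [Multiset.map_map, Function.comp_def] at this
      rwa [key] at this
    · by_cases hb : Q.IsLeaf b
      · obtain rfl : s = 0 := by
          refine Multiset.eq_zero_of_forall_notMem (fun x hx => hB x hx ?_)
          exact IsForest.eq_of_desc_leaf hb (h.le x hx).2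
        have : P.rel 0 a := by
          refine hP.rel_of_below ⟨by simp, by simp, by simp, fun p hp hpa => ?_⟩
          obtain ⟨f, hf, -⟩ := h.cover (p, b) ⟨hp, hb⟩ ⟨hpa, hQ.box.refl b⟩
          simp at hf
        exact Gen.of _ _ (TensorRel.left 0 a b this)
      obtain ⟨m, hm, hme, hex, huniq⟩ := hQ.exists_split hb
      have hex' : ∀ x ∈ s, ∃ i ∈ m, Q.Desc x.2 i := fun x hx => hex x.2 (h.le x hx).2 (hB x hx)
      have key := Multiset.sum_filter_eq (fun (x : E × F) i => Q.Desc x.2 i) s m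
        (hQ.simple _ _ hm) hex' (fun x _ => huniq x.2)
      have := (tensor P Q).trans (m.map (fun i => (s.filter (fun x => Q.Desc x.2 i), (a, i))))
        (a, b)
        (by
          intro p hp
          obtain ⟨i, hi, rfl⟩ := Multiset.mem_map.1 hp
          refine ih (a, i) ⟨⟨hP.box.refl a, (hme i hi).1⟩, fun h => (hme i hi).2
            (congrArg Prod.snd h)⟩ ⟨h.nodup.filter _, fun f hf =>
              ⟨(h.le f (Multiset.mem_filter.1 hf).1).1, (Multiset.mem_filter.1 hf).2⟩,
            fun f hf g hg => h.perp f (Multiset.mem_filter.1 hf).1 g (Multiset.mem_filter.1 hg).1,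
            fun p hp hpi => ?_⟩
          obtain ⟨f, hf, hpf⟩ := h.cover p hp ⟨hpi.1, Desc.trans hpi.2 (hme i hi).1⟩
          obtain ⟨j, hj, hfj⟩ := hex' f hf
          obtain rfl := huniq p.2 i hi j hj hpi.2 (Desc.trans hpf.2 hfj)
          exact ⟨f, Multiset.mem_filter.2 ⟨hf, hfj⟩, hpf⟩)
        (by
          have : (tensor P Q).rel _ _ := Gen.of _ _ (TensorRel.right (P := P) a m b hm)
          simpa [Multiset.map_map, Function.comp_def] using this)
      simp only [Multiset.map_map, Function.comp_def] at this
      rwa [key] at this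

theorem tensor_rel_iff {s : Multiset (E × F)} {e : E × F} :
    (tensor P Q).rel s e ↔ (hP.box.prod hQ.box).Below s e :=
  ⟨below_of_tensor_rel hP hQ, tensor_rel_of_below hP hQ⟩

end Tensor

end PreBroadPoset


/-! ### Monotone maps from trees to box posets -/

namespace PreBroadPoset

/-- The antichain is completed by the leaves below `e` that are not below one of its members. The
empty antichain gives a relation that consists of leaves only. -/
theorem IsForest.exists_rel_of_antichain {D : Type u} {W : PreBroadPoset D} (hW : W.IsForest)
    (t : D → Prop) (e : D) (hle : ∀ x, t x → W.Desc x e)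
    (ht : ∀ x y, t x → t y → W.Desc x y → x = y) :
    ∃ s : Multiset D, W.rel s e ∧ (∀ x, t x → x ∈ s) ∧
      ∀ x ∈ s, t x ∨ (W.IsLeaf x ∧ W.Desc x e) := by
  classical
  have := hW.finite
  have := Fintype.ofFinite D
  let s : Finset D := Finset.univ.filter (fun c => t c ∨ (W.IsLeaf c ∧ W.Desc c e ∧
    ∀ x, t x → ¬ W.Desc c x))
  have hs : ∀ x, x ∈ s.val ↔ t x ∨ (W.IsLeaf x ∧ W.Desc x e ∧ ∀ y, t y → ¬ W.Desc x y) := by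
    intro x
    simp [s]
  refine ⟨s.val, hW.rel_of_below ⟨s.nodup, ?_, ?_, ?_⟩, fun x hx => (hs x).2 (Or.inl hx), ?_⟩
  · intro x hx
    rcases (hs x).1 hx with h | h
    · exact hle x h
    · exact h.2.1
  · intro x hx y hy hxy
    have key : ∀ x y, x ∈ s.val → y ∈ s.val → x ≠ y → ¬ W.Desc x y := by
      intro x y hx hy hxy hd
      rcases (hs y).1 hy with h | h
      · rcases (hs x).1 hx with h' | h'
        · exact hxy (ht x y h' h hd)
        · exact h'.2.2 y h hd
      · exact hxy (IsForest.eq_of_desc_leaf h.1 hd)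
    exact ⟨key x y hx hy hxy, key y x hy hx hxy.symm⟩
  · intro p hp hpe
    by_cases h : ∃ y, t y ∧ W.Desc p y
    · obtain ⟨y, hy, hpy⟩ := h
      exact ⟨y, (hs y).2 (Or.inl hy), hpy⟩
    · push Not at h
      exact ⟨p, (hs p).2 (Or.inr ⟨hp, hpe, h⟩), Desc.refl p⟩
  · intro x hx
    exact ((hs x).1 hx).imp_right (fun h => ⟨h.1, h.2.1⟩)

end PreBroadPoset

namespace Box

/-- The broad poset `Q` is the one that belongs to the box poset `B`. -/
def Presents {F : Type v} (B : Box F) (Q : PreBroadPoset F) : Prop :=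
  ∀ s e, Q.rel s e ↔ B.Below s e

theorem _root_.PreBroadPoset.IsForest.presents {E : Type u} {P : PreBroadPoset E}
    (h : P.IsForest) : h.box.Presents P := fun _ _ => h.rel_iff

theorem presents_tensor {E : Type u} {F : Type v} {P : PreBroadPoset E} {Q : PreBroadPoset F}
    (hP : P.IsForest) (hQ : Q.IsForest) : (hP.box.prod hQ.box).Presents (tensor P Q) :=
  fun _ _ => tensor_rel_iff hP hQ

namespace Presents

variable {F : Type v} {B : Box F} {Q : PreBroadPoset F} (hB : B.Presents Q)
include hB

section Hom

variable {D : Type u} {W : PreBroadPoset D} (φ : Hom W Q)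

theorem mono {a b : D} (h : W.Desc a b) : B.le (φ.toFun a) (φ.toFun b) := by
  obtain ⟨s, hs, h⟩ := h
  exact ((hB _ _).1 (φ.map_rel s b h)).le _ (Multiset.mem_map_of_mem _ hs)

/-- Two incomparable edges occur together in some relation under the root, and the image of this
relation has disjoint members and no repetitions. -/
theorem perp (hW : W.IsTree) {a b : D} (hab : ¬ W.Desc a b) (hba : ¬ W.Desc b a) :
    B.perp (φ.toFun a) (φ.toFun b) := by
  obtain ⟨r, hr⟩ := hW.root
  obtain ⟨s, hs, hts, -⟩ := hW.isForest.exists_rel_of_antichain (fun x => x = a ∨ x = b) r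
    (fun x _ => hr x) (by
      rintro x y (rfl | rfl) (rfl | rfl) h
      · rfl
      · exact absurd h hab
      · exact absurd h hba
      · rfl)
  have h := (hB _ _).1 (φ.map_rel s r hs)
  have ha := hts a (Or.inl rfl)
  have hb := hts b (Or.inr rfl)
  refine h.perp _ (Multiset.mem_map_of_mem _ ha) _ (Multiset.mem_map_of_mem _ hb) ?_
  intro heq
  have := Multiset.inj_on_of_nodup_map h.nodup a ha b hb heq
  exact hab (this ▸ Desc.refl a)

theorem comparable (hW : W.IsTree) {a b : D} (h : ¬ B.perp (φ.toFun a) (φ.toFun b)) :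
    W.Desc a b ∨ W.Desc b a := by
  by_contra! hcon
  exact h (hB.perp φ hW hcon.1 hcon.2)

/-- Comes from the relation that expresses `w` through the leaves below it. -/
theorem cover (hW : W.IsForest) {p : F} (hp : B.leaf p) {w : D} (hpw : B.le p (φ.toFun w)) :
    ∃ l, W.IsLeaf l ∧ W.Desc l w ∧ B.le p (φ.toFun l) := by
  obtain ⟨s, hs, -, hs'⟩ := hW.exists_rel_of_antichain (fun _ => False) w
    (fun x h => h.elim) (fun x _ h => h.elim)
  obtain ⟨x, hx, hpx⟩ := ((hB _ _).1 (φ.map_rel s w hs)).cover p hp hpw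
  obtain ⟨l, hl, rfl⟩ := Multiset.mem_map.1 hx
  rcases hs' l hl with h | h
  · exact h.elim
  · exact ⟨l, h.1, h.2, hpx⟩

/-- The image of a leaf is minimal among the images of the edges. -/
theorem minimal (hW : W.IsTree) {l x : D} (hl : W.IsLeaf l)
    (hx : B.le (φ.toFun x) (φ.toFun l)) : φ.toFun x = φ.toFun l := by
  rcases hB.comparable φ hW (B.not_perp hx) with h | h
  · rw [IsForest.eq_of_desc_leaf hl h]
  · exact B.antisymm hx (hB.mono φ h)

/-- An edge above the image of a leaf, in the image, comes from an edge above the leaf. -/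
theorem desc_leaf (hW : W.IsTree) {l x : D} (hl : W.IsLeaf l)
    (hx : ¬ B.perp (φ.toFun l) (φ.toFun x)) : W.Desc l x := by
  rcases hB.comparable φ hW hx with h | h
  · exact h
  · rw [IsForest.eq_of_desc_leaf hl h]
    exact Desc.refl l

end Hom

/-- A criterion for monotonicity. -/
theorem map_rel {D : Type u} {W : PreBroadPoset D} (hW : W.IsForest) (φ : D → F)
    (h₁ : ∀ a b, W.Desc a b → B.le (φ a) (φ b))
    (h₂ : ∀ a b, ¬ W.Desc a b → ¬ W.Desc b a → B.perp (φ a) (φ b))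
    (h₃ : ∀ p w, B.leaf p → B.le p (φ w) → ∃ l, W.IsLeaf l ∧ W.Desc l w ∧ B.le p (φ l))
    (s : Multiset D) (e : D) (h : W.rel s e) : Q.rel (s.map φ) (φ e) := by
  have h := hW.below_of_rel h
  refine (hB _ _).2 ⟨?_, ?_, ?_, ?_⟩
  · refine Multiset.Nodup.map_on ?_ h.nodup
    intro x hx y hy hxy
    by_contra hne
    have := h₂ x y (h.perp x hx y hy hne).1 (h.perp x hx y hy hne).2
    rw [hxy] at this
    exact B.not_perp (B.refl _) this
  · intro f hf
    obtain ⟨x, hx, rfl⟩ := Multiset.mem_map.1 hf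
    exact h₁ x e (h.le x hx)
  · intro f hf g hg hfg
    obtain ⟨x, hx, rfl⟩ := Multiset.mem_map.1 hf
    obtain ⟨y, hy, rfl⟩ := Multiset.mem_map.1 hg
    have := h.perp x hx y hy (by rintro rfl; exact hfg rfl)
    exact h₂ x y this.1 this.2
  · intro p hp hpe
    obtain ⟨l, hl, hle, hpl⟩ := h₃ p e hp hpe
    obtain ⟨x, hx, hlx⟩ := h.cover l hl hle
    exact ⟨φ x, Multiset.mem_map_of_mem _ hx, B.trans hpl (h₁ l x hlx)⟩

/-- An injective map from a tree is full if it does not replace stumps by leaves. -/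
theorem full {D : Type u} {W : PreBroadPoset D} (hW : W.IsTree) (ψ : Hom W Q)
    (hψ : Function.Injective ψ.toFun)
    (hsat : ∀ l, W.IsLeaf l → ∃ p, B.leaf p ∧ B.le p (ψ.toFun l)) (s : Multiset D) (e : D) :
    W.rel s e ↔ Q.rel (s.map ψ.toFun) (ψ.toFun e) := by
  refine ⟨ψ.map_rel s e, fun h => ?_⟩
  have h := (hB _ _).1 h
  refine hW.isForest.rel_of_below ⟨Multiset.Nodup.of_map _ h.nodup, ?_, ?_, ?_⟩
  · intro x hx
    have hle := h.le _ (Multiset.mem_map_of_mem _ hx)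
    rcases hB.comparable ψ hW (B.not_perp hle) with h' | h'
    · exact h'
    · rw [hψ (B.antisymm hle (hB.mono ψ h'))]
      exact Desc.refl e
  · intro x hx y hy hxy
    have := h.perp _ (Multiset.mem_map_of_mem _ hx) _ (Multiset.mem_map_of_mem _ hy)
      (fun h => hxy (hψ h))
    exact ⟨fun h => B.not_perp (hB.mono ψ h) this,
      fun h => B.not_perp (hB.mono ψ h) (B.perp_symm this)⟩
  · intro l hl hle
    obtain ⟨p, hp, hpl⟩ := hsat l hl
    obtain ⟨f, hf, hpf⟩ := h.cover p hp (B.trans hpl (hB.mono ψ hle))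
    obtain ⟨x, hx, rfl⟩ := Multiset.mem_map.1 hf
    exact ⟨x, hx, hB.desc_leaf ψ hW hl (not_perp_of_le hpl hpf)⟩

end Presents

/-! ### Subtrees -/

/-- A set of elements of a box poset that spans a tree. -/
structure IsSubtree {F : Type v} (B : Box F) (X : Set F) : Prop where
  top : ∃ r ∈ X, ∀ x ∈ X, B.le x r
  comp : ∀ a ∈ X, ∀ b ∈ X, B.le a b ∨ B.le b a ∨ B.perp a b
  cover : ∀ d ∈ X, ∀ p, B.leaf p → B.le p d →
    ∃ d' ∈ X, B.le p d' ∧ ∀ c ∈ X, B.le c d' → c = d'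

/-- The tree spanned by a set of elements. -/
theorem IsSubtree.exists_omega {F : Type v} {B : Box F} {X : Set F} (h : B.IsSubtree X)
    (hX : X.Finite) : ∃ (V : Omega) (ψ : Fin V.card → F), Function.Injective ψ ∧
      Set.range ψ = X ∧ (∀ s e, V.broad.rel s e ↔ B.Below (s.map ψ) (ψ e)) ∧
      (∀ a b, V.broad.Desc a b ↔ B.le (ψ a) (ψ b)) ∧
      ∀ a, V.broad.IsLeaf a ↔ (∀ c ∈ X, B.le c (ψ a) → c = ψ a) ∧
        ∃ p, B.leaf p ∧ B.le p (ψ a) := by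
  have : Finite X := hX
  let e : Fin (Nat.card X) ≃ X := (Finite.equivFin X).symm
  let ψ : Fin (Nat.card X) → F := fun i => (e i).1
  have hψ : Function.Injective ψ := Subtype.val_injective.comp e.injective
  have hr : Set.range ψ = X := by
    ext x
    constructor
    · rintro ⟨i, rfl⟩
      exact (e i).2
    · intro hx
      exact ⟨e.symm ⟨x, hx⟩, congrArg Subtype.val (e.apply_symm_apply _)⟩
  have hmem : ∀ i, ψ i ∈ X := fun i => hr ▸ ⟨i, rfl⟩
  have hn : B.IsNested ψ := by
    refine ⟨hψ, fun a b => h.comp _ (hmem a) _ (hmem b), ?_⟩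
    intro d p hp hpd
    obtain ⟨d', hd', hpd', hmin⟩ := h.cover _ (hmem d) p hp hpd
    rw [← hr] at hd'
    obtain ⟨i, rfl⟩ := hd'
    exact ⟨i, hpd', fun c hc => hψ (hmin _ (hmem c) hc)⟩
  obtain ⟨r, hrX, hrmax⟩ := h.top
  rw [← hr] at hrX
  obtain ⟨r, rfl⟩ := hrX
  refine ⟨⟨_, _, hn.isTree r (fun d => hrmax _ (hmem d))⟩, ψ, hψ, hr, fun _ _ => Iff.rfl,
    fun _ _ => hn.desc_iff, fun a => ?_⟩
  refine hn.isLeaf_iff.trans ?_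
  refine and_congr_left (fun _ => ⟨fun h c hc hca => ?_, fun h c hc => hψ (h _ (hmem c) hc)⟩)
  rw [← hr] at hc
  obtain ⟨c, rfl⟩ := hc
  rw [h c hca]

namespace Presents

variable {F : Type v} {B : Box F} {Q : PreBroadPoset F} (hB : B.Presents Q)
include hB

/-- The marks `L` are left free: the marks of `B` describe images as subtrees of `B`, while the
images of leaves of the source give the image factorization. -/
theorem isSubtree_range {D : Type u} {W : PreBroadPoset D} (hW : W.IsTree) (φ : Hom W Q)
    (L : F → Prop) (hL : ∀ p w, L p → B.le p (φ.toFun w) → ∃ l, W.IsLeaf l ∧ B.le p (φ.toFun l)) :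
    (B.withLeaf L).IsSubtree (Set.range φ.toFun) where
  top := by
    obtain ⟨r, hr⟩ := hW.root
    refine ⟨_, ⟨r, rfl⟩, ?_⟩
    rintro _ ⟨x, rfl⟩
    exact hB.mono φ (hr x)
  comp := by
    rintro _ ⟨x, rfl⟩ _ ⟨y, rfl⟩
    by_cases hxy : W.Desc x y
    · exact Or.inl (hB.mono φ hxy)
    by_cases hyx : W.Desc y x
    · exact Or.inr (Or.inl (hB.mono φ hyx))
    exact Or.inr (Or.inr (hB.perp φ hW hxy hyx))
  cover := by
    rintro _ ⟨x, rfl⟩ p hp hpx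
    obtain ⟨l, hl, hpl⟩ := hL p x hp hpx
    refine ⟨_, ⟨l, rfl⟩, hpl, ?_⟩
    rintro _ ⟨y, rfl⟩ hy
    exact hB.minimal φ hW hl hy

/-- The image factorization of a map from a tree. -/
theorem exists_image (U : Omega) (φ : Hom U.broad Q) :
    ∃ (V : Omega) (ψ : Hom V.broad Q) (a : U ⟶ V), Function.Injective ψ.toFun ∧
      φ = ψ.comp a ∧ Function.Surjective a.toFun ∧
      ∀ l, U.broad.IsLeaf l → V.broad.IsLeaf (a.toFun l) := by
  have hU := U.isTree
  -- Marking the images of the leaves of `U`, rather than the marked elements of `B`, makes leaves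
  -- go to leaves even where `φ` sends a leaf to a stump.
  let L : F → Prop := fun p => ∃ l, U.broad.IsLeaf l ∧ φ.toFun l = p
  have hsub : (B.withLeaf L).IsSubtree (Set.range φ.toFun) :=
    hB.isSubtree_range hU φ L (by
      rintro _ w ⟨l, hl, rfl⟩ _
      exact ⟨l, hl, B.refl _⟩)
  obtain ⟨V, ψ, hψ, hr, hrel, hdesc, hleaf⟩ := hsub.exists_omega (Set.finite_range _)
  have hlift : ∀ x, ∃ y, ψ y = φ.toFun x := fun x => by
    have : φ.toFun x ∈ Set.range ψ := by rw [hr]; exact ⟨x, rfl⟩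
    exact this
  choose a ha using hlift
  refine ⟨V, ⟨ψ, ?_⟩, ⟨a, ?_⟩, hψ, Hom.ext (funext fun x => (ha x).symm), ?_, ?_⟩
  · intro s e h
    have h := (hrel s e).1 h
    refine (hB _ _).2 ⟨h.nodup, h.le, h.perp, ?_⟩
    intro p hp hpe
    have : ψ e ∈ Set.range φ.toFun := hr ▸ ⟨e, rfl⟩
    obtain ⟨w, hw⟩ := this
    rw [← hw] at hpe
    obtain ⟨l, hl, hlw, hpl⟩ := hB.cover φ hU.isForest hp hpe
    obtain ⟨x, hx, hlx⟩ := h.cover (φ.toFun l) ⟨l, hl, rfl⟩ (hw ▸ hB.mono φ hlw)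
    exact ⟨x, hx, B.trans hpl hlx⟩
  · intro s e h
    have hbelow := (hB _ _).1 (φ.map_rel s e h)
    refine (hrel _ _).2 ?_
    rw [Multiset.map_map, ha e, show ψ ∘ a = φ.toFun from funext ha]
    refine ⟨hbelow.nodup, hbelow.le, hbelow.perp, ?_⟩
    rintro _ ⟨l, hl, rfl⟩ hle
    have hle' := hB.desc_leaf φ hU hl (B.not_perp hle)
    obtain ⟨x, hx, hlx⟩ := (hU.isForest.below_of_rel h).cover l hl hle'
    exact ⟨_, Multiset.mem_map_of_mem _ hx, hB.mono φ hlx⟩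
  · intro y
    have : ψ y ∈ Set.range φ.toFun := hr ▸ ⟨y, rfl⟩
    obtain ⟨x, hx⟩ := this
    exact ⟨x, hψ ((ha x).trans hx)⟩
  · intro l hl
    rw [hleaf]
    change (∀ c ∈ Set.range φ.toFun, B.le c (ψ (a l)) → c = ψ (a l)) ∧
      ∃ p, L p ∧ B.le p (ψ (a l))
    rw [ha l]
    refine ⟨?_, _, ⟨l, hl, rfl⟩, B.refl _⟩
    rintro _ ⟨x, rfl⟩ hx
    exact hB.minimal φ hU hl hx

end Presents

end Box


namespace PreBroadPoset

/-! ### Minimal faces of maps into tensor products -/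

/-- Every edge has a leaf below it. -/
def LeafCovered {E : Type u} (P : PreBroadPoset E) : Prop := ∀ e, ∃ l, P.IsLeaf l ∧ P.Desc l e

/-- The edges below any edge form a chain. -/
def IsChainlike {E : Type u} (P : PreBroadPoset E) : Prop :=
  ∀ a b r, P.Desc a r → P.Desc b r → P.Desc a b ∨ P.Desc b a

/-- The condition on forests `P` and `Q` under which maps into `P ⊗ Q` have minimal faces. -/
def Amenable {E : Type u} {F : Type v} (P : PreBroadPoset E) (Q : PreBroadPoset F) : Prop :=
  (P.LeafCovered ∧ Q.LeafCovered) ∨ (P.LeafCovered ∧ P.IsChainlike) ∨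
    (Q.LeafCovered ∧ Q.IsChainlike)

theorem Amenable.symm {E : Type u} {F : Type v} {P : PreBroadPoset E} {Q : PreBroadPoset F}
    (h : Amenable P Q) : Amenable Q P := by
  rcases h with h | h | h
  · exact Or.inl ⟨h.2, h.1⟩
  · exact Or.inr (Or.inr h)
  · exact Or.inr (Or.inl h)

/-- Descending through inputs of vertices ends at a leaf, as no stump can be met. -/
theorem IsForest.leafCovered {E : Type u} {P : PreBroadPoset E} (h : P.IsForest)
    (ho : ∀ e, ¬ P.IsStump e) : P.LeafCovered := by
  intro e
  induction e using h.wf.induction with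
  | _ e ih =>
    by_cases he : P.IsLeaf e
    · exact ⟨e, he, Desc.refl e⟩
    rcases h.nodal e with h' | ⟨m, hm0, hm, hmax⟩ | h'
    · exact absurd h' he
    · obtain ⟨i, hi⟩ := Multiset.exists_mem_of_ne_zero hm0
      have hie : P.Desc i e := ⟨m, hi, hm.1⟩
      have hne : i ≠ e := by
        rintro rfl
        obtain ⟨s, rfl⟩ := Multiset.exists_cons_of_mem hi
        have := h.simple.eq_zero hm.1
        subst this
        exact hm.2 rfl
      obtain ⟨l, hl, hli⟩ := ih i ⟨hie, hne⟩
      exact ⟨l, hl, hli.trans hie⟩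
    · exact absurd h' (ho e)

/-- A pair of maps from a tree that defines a monotone map into a tensor product. -/
structure JointMap {D : Type w} {E : Type u} {F : Type v} (U : PreBroadPoset D)
    (P : PreBroadPoset E) (Q : PreBroadPoset F) (f : D → E) (g : D → F) : Prop where
  mono₁ : ∀ {a b}, U.Desc a b → P.Desc (f a) (f b)
  mono₂ : ∀ {a b}, U.Desc a b → Q.Desc (g a) (g b)
  comp : ∀ {a b}, (P.Desc (f a) (f b) ∨ P.Desc (f b) (f a)) →
    (Q.Desc (g a) (g b) ∨ Q.Desc (g b) (g a)) → (U.Desc a b ∨ U.Desc b a)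
  cover : ∀ {p m u}, P.IsLeaf p → Q.IsLeaf m → P.Desc p (f u) → Q.Desc m (g u) →
    ∃ l, U.IsLeaf l ∧ U.Desc l u ∧ P.Desc p (f l) ∧ Q.Desc m (g l)

/-- The leaves of the minimal face of `P` on the image of `f`. -/
structure FaceLeaf {D : Type w} {E : Type u} (U : PreBroadPoset D) (P : PreBroadPoset E)
    (f : D → E) (s : E) : Prop where
  mem : s ∈ Set.range f
  min : ∀ u, P.Desc (f u) s → f u = s
  leaf : (∃ l, U.IsLeaf l ∧ f l = s) ∨ ∃ p, P.IsLeaf p ∧ P.Desc p s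

section

variable {D : Type w} {E : Type u} {F : Type v} {U : PreBroadPoset D}
    {P : PreBroadPoset E} {Q : PreBroadPoset F} {f : D → E} {g : D → F}

theorem FaceLeaf.le_of_le (hP : P.IsForest) {s p : E} (h : FaceLeaf U P f s) {u : D}
    (hs : P.Desc p s) (hu : P.Desc p (f u)) : P.Desc s (f u) := by
  rcases hP.desc_total hs hu with h' | h'
  · exact h'
  · rw [h.min u h']
    exact Desc.refl s

namespace JointMap

theorem of_hom (hU : U.IsTree) (hP : P.IsForest) (hQ : Q.IsForest) (φ : Hom U (tensor P Q)) :
    JointMap U P Q (fun u => (φ.toFun u).1) (fun u => (φ.toFun u).2) where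
  mono₁ h := ((Box.presents_tensor hP hQ).mono φ h).1
  mono₂ h := ((Box.presents_tensor hP hQ).mono φ h).2
  comp := by
    intro a b h₁ h₂
    refine (Box.presents_tensor hP hQ).comparable φ hU ?_
    rintro (h | h)
    · exact h₁.elim h.1 h.2
    · exact h₂.elim h.1 h.2
  cover := by
    intro p m u hp hm hpu hmu
    exact (Box.presents_tensor hP hQ).cover φ hU.isForest (p := (p, m)) ⟨hp, hm⟩ ⟨hpu, hmu⟩

variable (h : JointMap U P Q f g)
include h

theorem swap : JointMap U Q P g f where
  mono₁ := h.mono₂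
  mono₂ := h.mono₁
  comp h₁ h₂ := h.comp h₂ h₁
  cover hp hm hpu hmu := by
    obtain ⟨l, hl, hlu, h₁, h₂⟩ := h.cover hm hp hmu hpu
    exact ⟨l, hl, hlu, h₂, h₁⟩

theorem chain (hU : U.IsTree) (hc : P.IsChainlike) (a b : D) :
    P.Desc (f a) (f b) ∨ P.Desc (f b) (f a) := by
  obtain ⟨r, hr⟩ := hU.root
  exact hc _ _ _ (h.mono₁ (hr a)) (h.mono₁ (hr b))

/-- The candidate is the smallest member of the image above `p`; the point is that no member of the
image at all lies strictly below it. -/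
theorem exists_faceLeaf (hU : U.IsTree) (hP : P.IsForest) (hQ : Q.IsForest)
    (hPQ : Q.LeafCovered ∨ P.IsChainlike) {p : E} (hp : P.IsLeaf p) {u : D}
    (hpu : P.Desc p (f u)) : ∃ s, FaceLeaf U P f s ∧ P.Desc p s := by
  have := hP.finite
  obtain ⟨r, hr⟩ := hU.root
  obtain ⟨s, -, ⟨⟨k, rfl⟩, hps⟩, hmin⟩ := hP.box.exists_minimal
    (fun s => s ∈ Set.range f ∧ P.Desc p s) (a := f u) ⟨⟨u, rfl⟩, hpu⟩
  refine ⟨f k, ⟨⟨k, rfl⟩, ?_, Or.inr ⟨p, hp, hps⟩⟩, hps⟩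
  intro x hx
  rcases hPQ with hl | hc
  -- With `m` a leaf below `g x`, the pair `(p, m)` lies below the image of a leaf `l` of `U`. Then
  -- `f l` is above `f k` and `l` is comparable to `x`, which forces `f x = f k`.
  · obtain ⟨m, hm, hmx⟩ := hl (g x)
    obtain ⟨l, hl, -, hpl, hml⟩ := h.cover hp hm (u := r) (hpu.trans (h.mono₁ (hr u)))
      (hmx.trans (h.mono₂ (hr x)))
    have hkl : P.Desc (f k) (f l) := by
      rcases hP.desc_total hps hpl with h' | h'
      · exact h'
      · rw [hmin (f l) ⟨⟨l, rfl⟩, hpl⟩ h']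
        exact Desc.refl _
    by_contra hne
    have hxl : P.Desc (f x) (f l) := hx.trans hkl
    rcases h.comp (Or.inl hxl) (hQ.desc_total hmx hml) with h' | h'
    · have hxl' := IsForest.eq_of_desc_leaf hl h'
      exact hne (hP.desc_antisymm hx (hxl' ▸ hkl))
    · exact hne (hP.desc_antisymm hx (hkl.trans (h.mono₁ h')))
  -- In a chain `f x` is comparable to the leaf `p`, hence above it, and the choice of `f k`
  -- applies.
  · rcases hc _ _ _ (hx.trans (h.mono₁ (hr k))) (hps.trans (h.mono₁ (hr k))) with h' | h'
    · have := IsForest.eq_of_desc_leaf hp h'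
      exact hmin _ ⟨⟨x, rfl⟩, this ▸ Desc.refl _⟩ hx
    · exact hmin _ ⟨⟨x, rfl⟩, h'⟩ hx

/-- If `P` is chainlike, only the second coordinates can separate edges of `U`. -/
theorem faceLeaf_le_of_chain (hU : U.IsTree) (hc : P.IsChainlike) {s : E}
    (hs : FaceLeaf U P f s) {l u : D} (hl : U.IsLeaf l) (hlu : Q.Desc (g l) (g u)) :
    U.Desc l u ∧ P.Desc s (f l) := by
  constructor
  · rcases h.comp (h.chain hU hc l u) (Or.inl hlu) with h' | h'
    · exact h'
    · rw [IsForest.eq_of_desc_leaf hl h']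
      exact Desc.refl l
  · obtain ⟨k, rfl⟩ := hs.mem
    rcases h.chain hU hc k l with h' | h'
    · exact h'
    · rw [hs.min l h']
      exact Desc.refl _

/-- This is the covering condition for the lift of the map to its minimal faces. Face leaves above
true leaves reduce to `cover`; one that is only the image of a leaf of `U` is handled by that leaf,
since the other factor is then chainlike. -/
theorem exists_leaf_of_faceLeaf (hU : U.IsTree) (hP : P.IsForest) (hQ : Q.IsForest)
    (hPQ : Amenable P Q) {a : E} {b : F} (ha : FaceLeaf U P f a) (hb : FaceLeaf U Q g b) {u : D}
    (hau : P.Desc a (f u)) (hbu : Q.Desc b (g u)) :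
    ∃ l, U.IsLeaf l ∧ U.Desc l u ∧ P.Desc a (f l) ∧ Q.Desc b (g l) := by
  have key : (∃ p, P.IsLeaf p ∧ P.Desc p a) → (∃ m, Q.IsLeaf m ∧ Q.Desc m b) →
      ∃ l, U.IsLeaf l ∧ U.Desc l u ∧ P.Desc a (f l) ∧ Q.Desc b (g l) := by
    rintro ⟨p, hp, hpa⟩ ⟨m, hm, hmb⟩
    obtain ⟨l, hl, hlu, hpl, hml⟩ := h.cover hp hm (hpa.trans hau) (hmb.trans hbu)
    exact ⟨l, hl, hlu, ha.le_of_le hP hpa hpl, hb.le_of_le hQ hmb hml⟩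
  rcases hPQ with ⟨h₁, h₂⟩ | ⟨h₁, hc⟩ | ⟨h₂, hc⟩
  · exact key (h₁ a) (h₂ b)
  · rcases hb.leaf with ⟨l, hl, rfl⟩ | h₂
    · obtain ⟨h3, h4⟩ := h.faceLeaf_le_of_chain hU hc ha hl hbu
      exact ⟨l, hl, h3, h4, Desc.refl _⟩
    · exact key (h₁ a) h₂
  · rcases ha.leaf with ⟨l, hl, rfl⟩ | h₁
    · obtain ⟨h3, h4⟩ := h.swap.faceLeaf_le_of_chain hU hc hb hl hau
      exact ⟨l, hl, h3, Desc.refl _, h4⟩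
    · exact key h₁ (h₂ b)

end JointMap

/-- `v : V → P` is the minimal face of `P` on the image of `f`. -/
structure IsMinimalFace {D : Type w} {E : Type u} (U : PreBroadPoset D) (P : PreBroadPoset E)
    (f : D → E) {V : Omega} (v : Hom V.broad P) : Prop where
  inj : Function.Injective v.toFun
  range : Set.range v.toFun = Set.range f
  desc : ∀ a b, V.broad.Desc a b ↔ P.Desc (v.toFun a) (v.toFun b)
  leaf : ∀ a, V.broad.IsLeaf a ↔ FaceLeaf U P f (v.toFun a)
  cover : ∀ s e, V.broad.rel s e → ∀ p, FaceLeaf U P f p → P.Desc p (v.toFun e) →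
    ∃ x ∈ s, P.Desc p (v.toFun x)

namespace JointMap

variable (h : JointMap U P Q f g)
include h

/-- The image of `f` is marked by `FaceLeaf`; by `exists_faceLeaf` these marks account for every
leaf of `P` below the image, which makes the inclusion monotone. -/
theorem exists_minimalFace (hU : U.IsTree) (hP : P.IsForest) (hQ : Q.IsForest)
    (hPQ : Q.LeafCovered ∨ P.IsChainlike) :
    ∃ (V : Omega) (v : Hom V.broad P), IsMinimalFace U P f v := by
  have := hP.finite
  have hsub : (hP.box.withLeaf (FaceLeaf U P f)).IsSubtree (Set.range f) := by
    refine ⟨?_, ?_, ?_⟩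
    · obtain ⟨r, hr⟩ := hU.root
      refine ⟨f r, ⟨r, rfl⟩, ?_⟩
      rintro _ ⟨x, rfl⟩
      exact h.mono₁ (hr x)
    · intro a _ b _
      change P.Desc a b ∨ P.Desc b a ∨ ¬ P.Desc a b ∧ ¬ P.Desc b a
      tauto
    · intro d _ p hp _
      refine ⟨p, FaceLeaf.mem hp, Desc.refl p, ?_⟩
      rintro _ ⟨u, rfl⟩ hu
      exact FaceLeaf.min hp u hu
  obtain ⟨V, v, hv, hr, hrel, hdesc, hleaf⟩ := hsub.exists_omega (Set.toFinite _)
  refine ⟨V, ⟨v, ?_⟩, hv, hr, hdesc, ?_, ?_⟩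
  · intro s e hs
    have hs := (hrel s e).1 hs
    refine hP.rel_of_below ⟨hs.nodup, hs.le, hs.perp, ?_⟩
    intro p hp hpe
    obtain ⟨u, hu⟩ : v e ∈ Set.range f := hr ▸ ⟨e, rfl⟩
    have hpu : P.Desc p (f u) := hu ▸ hpe
    obtain ⟨q, hq, hpq⟩ := h.exists_faceLeaf hU hP hQ hPQ hp hpu
    obtain ⟨x, hx, hqx⟩ := hs.cover q hq (hu ▸ hq.le_of_le hP hpq hpu)
    exact ⟨x, hx, hpq.trans hqx⟩
  · intro a
    rw [hleaf]
    constructor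
    · rintro ⟨h₁, p, hp, hpa⟩
      obtain rfl := h₁ p (FaceLeaf.mem hp) hpa
      exact hp
    · intro ha
      refine ⟨?_, v a, ha, Desc.refl _⟩
      rintro _ ⟨u, rfl⟩ hu
      exact ha.min u hu
  · intro s e hs p hp hpe
    obtain ⟨x, hx, hpx⟩ := ((hrel s e).1 hs).cover p hp hpe
    obtain ⟨x, hx', rfl⟩ := Multiset.mem_map.1 hx
    exact ⟨x, hx', hpx⟩

/-- The minimal face is contained in any other face that `f` factors through. -/
theorem exists_lift (hU : U.IsTree) (hP : P.IsForest) (hQ : Q.IsForest)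
    (hPQ : (P.LeafCovered ∧ (Q.LeafCovered ∨ P.IsChainlike)) ∨ (Q.LeafCovered ∧ Q.IsChainlike))
    {V V' W' : Omega} {v : Hom V.broad P} (hv : IsMinimalFace U P f v) (v' : Hom V'.broad P)
    (hv' : Function.Injective v'.toFun) (w' : Hom W'.broad Q)
    {k : D → Fin V'.card} {k' : D → Fin W'.card} (h' : JointMap U V'.broad W'.broad k k')
    (hk : ∀ u, f u = v'.toFun (k u)) (hk' : ∀ u, g u = w'.toFun (k' u)) :
    ∃ a : V ⟶ V', v = v'.comp a := by
  have hlift : ∀ x, ∃ y, v'.toFun y = v.toFun x := by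
    intro x
    obtain ⟨u, hu⟩ : v.toFun x ∈ Set.range f := hv.range ▸ ⟨x, rfl⟩
    exact ⟨k u, by rw [← hu, hk]⟩
  choose a ha using hlift
  refine ⟨⟨a, ?_⟩, Hom.ext (funext fun x => (ha x).symm)⟩
  intro s e hs
  have hs' := V.isTree.isForest.below_of_rel hs
  have hV' := V'.isTree
  have hP' := hP.presents
  have hainj : Function.Injective a := fun x y hxy => hv.inj (by rw [← ha, hxy, ha])
  refine hV'.isForest.rel_of_below ⟨hs'.nodup.map hainj, ?_, ?_, ?_⟩
  · intro x hx
    obtain ⟨x, hx', rfl⟩ := Multiset.mem_map.1 hx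
    have hle : P.Desc (v'.toFun (a x)) (v'.toFun (a e)) := by
      rw [ha, ha]
      exact (hv.desc x e).1 (hs'.le x hx')
    rcases hP'.comparable v' hV' (hP.box.not_perp hle) with h | h
    · exact h
    · rw [hv' (hP.desc_antisymm hle (hP'.mono v' h))]
      exact Desc.refl _
  · intro x hx y hy hxy
    obtain ⟨x, hx', rfl⟩ := Multiset.mem_map.1 hx
    obtain ⟨y, hy', rfl⟩ := Multiset.mem_map.1 hy
    have hp := hs'.perp x hx' y hy' (fun h => hxy (congrArg a h))
    refine ⟨fun h => hp.1 ?_, fun h => hp.2 ?_⟩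
    · have := hP'.mono v' h
      rw [ha, ha] at this
      exact (hv.desc _ _).2 this
    · have := hP'.mono v' h
      rw [ha, ha] at this
      exact (hv.desc _ _).2 this
  · intro l hl hle
    have hlv : P.Desc (v'.toFun l) (v.toFun e) := ha e ▸ hP'.mono v' hle
    obtain ⟨u, hu⟩ : v.toFun e ∈ Set.range f := hv.range ▸ ⟨e, rfl⟩
    have hke : k u = a e := hv' (by rw [← hk, ha, hu])
    -- A leaf `l` of the other face needs a face leaf between it and `e`. It is found above a leaf
    -- of `P` below `l` or, when `Q` is chainlike, as the image of a leaf of `U` lying above `l`.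
    have key : ∃ q, FaceLeaf U P f q ∧ P.Desc (v'.toFun l) q ∧ P.Desc q (v.toFun e) := by
      rcases hPQ with ⟨h₁, h₂⟩ | ⟨h₁, h₂⟩
      · obtain ⟨p, hp, hpl⟩ := h₁ (v'.toFun l)
        have hpu : P.Desc p (f u) := hu ▸ hpl.trans hlv
        obtain ⟨q, hq, hpq⟩ := h.exists_faceLeaf hU hP hQ h₂ hp hpu
        refine ⟨q, hq, ?_, hu ▸ hq.le_of_le hP hpq hpu⟩
        obtain ⟨x, rfl⟩ := hq.mem
        rw [hk] at hpq ⊢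
        exact hP'.mono v' (hP'.desc_leaf v' hV' hl (Box.not_perp_of_le hpl hpq))
      · obtain ⟨m, hm, hmu⟩ := h₁ (g u)
        rw [hk'] at hmu
        obtain ⟨b, hb, hbu, -⟩ := hQ.presents.cover w' W'.isTree.isForest hm hmu
        obtain ⟨l', hl', hlu, hll, -⟩ := h'.cover hl hb (hke ▸ hle) hbu
        refine ⟨f l', ⟨⟨l', rfl⟩, fun x hx => ?_, Or.inl ⟨l', hl', rfl⟩⟩, ?_, hu ▸ h.mono₁ hlu⟩
        · rcases h.comp (Or.inl hx) (h.swap.chain hU h₂ x l') with h3 | h3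
          · rw [IsForest.eq_of_desc_leaf hl' h3]
          · exact hP.desc_antisymm hx (h.mono₁ h3)
        · rw [hk]
          exact hP'.mono v' hll
    obtain ⟨q, hq, hlq, hqe⟩ := key
    obtain ⟨x, hx, hqx⟩ := hv.cover s e hs q hq hqe
    refine ⟨a x, Multiset.mem_map_of_mem _ hx, ?_⟩
    have : P.Desc (v'.toFun l) (v'.toFun (a x)) := ha x ▸ hlq.trans hqx
    exact hP'.desc_leaf v' hV' hl (hP.box.not_perp this)

end JointMap

end

theorem Amenable.left {E : Type u} {F : Type v} {P : PreBroadPoset E} {Q : PreBroadPoset F}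
    (h : Amenable P Q) : Q.LeafCovered ∨ P.IsChainlike := by
  rcases h with h | h | h
  · exact Or.inl h.2
  · exact Or.inr h.2
  · exact Or.inl h.1

theorem Amenable.left' {E : Type u} {F : Type v} {P : PreBroadPoset E} {Q : PreBroadPoset F}
    (h : Amenable P Q) :
    (P.LeafCovered ∧ (Q.LeafCovered ∨ P.IsChainlike)) ∨ (Q.LeafCovered ∧ Q.IsChainlike) := by
  rcases h with h | h | h
  · exact Or.inl ⟨h.1, Or.inl h.2⟩
  · exact Or.inl ⟨h.1, Or.inr h.2⟩
  · exact Or.inr h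

/-- Every map from a tree into a tensor product has a minimal pair of faces. -/
theorem exists_minimal_faces {E : Type u} {F : Type v} {P : PreBroadPoset E}
    {Q : PreBroadPoset F} (hP : P.IsForest) (hQ : Q.IsForest) (hPQ : Amenable P Q) (U : Omega)
    (φ : Hom U.broad (tensor P Q)) :
    ∃ (V W : Omega) (v : Hom V.broad P) (w : Hom W.broad Q)
      (h : Hom U.broad (tensor V.broad W.broad)),
      IsMinimalFace U.broad P (fun u => (φ.toFun u).1) v ∧
      IsMinimalFace U.broad Q (fun u => (φ.toFun u).2) w ∧
      φ = (tensorMap v w).comp h ∧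
      ∀ (V' W' : Omega) (v' : Hom V'.broad P) (w' : Hom W'.broad Q)
        (h' : Hom U.broad (tensor V'.broad W'.broad)), Function.Injective v'.toFun →
        Function.Injective w'.toFun → φ = (tensorMap v' w').comp h' →
        (∃ a : V ⟶ V', v = v'.comp a) ∧ ∃ b : W ⟶ W', w = w'.comp b := by
  have hU := U.isTree
  have J := JointMap.of_hom hU hP hQ φ
  obtain ⟨V, v, hv⟩ := J.exists_minimalFace hU hP hQ hPQ.left
  obtain ⟨W, w, hw⟩ := J.swap.exists_minimalFace hU hQ hP hPQ.symm.left
  have hx : ∀ u, ∃ x, v.toFun x = (φ.toFun u).1 := fun u => by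
    have : (φ.toFun u).1 ∈ Set.range v.toFun := hv.range ▸ ⟨u, rfl⟩
    exact this
  have hy : ∀ u, ∃ x, w.toFun x = (φ.toFun u).2 := fun u => by
    have : (φ.toFun u).2 ∈ Set.range w.toFun := hw.range ▸ ⟨u, rfl⟩
    exact this
  choose x hx using hx
  choose y hy using hy
  have hmono := (Box.presents_tensor V.isTree.isForest W.isTree.isForest).map_rel hU.isForest
    (fun u => (x u, y u))
    (by
      intro a b hab
      refine ⟨(hv.desc _ _).2 ?_, (hw.desc _ _).2 ?_⟩
      · rw [hx, hx]
        exact J.mono₁ hab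
      · rw [hy, hy]
        exact J.mono₂ hab)
    (by
      intro a b hab hba
      by_contra hcon
      have h₁ : ¬ (¬ V.broad.Desc (x a) (x b) ∧ ¬ V.broad.Desc (x b) (x a)) :=
        fun h => hcon (Or.inl h)
      have h₂ : ¬ (¬ W.broad.Desc (y a) (y b) ∧ ¬ W.broad.Desc (y b) (y a)) :=
        fun h => hcon (Or.inr h)
      simp only [hv.desc, hw.desc, hx, hy] at h₁ h₂
      exact (J.comp (by tauto) (by tauto)).elim hab hba)
    (by
      rintro ⟨p, m⟩ u ⟨hp, hm⟩ ⟨hpu, hmu⟩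
      obtain ⟨l, hl, hlu, h₁, h₂⟩ := J.exists_leaf_of_faceLeaf hU hP hQ hPQ ((hv.leaf p).1 hp)
        ((hw.leaf m).1 hm) (u := u) (hx u ▸ (hv.desc _ _).1 hpu) (hy u ▸ (hw.desc _ _).1 hmu)
      exact ⟨l, hl, hlu, (hv.desc _ _).2 (by rw [hx]; exact h₁),
        (hw.desc _ _).2 (by rw [hy]; exact h₂)⟩)
  refine ⟨V, W, v, w, ⟨_, hmono⟩, hv, hw, Hom.ext (funext fun u => ?_), ?_⟩
  · exact Prod.ext (hx u).symm (hy u).symm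
  · intro V' W' v' w' h' hv' hw' hφ
    have J' := JointMap.of_hom hU V'.isTree.isForest W'.isTree.isForest h'
    have h₁ : ∀ u, (φ.toFun u).1 = v'.toFun (h'.toFun u).1 := fun u => by rw [hφ]; rfl
    have h₂ : ∀ u, (φ.toFun u).2 = w'.toFun (h'.toFun u).2 := fun u => by rw [hφ]; rfl
    exact ⟨J.exists_lift hU hP hQ hPQ.left' hv v' hv' w' J' h₁ h₂,
      J.swap.exists_lift hU hQ hP hPQ.symm.left' hw w' hw' v' J'.swap h₂ h₁⟩

end PreBroadPoset


/-! ### Tensor products of subpresheaves of `Hom(-, P)` and `Hom(-, Q)` -/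

section TensorPresheaf

variable {E F : Type u} {P : PreBroadPoset E} {Q : PreBroadPoset F}

theorem PreBroadPoset.tensorMap_injective {E' F' : Type*} {P' : PreBroadPoset E'}
    {Q' : PreBroadPoset F'} {v : Hom P' P} {w : Hom Q' Q} (hv : Function.Injective v.toFun)
    (hw : Function.Injective w.toFun) {D : Type*} {U : PreBroadPoset D}
    {h h' : Hom U (tensor P' Q')} (hh : (tensorMap v w).comp h = (tensorMap v w).comp h') :
    h = h' := by
  refine Hom.ext (funext fun u => ?_)
  have := congrFun (congrArg Hom.toFun hh) u
  exact Prod.ext (hv (congrArg Prod.fst this)) (hw (congrArg Prod.snd this))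

/-- The comparison map `X ⊗ Y → Hom(-, P ⊗ Q)` for `X → Hom(-, P)` and `Y → Hom(-, Q)`. -/
def tensorToHom {X Y : DSet.{u}} (i : X ⟶ homPresheaf P) (j : Y ⟶ homPresheaf Q) :
    tensorObj X Y ⟶ homPresheaf (tensor P Q) where
  app U := TypeCat.ofHom (Quot.lift
    (fun z => (tensorMap (i.app (op z.S) z.x) (j.app (op z.T) z.y)).comp z.h) (by
      rintro _ _ ⟨a, b, x, y, h⟩
      have hx := NatTrans.naturality_apply i a.op x
      have hy := NatTrans.naturality_apply j b.op y
      dsimp only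
      rw [hx, hy]
      rfl))
  naturality _ _ c := by
    ext z
    obtain ⟨z⟩ := z
    rfl

/-- `X` is a union of faces of `P`. -/
structure IsFaceUnion {X : DSet.{u}} (i : X ⟶ homPresheaf P) : Prop where
  face : ∀ (V : Omega) (x : X.obj (op V)), ∃ (V₁ : Omega) (x₁ : X.obj (op V₁)) (a : V ⟶ V₁),
    x = X.map a.op x₁ ∧ Function.Injective (i.app (op V₁) x₁).toFun

theorem isFaceUnion_id (hP : P.IsForest) : IsFaceUnion (𝟙 (homPresheaf P)) where
  face V x := by
    obtain ⟨V₁, ψ, a, hψ, rfl, -⟩ := hP.presents.exists_image V x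
    exact ⟨V₁, ψ, a, rfl, hψ⟩

theorem isFaceUnion_faceUnion {G : Type u} [Group G] (T : GTree G)
    (R : ∀ V : Omega, Hom V.broad T.broad → Prop) : IsFaceUnion (T.faceUnion R).ι where
  face V x := by
    obtain ⟨_, V₁, ψ, a, hψ, hR, rfl⟩ := x
    exact ⟨V₁, ⟨ψ, V₁, ψ, 𝟙 V₁, hψ, hR, rfl⟩, a, rfl, hψ⟩

/-- An element of `X ⊗ Y` is determined by the minimal faces of its image in `Hom(-, P ⊗ Q)`. -/
theorem exists_tensor_normal_form (hP : P.IsForest) (hQ : Q.IsForest) (hPQ : Amenable P Q)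
    (U : Omega) (φ : Hom U.broad (tensor P Q)) :
    ∃ (V W : Omega) (v : Hom V.broad P) (w : Hom W.broad Q)
      (h : Hom U.broad (tensor V.broad W.broad)),
      ∀ {X Y : DSet.{u}} (i : X ⟶ homPresheaf P) (j : Y ⟶ homPresheaf Q),
        IsFaceUnion i → IsFaceUnion j → ∀ z : (tensorObj X Y).obj (op U),
          (tensorToHom i j).app (op U) z = φ →
          ∃ (x : X.obj (op V)) (y : Y.obj (op W)), i.app (op V) x = v ∧ j.app (op W) y = w ∧
            z = Quot.mk _ ⟨V, W, x, y, h⟩ := by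
  obtain ⟨V, W, v, w, h, hv, hw, hφ, hmin⟩ := exists_minimal_faces hP hQ hPQ U φ
  refine ⟨V, W, v, w, h, ?_⟩
  intro X Y i j hi hj z hz
  obtain ⟨⟨S, T, x, y, k⟩, rfl⟩ := Quot.exists_rep z
  obtain ⟨S', x', a, rfl, hx'⟩ := hi.face S x
  obtain ⟨T', y', b, rfl, hy'⟩ := hj.face T y
  have h1 := Quot.sound (PreTensor.Step.mk a b x' y' k)
  rw [h1] at hz ⊢
  replace hz : (tensorMap (i.app (op S') x') (j.app (op T') y')).comp ((tensorMap a b).comp k) = φ :=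
    hz
  -- The faces of any representative contain the minimal pair, so the representative can be
  -- restricted to it.
  obtain ⟨⟨a', ha'⟩, b', hb'⟩ := hmin S' T' _ _ _ hx' hy' hz.symm
  refine ⟨X.map a'.op x', Y.map b'.op y', ?_, ?_, ?_⟩
  · rw [ha']
    exact NatTrans.naturality_apply i a'.op x'
  · rw [hb']
    exact NatTrans.naturality_apply j b'.op y'
  · have h2 := Quot.sound (PreTensor.Step.mk a' b' x' y' h)
    refine Eq.trans ?_ h2.symm
    have : (tensorMap a b).comp k = (tensorMap a' b').comp h := by
      refine PreBroadPoset.tensorMap_injective hx' hy' (hz.trans (hφ.trans ?_))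
      rw [ha', hb']
      rfl
    rw [this]

end TensorPresheaf

/-! ### Presheaves of maps into a broad poset with `G`-action -/

section GBroad

variable (G : Type u) [Group G] {E : Type u} [MulAction G E] (P : PreBroadPoset E)

/-- The group `G` acts on the pre-broad poset `P`. -/
def PreBroadPoset.IsEquivariant : Prop :=
  ∀ (g : G) (s : Multiset E) (e : E), P.rel s e → P.rel (s.map (fun x => g • x)) (g • e)

variable {G P}

/-- The action of an element of `G`. -/
def PreBroadPoset.IsEquivariant.smulHom (hG : P.IsEquivariant G) (g : G) : Hom P P where
  toFun e := g • e
  map_rel := hG g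

/-- A `G`-stable set of maps from trees to `P`, closed under precomposition. -/
structure PreBroadPoset.IsGSieve (hG : P.IsEquivariant G)
    (A : ∀ U : Omega, Hom U.broad P → Prop) : Prop where
  comp : ∀ (U V : Omega) (a : U ⟶ V) (φ : Hom V.broad P), A V φ → A U (φ.comp a)
  smul : ∀ (g : G) (U : Omega) (φ : Hom U.broad P), A U φ → A U ((hG.smulHom g).comp φ)

/-- The subpresheaf of the maps in `A`. -/
def PreBroadPoset.IsGSieve.subfunctor {hG : P.IsEquivariant G}
    {A : ∀ U : Omega, Hom U.broad P → Prop} (hA : IsGSieve hG A) : Subfunctor (homPresheaf P) where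
  obj U := {φ | A U.unop φ}
  map a φ hφ := hA.comp _ _ a.unop φ hφ

/-- The presheaf with `G`-action of the maps in `A`. -/
def PreBroadPoset.IsGSieve.obj {hG : P.IsEquivariant G}
    {A : ∀ U : Omega, Hom U.broad P → Prop} (hA : IsGSieve hG A) : DSetG G where
  V := hA.subfunctor.toFunctor
  ρ :=
    { toFun := fun g =>
        { app := fun U => TypeCat.ofHom (fun φ => ⟨(hG.smulHom g).comp φ.1, hA.smul g _ φ.1 φ.2⟩)
          naturality := fun _ _ _ => rfl }
      map_one' := by
        refine NatTrans.ext (funext fun U => ?_)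
        ext φ
        exact Subtype.ext (Hom.ext (funext fun x => one_smul G (φ.1.toFun x)))
      map_mul' := fun g h => by
        refine NatTrans.ext (funext fun U => ?_)
        ext φ
        exact Subtype.ext (Hom.ext (funext fun x => mul_smul g h (φ.1.toFun x))) }

/-- The inclusion of a smaller set of maps. -/
def PreBroadPoset.IsGSieve.incl {hG : P.IsEquivariant G}
    {A A' : ∀ U : Omega, Hom U.broad P → Prop} (hA : IsGSieve hG A) (hA' : IsGSieve hG A')
    (h : ∀ U φ, A U φ → A' U φ) : hA.obj ⟶ hA'.obj where
  hom :=
    { app := fun U => TypeCat.ofHom (fun φ => ⟨φ.1, h U.unop φ.1 φ.2⟩)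
      naturality := fun _ _ _ => rfl }
  comm _ := rfl

theorem isGSieve_true (hG : P.IsEquivariant G) : IsGSieve hG (fun _ _ => True) :=
  ⟨fun _ _ _ _ _ => trivial, fun _ _ _ _ => trivial⟩

end GBroad

theorem DSetG.isIso_of_bijective {G : Type u} [Group G] {X Y : DSetG G} (f : X ⟶ Y)
    (h : ∀ U : Omega, Function.Bijective (f.hom.app (op U))) : IsIso f := by
  have : IsIso f.hom := by
    rw [NatTrans.isIso_iff_isIso_app]
    intro U
    rw [isIso_iff_bijective]
    exact h U.unop
  exact Action.isIso_of_hom_isIso f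

/-- The set of elements of a presheaf with `G`-action on a tree. -/
abbrev DSetG.ev (G : Type u) [Group G] (U : Omega) : DSetG G ⥤ Type u :=
  Action.forget _ _ ⋙ (evaluation _ _).obj (op U)

/-! ### The pushout product as a subpresheaf of the maps to `S ⊗ T` -/

section PushoutProduct

variable {G : Type u} [Group G] (S T : GTree G) (ξ : T.carrier)

theorem GTree.tensor_isEquivariant : (tensor S.broad T.broad).IsEquivariant G := fun g _ _ h =>
  (tensorMap (S.smulHom g) (T.smulHom g)).map_rel _ _ h

/-- The maps to `S ⊗ T` in the image of `∂Ω[S] ⊗ Ω[T] ∪ Ω[S] ⊗ Λ[T]`. -/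
def GTree.InPushoutProduct (U : Omega) (φ : Hom U.broad (tensor S.broad T.broad)) : Prop :=
  ∃ (V W : Omega) (v : Hom V.broad S.broad) (w : Hom W.broad T.broad)
    (h : Hom U.broad (tensor V.broad W.broad)), φ = (tensorMap v w).comp h ∧
    (v ∈ (S.faceUnion S.BoundaryFace).obj (op V) ∨
      w ∈ (T.faceUnion (T.HornFace (MulAction.orbit G ξ))).obj (op W))

theorem GTree.isGSieve_inPushoutProduct :
    IsGSieve (S.tensor_isEquivariant T) (S.InPushoutProduct T ξ) where
  comp := by
    rintro U V a _ ⟨V', W', v, w, h, rfl, hvw⟩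
    exact ⟨V', W', v, w, h.comp a, rfl, hvw⟩
  smul := by
    rintro g U _ ⟨V', W', v, w, h, rfl, hvw⟩
    refine ⟨V', W', (S.smulHom g).comp v, (T.smulHom g).comp w, h, rfl, hvw.imp ?_ ?_⟩
    · intro hv
      exact ((S.boundary.ρ g).app (op V') ⟨v, hv⟩).2
    · intro hw
      exact (((T.horn ξ).ρ g).app (op W') ⟨w, hw⟩).2

/-- The map from `Ω[S] ⊗ Ω[T]` to the presheaf of maps to `S ⊗ T`. -/
def GTree.tensorToHomG : ((tensorG G).obj S.omega).obj T.omega ⟶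
    (isGSieve_true (S.tensor_isEquivariant T)).obj where
  hom :=
    { app := fun U => TypeCat.ofHom (fun z =>
        ⟨(tensorToHom (𝟙 (homPresheaf S.broad)) (𝟙 (homPresheaf T.broad))).app U z, trivial⟩)
      naturality := by
        intro U V a
        ext z
        obtain ⟨z⟩ := z
        rfl }
  comm g := by
    refine NatTrans.ext (funext fun U => ?_)
    ext z
    obtain ⟨z⟩ := z
    rfl

variable {S T ξ}

/-- The normal form gives injectivity, and the minimal faces of a map provide an element over it. -/
theorem GTree.isIso_tensorToHomG (hST : Amenable S.broad T.broad) : IsIso (S.tensorToHomG T) := by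
  refine DSetG.isIso_of_bijective _ (fun U => ⟨fun z z' hz => ?_, fun φ => ?_⟩)
  · have hz := congrArg Subtype.val hz
    obtain ⟨V, W, v, w, h, H⟩ := exists_tensor_normal_form S.isForest T.isForest hST U
      ((tensorToHom (𝟙 (homPresheaf S.broad)) (𝟙 (homPresheaf T.broad))).app (op U) z')
    obtain ⟨x, y, rfl, rfl, h1⟩ := H _ _ (isFaceUnion_id S.isForest) (isFaceUnion_id T.isForest) z hz
    obtain ⟨x', y', hx, hy, h2⟩ :=
      H _ _ (isFaceUnion_id S.isForest) (isFaceUnion_id T.isForest) z' rfl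
    obtain rfl : x' = x := hx
    obtain rfl : y' = y := hy
    rw [h1, h2]
  · obtain ⟨V, W, v, w, h, hv, hw, hφ, hmin⟩ :=
      exists_minimal_faces S.isForest T.isForest hST U φ.1
    exact ⟨Quot.mk _ ⟨V, W, v, w, h⟩, Subtype.ext hφ.symm⟩

/-- The pushout-product map is isomorphic to the inclusion of its image in the presheaf of maps
to `S ⊗ T`. -/
theorem GTree.nonempty_arrow_iso (hST : Amenable S.broad T.broad)
    (sq : (tensorG G).PushoutObjObj S.boundaryι (T.hornι ξ)) :
    Nonempty (Arrow.mk sq.ι ≅ Arrow.mk ((S.isGSieve_inPushoutProduct T ξ).incl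
      (isGSieve_true (S.tensor_isEquivariant T)) (fun _ _ _ => trivial))) := by
  have := isIso_tensorToHomG hST
  have hpush := fun U : Omega => sq.isPushout.map (DSetG.ev G U)
  let Θ : sq.pt ⟶ (isGSieve_true (S.tensor_isEquivariant T)).obj := sq.ι ≫ S.tensorToHomG T
  have hl : ∀ (U : Omega) (z : (tensorObj S.omega.V (T.horn ξ).V).obj (op U)),
      (Θ.hom.app (op U) (sq.inl.hom.app (op U) z)).1 =
        (tensorToHom (𝟙 (homPresheaf S.broad)) (T.faceUnion _).ι).app (op U) z := by
    intro U z
    have h1 : sq.inl ≫ Θ = ((tensorG G).obj S.omega).map (T.hornι ξ) ≫ S.tensorToHomG T := by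
      rw [← sq.inl_ι, Category.assoc]
    have h2 := ConcreteCategory.congr_hom (congrArg (fun f => (DSetG.ev G U).map f) h1) z
    refine (congrArg Subtype.val h2).trans ?_
    obtain ⟨z⟩ := z
    rfl
  have hr : ∀ (U : Omega) (z : (tensorObj S.boundary.V T.omega.V).obj (op U)),
      (Θ.hom.app (op U) (sq.inr.hom.app (op U) z)).1 =
        (tensorToHom (S.faceUnion _).ι (𝟙 (homPresheaf T.broad))).app (op U) z := by
    intro U z
    have h1 : sq.inr ≫ Θ = ((tensorG G).map S.boundaryι).app T.omega ≫ S.tensorToHomG T := by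
      rw [← sq.inr_ι, Category.assoc]
    have h2 := ConcreteCategory.congr_hom (congrArg (fun f => (DSetG.ev G U).map f) h1) z
    refine (congrArg Subtype.val h2).trans ?_
    obtain ⟨z⟩ := z
    rfl
  have hmem : ∀ (U : Omega) (z : sq.pt.V.obj (op U)),
      S.InPushoutProduct T ξ U (Θ.hom.app (op U) z).1 := by
    intro U z
    rcases Limits.Types.eq_or_eq_of_isPushout (hpush U) z with ⟨z, rfl⟩ | ⟨z, rfl⟩
    · have := hl U z
      refine cast (congrArg _ this.symm) ?_
      obtain ⟨z⟩ := z
      exact ⟨z.S, z.T, _, _, z.h, rfl, Or.inr z.y.2⟩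
    · have := hr U z
      refine cast (congrArg _ this.symm) ?_
      obtain ⟨z⟩ := z
      exact ⟨z.S, z.T, _, _, z.h, rfl, Or.inl z.x.2⟩
  let α : sq.pt ⟶ (S.isGSieve_inPushoutProduct T ξ).obj :=
    { hom :=
        { app := fun U => TypeCat.ofHom (fun z => ⟨(Θ.hom.app U z).1, hmem U.unop z⟩)
          naturality := by
            intro U V a
            ext z
            have h1 := congrArg (fun t : {φ : Hom V.unop.broad (tensor S.broad T.broad) // True} =>
              t.1) (NatTrans.naturality_apply Θ.hom a z)
            exact Subtype.ext h1 }
      comm := by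
        intro g
        refine NatTrans.ext (funext fun U => ?_)
        ext z
        have h1 := ConcreteCategory.congr_hom (congrArg (fun f => NatTrans.app f U) (Θ.comm g)) z
        have h2 := congrArg (fun t : {φ : Hom U.unop.broad (tensor S.broad T.broad) // True} =>
          t.1) h1
        exact Subtype.ext h2 }
  have hα : IsIso α := by
    refine DSetG.isIso_of_bijective _ (fun U => ⟨fun z z' hz => ?_, fun φ => ?_⟩)
    · replace hz : (Θ.hom.app (op U) z).1 = (Θ.hom.app (op U) z').1 :=
        congrArg (fun t : {φ : Hom U.broad (tensor S.broad T.broad) // S.InPushoutProduct T ξ U φ} =>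
          t.1) hz
      obtain ⟨V, W, v, w, h, H⟩ := exists_tensor_normal_form S.isForest T.isForest hST U
        (Θ.hom.app (op U) z').1
      -- Elements of the two pieces with the same image have the same normal form, so its first
      -- factor is in the boundary and its second in the horn: both come from the common corner.
      have key : ∀ (a : (tensorObj S.omega.V (T.horn ξ).V).obj (op U))
          (b : (tensorObj S.boundary.V T.omega.V).obj (op U)),
          (Θ.hom.app (op U) (sq.inl.hom.app (op U) a)).1 = (Θ.hom.app (op U) z').1 →
          (Θ.hom.app (op U) (sq.inr.hom.app (op U) b)).1 = (Θ.hom.app (op U) z').1 →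
          sq.inl.hom.app (op U) a = sq.inr.hom.app (op U) b := by
        intro a b ha hb
        rw [hl] at ha
        rw [hr] at hb
        obtain ⟨x, y, hx, hy, rfl⟩ := H _ _ (isFaceUnion_id S.isForest)
          (isFaceUnion_faceUnion T _) a ha
        obtain ⟨x', y', hx', hy', rfl⟩ := H _ _ (isFaceUnion_faceUnion S _)
          (isFaceUnion_id T.isForest) b hb
        have hxx : (S.boundaryι).hom.app (op V) x' = x := hx'.trans hx.symm
        have hyy : (T.hornι ξ).hom.app (op W) y = y' := hy.trans hy'.symm
        subst hxx
        subst hyy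
        exact ConcreteCategory.congr_hom (hpush U).w
          (Quot.mk (PreTensor.Step S.boundary.V (T.horn ξ).V U) ⟨V, W, x', y, h⟩)
      rcases Limits.Types.eq_or_eq_of_isPushout (hpush U) z with ⟨a, rfl⟩ | ⟨a, rfl⟩ <;>
      rcases Limits.Types.eq_or_eq_of_isPushout (hpush U) z' with ⟨b, rfl⟩ | ⟨b, rfl⟩
      · have ha := (hl U a).symm.trans hz
        have hb := (hl U b).symm
        obtain ⟨x, y, hx, hy, rfl⟩ := H _ _ (isFaceUnion_id S.isForest)
          (isFaceUnion_faceUnion T _) a ha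
        obtain ⟨x', y', hx', hy', rfl⟩ := H _ _ (isFaceUnion_id S.isForest)
          (isFaceUnion_faceUnion T _) b hb
        obtain rfl : x' = x := hx'.trans hx.symm
        obtain rfl : y' = y := Subtype.ext (hy'.trans hy.symm)
        rfl
      · exact key a b hz rfl
      · exact (key b a rfl hz).symm
      · have ha := (hr U a).symm.trans hz
        have hb := (hr U b).symm
        obtain ⟨x, y, hx, hy, rfl⟩ := H _ _ (isFaceUnion_faceUnion S _)
          (isFaceUnion_id T.isForest) a ha
        obtain ⟨x', y', hx', hy', rfl⟩ := H _ _ (isFaceUnion_faceUnion S _)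
          (isFaceUnion_id T.isForest) b hb
        obtain rfl : x' = x := Subtype.ext (hx'.trans hx.symm)
        obtain rfl : y' = y := hy'.trans hy.symm
        rfl
    · obtain ⟨φ, V, W, v, w, h, rfl, hv | hw⟩ := φ
      · exact ⟨sq.inr.hom.app (op U) (Quot.mk _ ⟨V, W, ⟨v, hv⟩, w, h⟩), Subtype.ext (hr U _)⟩
      · exact ⟨sq.inl.hom.app (op U) (Quot.mk _ ⟨V, W, v, ⟨w, hw⟩, h⟩), Subtype.ext (hl U _)⟩
  exact ⟨Arrow.isoMk (asIso α) (asIso (S.tensorToHomG T)) rfl⟩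

end PushoutProduct


/-! ### Attaching cells -/

/-- A criterion for pushout squares of presheaves with `G`-action. -/
theorem DSetG.isPushout_of {G : Type u} [Group G] {L A K A' : DSetG G} {t : L ⟶ A} {l : L ⟶ K}
    {r : A ⟶ A'} {b : K ⟶ A'} (hw : t ≫ r = l ≫ b)
    (hr : ∀ (U : Omega) (x y : A.V.obj (op U)), r.hom.app (op U) x = r.hom.app (op U) y → x = y)
    (hl : ∀ (U : Omega) (x y : L.V.obj (op U)), l.hom.app (op U) x = l.hom.app (op U) y → x = y)
    (hpull : ∀ (U : Omega) (x : A.V.obj (op U)) (y : K.V.obj (op U)),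
      r.hom.app (op U) x = b.hom.app (op U) y → ∃ z, l.hom.app (op U) z = y)
    (hsurj : ∀ (U : Omega) (z : A'.V.obj (op U)), (∃ x, r.hom.app (op U) x = z) ∨
      ∃ y, b.hom.app (op U) y = z)
    (hinj : ∀ (U : Omega) (x y : K.V.obj (op U)), (¬ ∃ z, l.hom.app (op U) z = x) →
      (¬ ∃ z, l.hom.app (op U) z = y) → b.hom.app (op U) x = b.hom.app (op U) y → x = y) :
    IsPushout t l r b := by
  refine IsPushout.of_map (Action.forget _ _) hw (IsPushout.of_forall_isPushout_app fun U => ?_)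
  have hw' : ∀ z, r.hom.app U (t.hom.app U z) = b.hom.app U (l.hom.app U z) := fun z =>
    ConcreteCategory.congr_hom (congrArg (fun f => (DSetG.ev G U.unop).map f) hw) z
  have : Mono (((Action.forget DSet G).map r).app U) := by
    rw [mono_iff_injective]
    exact hr U.unop
  refine Limits.Types.isPushout_of_isPullback_of_mono' ?_ ?_ ?_
  · rw [Limits.Types.isPullback_iff]
    refine ⟨?_, fun x y h => hl U.unop x y h.2, fun x y h => ?_⟩
    · exact congrArg (fun f => (DSetG.ev G U.unop).map f) hw
    · obtain ⟨z, rfl⟩ := hpull U.unop x y h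
      exact ⟨z, hr U.unop _ _ ((hw' z).trans h.symm), rfl⟩
  · refine Set.eq_univ_of_forall fun z => ?_
    rcases hsurj U.unop z with h | h
    · exact Or.inl h
    · exact Or.inr h
  · exact fun x y hx hy h => hinj U.unop x y hx hy h

section

open scoped Pointwise

variable {G : Type u} [Group G] {E : Type u} [MulAction G E]
  {P : PreBroadPoset E} {B : Box E}

/-- The map `φ` does not send leaves to edges with a nullary relation. -/
def PreBroadPoset.Saturated {D : Type w} {U : PreBroadPoset D} (φ : Hom U P) : Prop :=
  ∀ l, U.IsLeaf l → ¬ P.rel 0 (φ.toFun l)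

theorem Box.Presents.rel_zero_iff (hB : B.Presents P) {e : E} :
    P.rel 0 e ↔ ∀ p, B.leaf p → ¬ B.le p e := by
  rw [hB]
  constructor
  · intro h p hp hpe
    obtain ⟨f, hf, -⟩ := h.cover p hp hpe
    simp at hf
  · exact fun h => ⟨by simp, by simp, by simp, fun p hp hpe => absurd hpe (h p hp)⟩

theorem Box.Presents.exists_of_saturated (hB : B.Presents P) {D : Type w} {U : PreBroadPoset D}
    {φ : Hom U P} (hφ : Saturated φ) {l : D} (hl : U.IsLeaf l) :
    ∃ p, B.leaf p ∧ B.le p (φ.toFun l) := by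
  have := hφ l hl
  rw [hB.rel_zero_iff] at this
  push Not at this
  exact this

/-- The image of the map `φ` is one of the subtrees in `𝒟`. -/
def PreBroadPoset.Spans (𝒟 : Set (Set E)) (U : Omega) (φ : Hom U.broad P) : Prop :=
  Set.range φ.toFun ∈ 𝒟 ∧ Saturated φ

/-- A set of subtrees such that the maps that span one of them are closed under extension. -/
structure CellBase (hG : P.IsEquivariant G) (B : Box E) (𝒟₀ : Set (Set E)) : Prop where
  presents : B.Presents P
  subtree : ∀ X ∈ 𝒟₀, B.IsSubtree X
  reflect : ∀ (U V : Omega) (a : U ⟶ V) (φ : Hom V.broad P), Spans 𝒟₀ U (φ.comp a) → Spans 𝒟₀ V φ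

/-- A `G`-stable set of subtrees in `𝒟₀`, closed under passage to larger ones. -/
structure IsUpper (G : Type u) [Group G] [MulAction G E] (𝒟₀ 𝒟 : Set (Set E)) : Prop where
  le : 𝒟 ⊆ 𝒟₀
  up : ∀ V ∈ 𝒟, ∀ V' ∈ 𝒟₀, V ⊆ V' → V' ∈ 𝒟
  smul : ∀ g : G, ∀ X ∈ 𝒟, g • X ∈ 𝒟

namespace CellBase

variable {hG : P.IsEquivariant G} {𝒟₀ : Set (Set E)} (hb : CellBase hG B 𝒟₀)
include hb

theorem spans_of_comp {𝒟 : Set (Set E)} (h𝒟 : IsUpper G 𝒟₀ 𝒟) {U V : Omega} (a : U ⟶ V)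
    (φ : Hom V.broad P) (h : Spans 𝒟 U (φ.comp a)) : Spans 𝒟 V φ := by
  have h' := hb.reflect U V a φ ⟨h𝒟.le h.1, h.2⟩
  refine ⟨h𝒟.up _ h.1 _ h'.1 ?_, h'.2⟩
  rintro _ ⟨x, rfl⟩
  exact ⟨a.toFun x, rfl⟩

/-- The image of `φ` contains that of any precomposition, and `𝒟` is closed under enlargement, so a
map with a spanning precomposition spans `𝒟` itself. -/
theorem isGSieve {𝒟 : Set (Set E)} (h𝒟 : IsUpper G 𝒟₀ 𝒟) :
    IsGSieve hG (fun U φ => ¬ Spans 𝒟 U φ) where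
  comp _ _ a φ hφ h := hφ (hb.spans_of_comp h𝒟 a φ h)
  smul := by
    rintro g U φ hφ ⟨h₁, h₂⟩
    refine hφ ⟨?_, fun l hl h => h₂ l hl (hG g 0 _ h)⟩
    have := h𝒟.smul g⁻¹ _ h₁
    convert this using 1
    ext x
    rw [Set.mem_inv_smul_set_iff]
    constructor
    · rintro ⟨y, rfl⟩
      exact ⟨y, rfl⟩
    · rintro ⟨y, hy⟩
      exact ⟨y, smul_left_cancel g hy⟩

end CellBase

/-! ### The `G`-tree of an orbit of subtrees -/

/-- The edges of the `G`-tree of the orbit of `X`. -/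
abbrev OrbitEdge (G : Type u) [Group G] [MulAction G E] (X : Set E) : Type u :=
  {q : Set E × E // q.1 ∈ MulAction.orbit G X ∧ q.2 ∈ q.1}

instance (X : Set E) : MulAction G (OrbitEdge G X) where
  smul g q := ⟨(g • q.1.1, g • q.1.2), MulAction.mem_orbit_of_mem_orbit g q.2.1,
    Set.smul_mem_smul_set q.2.2⟩
  one_smul q := Subtype.ext (Prod.ext (one_smul G q.1.1) (one_smul G q.1.2))
  mul_smul g h q := Subtype.ext (Prod.ext (mul_smul g h q.1.1) (mul_smul g h q.1.2))

/-- Translates of `X` may overlap in `E`. Recording the translate along with its element makes the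
components disjoint. -/
theorem isNested_orbitEdge {X : Set E} (hX : ∀ Z ∈ MulAction.orbit G X, B.IsSubtree Z) :
    (B.copies (Set E)).IsNested (Subtype.val : OrbitEdge G X → Set E × E) where
  inj := Subtype.val_injective
  comp := by
    rintro ⟨⟨Z, x⟩, hZ, hx⟩ ⟨⟨Z', y⟩, hZ', hy⟩
    by_cases h : Z = Z'
    · subst h
      rcases (hX Z hZ).comp x hx y hy with h | h | h
      · exact Or.inl ⟨rfl, h⟩
      · exact Or.inr (Or.inl ⟨rfl, h⟩)
      · exact Or.inr (Or.inr (Or.inr h))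
    · exact Or.inr (Or.inr (Or.inl h))
  cover := by
    rintro ⟨⟨Z, x⟩, hZ, hx⟩ ⟨Z', p⟩ hp ⟨hZZ', hpx⟩
    obtain rfl : Z' = Z := hZZ'
    obtain ⟨d, hd, hpd, hmin⟩ := (hX _ hZ).cover x hx p hp hpx
    refine ⟨⟨(_, d), hZ, hd⟩, ⟨rfl, hpd⟩, ?_⟩
    rintro ⟨⟨Z, y⟩, hZ, hy⟩ ⟨hZZ', hyd⟩
    obtain rfl : Z = _ := hZZ'
    obtain rfl : y = d := hmin y hy hyd
    rfl

theorem orbitEdge_rel_iff (hB : B.Presents P) {X : Set E} {s : Multiset (OrbitEdge G X)}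
    {e : OrbitEdge G X} : (comap Subtype.val (B.copies (Set E)).broad).rel s e ↔
      P.rel (s.map (fun q => q.1.2)) e.1.2 ∧ ∀ q ∈ s, q.1.1 = e.1.1 := by
  change (B.copies (Set E)).Below _ _ ↔ _
  rw [Box.copies_below_iff, hB, Multiset.map_map]
  simp

theorem PreBroadPoset.Desc.smul {P : PreBroadPoset E} (hG : P.IsEquivariant G) (g : G) {a b : E}
    (h : P.Desc a b) : P.Desc (g • a) (g • b) := by
  obtain ⟨s, hs, h⟩ := h
  exact ⟨_, Multiset.mem_map_of_mem _ hs, hG g s b h⟩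

theorem PreBroadPoset.IsRoot.smul {P : PreBroadPoset E} (hG : P.IsEquivariant G) (g : G) {r : E}
    (h : P.IsRoot r) : P.IsRoot (g • r) := by
  intro e he
  have h' := h (g⁻¹ • e) (by simpa using he.smul hG g⁻¹)
  rw [← h', smul_inv_smul]

theorem orbitEdge_equivariant (hG : P.IsEquivariant G) (hB : B.Presents P) (X : Set E) :
    (comap (Subtype.val : OrbitEdge G X → _) (B.copies (Set E)).broad).IsEquivariant G := by
  intro g s e h
  rw [orbitEdge_rel_iff hB] at h ⊢
  refine ⟨?_, ?_⟩
  · have := hG g _ _ h.1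
    rw [Multiset.map_map] at this ⊢
    exact this
  · intro q hq
    obtain ⟨q, hq', rfl⟩ := Multiset.mem_map.1 hq
    exact congrArg (fun Z => g • Z) (h.2 q hq')

/-- The `G`-tree of the orbit of a subtree. -/
def orbitTree [Finite E] (hG : P.IsEquivariant G) (hB : B.Presents P) (X : Set E)
    (hX : ∀ Z ∈ MulAction.orbit G X, B.IsSubtree Z) : GTree G where
  carrier := OrbitEdge G X
  broad := comap Subtype.val (B.copies (Set E)).broad
  isForest := (isNested_orbitEdge hX).isForest
  smul_rel := orbitEdge_equivariant hG hB X
  root_orbit := by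
    have hdesc : ∀ a b : OrbitEdge G X, _ ↔ _ := fun a b => (isNested_orbitEdge hX).desc_iff
      (a := a) (b := b)
    obtain ⟨r, hr, hmax⟩ := (hX X (MulAction.mem_orbit_self X)).top
    let r' : OrbitEdge G X := ⟨(X, r), MulAction.mem_orbit_self X, hr⟩
    have hr' : (comap (Subtype.val : OrbitEdge G X → _) (B.copies (Set E)).broad).IsRoot r' := by
      rintro ⟨⟨Z, y⟩, hZ, hy⟩ h
      rw [hdesc] at h
      obtain ⟨h₁, h₂⟩ := h
      obtain rfl : X = Z := h₁
      obtain rfl : r = y := B.antisymm h₂ (hmax y hy)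
      rfl
    refine ⟨r', Set.Subset.antisymm ?_ ?_⟩
    · rintro ⟨⟨Z, y⟩, ⟨g, hg⟩, hy⟩ hq
      replace hg : g • X = Z := hg
      refine ⟨g, ?_⟩
      have h1 := IsRoot.smul (orbitEdge_equivariant hG hB X) g⁻¹ hq
      have h2 := h1 r' ((hdesc _ _).2 ⟨inv_smul_eq_iff.2 hg.symm, hmax _ ?_⟩)
      · exact (congrArg (fun q => g • q) h2).trans (smul_inv_smul g _)
      · refine Set.mem_smul_set_iff_inv_smul_mem.1 ?_
        rw [hg]
        exact hy
    · rintro _ ⟨g, rfl⟩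
      exact IsRoot.smul (orbitEdge_equivariant hG hB X) g hr'

end


section

open scoped Pointwise

variable {G : Type u} [Group G] {E : Type u} [MulAction G E]
  {P : PreBroadPoset E} {B : Box E}

/-! ### Pairings -/

/-- The subtrees in `𝒞` are grouped into intervals `[V \ c V, V ∪ c V]`, where `c V` consists of
inner edges of `V ∪ c V`, and these intervals are well ordered by `k`. -/
structure IsPairing (G : Type u) [Group G] [MulAction G E] (B : Box E) (𝒞 : Set (Set E))
    (c : Set E → Set E) (k : Set E → ℕ) : Prop where
  mem : ∀ V ∈ 𝒞, ∀ E' ⊆ c V, (V ∪ c V) \ E' ∈ 𝒞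
  eq : ∀ V ∈ 𝒞, ∀ E' ⊆ c V, c ((V ∪ c V) \ E') = c V
  smul : ∀ g : G, ∀ V ∈ 𝒞, c (g • V) = g • c V
  nonempty : ∀ V ∈ 𝒞, (c V).Nonempty
  above : ∀ V ∈ 𝒞, ∀ x ∈ c V, ∃ y ∈ V, B.le x y ∧ y ≠ x
  below : ∀ V ∈ 𝒞, ∀ x ∈ c V, ∀ p, B.leaf p → B.le p x → ∃ y ∈ V, B.le y x ∧ y ≠ x
  key_smul : ∀ g : G, ∀ V ∈ 𝒞, k (g • V) = k V
  key : ∀ U ∈ 𝒞, ∀ V ∈ 𝒞, V ⊆ U → V ∪ c V = U ∪ c U ∨ k (V ∪ c V) < k (U ∪ c U)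

namespace IsPairing

variable {𝒞 : Set (Set E)} {c : Set E → Set E} {k : Set E → ℕ} (hc : IsPairing G B 𝒞 c k)
include hc

theorem hat_mem {V : Set E} (hV : V ∈ 𝒞) : V ∪ c V ∈ 𝒞 := by
  simpa using hc.mem V hV ∅ (Set.empty_subset _)

theorem hat_eq {V : Set E} (hV : V ∈ 𝒞) : c (V ∪ c V) = c V := by
  simpa using hc.eq V hV ∅ (Set.empty_subset _)

theorem hat_hat {V : Set E} (hV : V ∈ 𝒞) : (V ∪ c V) ∪ c (V ∪ c V) = V ∪ c V := by
  rw [hc.hat_eq hV, Set.union_assoc, Set.union_self]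

theorem hat_smul (g : G) {V : Set E} (hV : V ∈ 𝒞) : g • V ∪ c (g • V) = g • (V ∪ c V) := by
  rw [hc.smul g V hV, Set.smul_set_union]

end IsPairing

/-! ### Attaching one orbit of intervals -/

section Attach

variable {hG : P.IsEquivariant G} {𝒟₀ : Set (Set E)} (hb : CellBase hG B 𝒟₀)
include hb

namespace CellBase

/-- The map from the `G`-tree of an orbit of subtrees. -/
def orbitTreeHom (_ : CellBase hG B 𝒟₀) (X : Set E) :
    Hom (comap (Subtype.val : OrbitEdge G X → _) (B.copies (Set E)).broad) P where
  toFun q := q.1.2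
  map_rel _ _ h := ((orbitEdge_rel_iff ‹CellBase hG B 𝒟₀›.presents).1 h).1

omit hb in
theorem smul_mem_sdiff {𝒟 𝒟' : Set (Set E)} (h𝒟 : IsUpper G 𝒟₀ 𝒟) (h𝒟' : IsUpper G 𝒟₀ 𝒟')
    {Z : Set E} (hZ : Z ∈ 𝒟 \ 𝒟') (g : G) : g • Z ∈ 𝒟 \ 𝒟' :=
  ⟨h𝒟.smul g Z hZ.1, fun h => hZ.2 (by simpa using h𝒟'.smul g⁻¹ _ h)⟩

end CellBase

/-- Attaching the cells in a single interval, for which the toggled edges form one orbit. -/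
theorem attach_orbit [Finite E] (W : MorphismProperty (DSetG G)) [W.IsStableUnderCobaseChange]
    (hW : innerHorns G ≤ W) {𝒟 𝒟' : Set (Set E)} (h𝒟 : IsUpper G 𝒟₀ 𝒟) (h𝒟' : IsUpper G 𝒟₀ 𝒟')
    (hle : 𝒟' ⊆ 𝒟) {c : Set E → Set E} {k : Set E → ℕ} (hc : IsPairing G B (𝒟 \ 𝒟') c k)
    {X : Set E} (hX : X ∈ 𝒟 \ 𝒟') (hXc : X ∪ c X = X)
    (hclass : ∀ V ∈ 𝒟 \ 𝒟', ∃ g : G, V ∪ c V = g • X) {x : E} (hx : x ∈ c X)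
    (horbit : ∀ y ∈ c X, ∃ g : G, g • X = X ∧ g • x = y) :
    W ((hb.isGSieve h𝒟).incl (hb.isGSieve h𝒟') (fun _ _ h h' => h ⟨hle h'.1, h'.2⟩)) := by
  have hB := hb.presents
  have hcX : c X ⊆ X := by
    intro y hy
    have : y ∈ X ∪ c X := Or.inr hy
    rwa [hXc] at this
  have hmem : ∀ Z ∈ MulAction.orbit G X, Z ∈ 𝒟 \ 𝒟' := by
    rintro _ ⟨g, rfl⟩
    exact CellBase.smul_mem_sdiff h𝒟 h𝒟' hX g
  have hhatZ : ∀ Z ∈ MulAction.orbit G X, Z ∪ c Z = Z := by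
    rintro _ ⟨g, rfl⟩
    exact (hc.hat_smul g hX).trans (by rw [hXc])
  -- As `k` is constant on the orbit of `X`, the strict alternative in `key` cannot occur: a cell
  -- inside a translate `Z` has `Z` as the top of its interval.
  have hkey : ∀ V ∈ 𝒟 \ 𝒟', ∀ Z ∈ MulAction.orbit G X, V ⊆ Z → V ∪ c V = Z := by
    rintro V hV Z hZ hVZ
    rcases hc.key Z (hmem Z hZ) V hV hVZ with h | h
    · rw [h, hhatZ Z hZ]
    · obtain ⟨g, hg⟩ := hclass V hV
      obtain ⟨g', hg'⟩ := hZ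
      replace hg' : g' • X = Z := hg'
      rw [hhatZ Z ⟨g', hg'⟩, hg, ← hg', hc.key_smul g X hX, hc.key_smul g' X hX] at h
      exact absurd h (lt_irrefl _)
  have hin : ∀ V ∈ 𝒟, ∀ Z ∈ MulAction.orbit G X, V ⊆ Z → V ∈ 𝒟 \ 𝒟' := fun V hV Z hZ hVZ =>
    ⟨hV, fun h => (hmem Z hZ).2 (h𝒟'.up V h Z (h𝒟.le (hmem Z hZ).1) hVZ)⟩
  have hsub : ∀ Z ∈ MulAction.orbit G X, B.IsSubtree Z := fun Z hZ =>
    hb.subtree Z (h𝒟.le (hmem Z hZ).1)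
  let T : GTree G := orbitTree hG hB X hsub
  have hnest := isNested_orbitEdge hsub
  let π : Hom T.broad P := hb.orbitTreeHom X
  let ζ : T.carrier := ⟨(X, x), MulAction.mem_orbit_self X, hcX hx⟩
  have hζ : T.IsInnerEdge ζ := by
    constructor
    · intro h
      obtain ⟨hmin, ⟨Z, p⟩, hp, hpx⟩ := hnest.isLeaf_iff.1 h
      obtain ⟨y, hy, hyx, hne⟩ := hc.below X hX x hx p hp hpx.2
      have := hmin ⟨(X, y), MulAction.mem_orbit_self X, hy⟩ ⟨rfl, hyx⟩
      exact hne (congrArg (fun q => q.1.2) this)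
    · intro h
      obtain ⟨y, hy, hyx, hne⟩ := hc.above X hX x hx
      have := h ⟨(X, y), MulAction.mem_orbit_self X, hy⟩ (hnest.desc_iff.2 ⟨rfl, hyx⟩)
      exact hne (congrArg (fun q => q.1.2) this)
  -- Transitivity of the stabilizer of `X` on `c X` makes the orbit of `ζ` meet the component `Z`
  -- exactly in `c Z`.
  have horb : ∀ Z ∈ MulAction.orbit G X, ∀ (y : E) (hy : y ∈ Z) (hZ : Z ∈ MulAction.orbit G X),
      (⟨(Z, y), hZ, hy⟩ : T.carrier) ∈ MulAction.orbit G ζ ↔ y ∈ c Z := by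
    rintro Z ⟨g, hg⟩ y hy hZ
    replace hg : g • X = Z := hg
    constructor
    · rintro ⟨g', hg'⟩
      replace hg' : g' • ζ = _ := hg'
      have h1 : g' • X = Z := congrArg (fun q => q.1.1) hg'
      have h2 : g' • x = y := congrArg (fun q => q.1.2) hg'
      rw [← h1, hc.smul g' X hX, ← h2]
      exact Set.smul_mem_smul_set hx
    · intro hyc
      rw [← hg, hc.smul g X hX] at hyc
      obtain ⟨z, hz, rfl⟩ := hyc
      obtain ⟨g', hg', rfl⟩ := horbit z hz
      refine ⟨g * g', Subtype.ext (Prod.ext ?_ ?_)⟩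
      · change (g * g') • X = Z
        rw [mul_smul, hg', hg]
      · exact mul_smul g g' x
  have hcomp : ∀ (U : Omega) (φ : Hom U.broad T.broad), ∃ Z ∈ MulAction.orbit G X,
      ∀ w, (φ.toFun w).1.1 = Z := by
    intro U φ
    obtain ⟨r, hr⟩ := U.isTree.root
    refine ⟨_, (φ.toFun r).2.1, fun w => ?_⟩
    have : Desc T.broad (φ.toFun w) (φ.toFun r) := by
      obtain ⟨s, hs, h⟩ := hr w
      exact ⟨_, Multiset.mem_map_of_mem _ hs, φ.map_rel _ _ h⟩
    exact (hnest.desc_iff.1 this).1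
  have hcompsub : ∀ (U : Omega) (φ : Hom U.broad T.broad) (Z : Set E),
      (∀ w, (φ.toFun w).1.1 = Z) → Set.range (π.comp φ).toFun ⊆ Z := by
    rintro U φ Z hZ _ ⟨w, rfl⟩
    have := (φ.toFun w).2.2
    rwa [hZ w] at this
  -- The faces missing from the horn are the `Z \ E'` with `E' ⊆ c Z`, and these are exactly the
  -- members of `𝒟` contained in `Z`.
  have hhorn : ∀ (U : Omega) (φ : Hom U.broad T.broad),
      φ ∈ (T.faceUnion (T.HornFace (MulAction.orbit G ζ))).obj (op U) ↔
        ¬ Spans 𝒟 U (π.comp φ) := by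
    intro U φ
    constructor
    · rintro ⟨V, ψ, a, hψ, hface, rfl⟩ hspan
      have hspan := hb.spans_of_comp h𝒟 a (π.comp ψ) hspan
      obtain ⟨Z, hZ, hψZ⟩ := hcomp V ψ
      have hVZ := hcompsub V ψ Z hψZ
      have hhat := hkey _ (hin _ hspan.1 Z hZ hVZ) Z hZ hVZ
      obtain ⟨r, hr, hmax⟩ := (hsub Z hZ).top
      have hπψ : Function.Injective (π.comp ψ).toFun := fun a b hab =>
        hψ (Subtype.ext (Prod.ext ((hψZ a).trans (hψZ b).symm) hab))
      refine hface ⟨⟨(Z, r), hZ, hr⟩, {q | q.1.1 = Z ∧ q.1.2 ∉ Set.range (π.comp ψ).toFun}, ?_,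
        ?_, ?_, ?_⟩
      · rintro ⟨⟨Z', y⟩, hZ', hy⟩ ⟨h₁, h₂⟩
        obtain rfl : Z' = Z := h₁
        refine (horb Z' hZ' y hy hZ').2 ?_
        have hy' : y ∈ Z' := hy
        rw [← hhat] at hy'
        rw [← hhat, hc.hat_eq (hin _ hspan.1 Z' hZ hVZ)]
        exact hy'.resolve_left h₂
      · rintro ⟨⟨Z', y⟩, hZ', hy⟩ h
        obtain ⟨h₁, h₂⟩ := hnest.desc_iff.1 h
        obtain rfl : Z = Z' := h₁
        obtain rfl : r = y := B.antisymm h₂ (hmax y hy)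
        rfl
      · ext q
        constructor
        · rintro ⟨w, rfl⟩
          refine ⟨hnest.desc_iff.2 ⟨hψZ w, hmax _ (hVZ ⟨w, rfl⟩)⟩, fun h => h.2 ⟨w, rfl⟩⟩
        · rintro ⟨h₁, h₂⟩
          have h₁ : q.1.1 = Z := (hnest.desc_iff.1 h₁).1
          by_contra hno
          refine h₂ ⟨h₁, ?_⟩
          rintro ⟨w, hw⟩
          exact hno ⟨w, Subtype.ext (Prod.ext ((hψZ w).trans h₁.symm) hw)⟩
      · intro s e
        rw [hB.full V.isTree (π.comp ψ) hπψ (fun l hl => hB.exists_of_saturated hspan.2 hl)]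
        refine Iff.trans ?_ (orbitEdge_rel_iff hB).symm
        have hmap : (s.map ψ.toFun).map (fun q : OrbitEdge G X => q.1.2) =
            s.map (π.comp ψ).toFun := Multiset.map_map _ _ _
        rw [hmap]
        refine ⟨fun h => ⟨h, fun q hq => ?_⟩, fun h => h.1⟩
        obtain ⟨w, -, rfl⟩ := Multiset.mem_map.1 hq
        exact (hψZ w).trans (hψZ e).symm
    · intro hspan
      obtain ⟨V, ψ, a, hψ, rfl, hsurj, hleaf⟩ := hnest.isForest.presents.exists_image U φ
      refine ⟨V, ψ, a, hψ, ?_, rfl⟩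
      rintro ⟨⟨⟨Z, r⟩, hZ, hr⟩, E', hE', hroot, hrange, hfull⟩
      refine hspan ⟨?_, ?_⟩
      · obtain ⟨r', hr', hmax⟩ := (hsub Z hZ).top
        have hrr : r' = r := by
          have := hroot ⟨(Z, r'), hZ, hr'⟩ (hnest.desc_iff.2 ⟨rfl, hmax r hr⟩)
          exact congrArg (fun q => q.1.2) this
        subst hrr
        have hset : Set.range (π.comp (ψ.comp a)).toFun =
            (Z ∪ c Z) \ {y | ∃ hy : y ∈ Z, (⟨(Z, y), hZ, hy⟩ : T.carrier) ∈ E'} := by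
          rw [hhatZ Z hZ]
          ext y
          constructor
          · rintro ⟨w, rfl⟩
            have hw := (Set.ext_iff.1 hrange _).1 ⟨a.toFun w, rfl⟩
            have h1 : (ψ.toFun (a.toFun w)).1.1 = Z := (hnest.desc_iff.1 hw.1).1
            refine ⟨?_, ?_⟩
            · have := (ψ.toFun (a.toFun w)).2.2
              rwa [h1] at this
            · rintro ⟨hy, hyE⟩
              have : (⟨(Z, (π.comp (ψ.comp a)).toFun w), hZ, hy⟩ : T.carrier) = ψ.toFun (a.toFun w) :=
                Subtype.ext (Prod.ext h1.symm rfl)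
              exact hw.2 (this ▸ hyE)
          · rintro ⟨hy, hyE⟩
            obtain ⟨v, hv⟩ := (Set.ext_iff.1 hrange ⟨(Z, y), hZ, hy⟩).2
              ⟨hnest.desc_iff.2 ⟨rfl, hmax y hy⟩, fun h => hyE ⟨hy, h⟩⟩
            obtain ⟨w, rfl⟩ := hsurj v
            exact ⟨w, congrArg (fun q => q.1.2) hv⟩
        rw [hset]
        refine (hc.mem Z (hmem Z hZ) _ ?_).1
        rintro y ⟨hy, hyE⟩
        exact (horb Z hZ y hy hZ).1 (hE' hyE)
      · intro l hl h0
        have h1 : T.broad.rel 0 (ψ.toFun (a.toFun l)) :=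
          (orbitEdge_rel_iff hB).2 ⟨h0, fun q hq => absurd hq (Multiset.notMem_zero q)⟩
        exact hleaf l hl 0 ⟨(hfull 0 _).2 h1, by simp⟩
  have hK : ∀ (U : Omega) (φ : Hom U.broad T.broad), ¬ Spans 𝒟' U (π.comp φ) := by
    intro U φ h
    obtain ⟨Z, hZ, hφZ⟩ := hcomp U φ
    exact (hmem Z hZ).2 (h𝒟'.up _ h.1 Z (h𝒟.le (hmem Z hZ).1) (hcompsub U φ Z hφZ))
  have hπg : ∀ (g : G) (q : T.carrier), π.toFun (g • q) = g • π.toFun q := fun _ _ => rfl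
  let t : T.horn ζ ⟶ (hb.isGSieve h𝒟).obj :=
    { hom :=
        { app := fun U => TypeCat.ofHom (fun φ => ⟨π.comp φ.1, (hhorn U.unop φ.1).1 φ.2⟩)
          naturality := fun _ _ _ => rfl }
      comm := fun _ => rfl }
  let b : T.omega ⟶ (hb.isGSieve h𝒟').obj :=
    { hom :=
        { app := fun U => TypeCat.ofHom (fun φ => ⟨π.comp φ, hK U.unop φ⟩)
          naturality := fun _ _ _ => rfl }
      comm := fun _ => rfl }
  refine W.of_isPushout (f := T.hornι ζ) (g := t) (g' := b) ?_
    (hW _ (MorphismProperty.ofHoms.mk (⟨T, ⟨ζ, hζ⟩⟩ : (T : GTree G) × {ζ : T.carrier // T.IsInnerEdge ζ})))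
  have hspanZ : ∀ (U : Omega) (φ : Hom U.broad P) (Z : Set E) (hZ : Z ∈ MulAction.orbit G X)
      (hφ : Set.range φ.toFun ⊆ Z), ∃ φ' : Hom U.broad T.broad, π.comp φ' = φ := by
    intro U φ Z hZ hφ
    exact ⟨{
      toFun := fun w => ⟨(Z, φ.toFun w), hZ, hφ ⟨w, rfl⟩⟩
      map_rel := fun s e h => (orbitEdge_rel_iff hB).2 ⟨by
        have hmap : (s.map (fun w => (⟨(Z, φ.toFun w), hZ, hφ ⟨w, rfl⟩⟩ : OrbitEdge G X))).map
            (fun q : OrbitEdge G X => q.1.2) = s.map φ.toFun := Multiset.map_map _ _ _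
        exact (congrArg (fun m => P.rel m (φ.toFun e)) hmap).mpr (φ.map_rel s e h), fun q hq => by
        obtain ⟨w, -, rfl⟩ := Multiset.mem_map.1 hq
        rfl⟩ }, rfl⟩
  refine DSetG.isPushout_of rfl ?_ ?_ ?_ ?_ ?_
  · intro U φ φ' h
    have h' : φ.1 = φ'.1 := congrArg (fun t : {φ : Hom U.broad P // ¬ Spans 𝒟' U φ} => t.1) h
    exact Subtype.ext h'
  · intro U φ φ' h
    exact Subtype.ext h
  · intro U φ ψ h
    have h' : φ.1 = π.comp ψ := congrArg (fun t : {φ // _} => t.1) h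
    have h'' := φ.2
    rw [h'] at h''
    exact ⟨⟨ψ, (hhorn U ψ).2 h''⟩, rfl⟩
  · rintro U ⟨φ, hφ⟩
    by_cases h : Spans 𝒟 U φ
    · right
      have hV : Set.range φ.toFun ∈ 𝒟 \ 𝒟' := ⟨h.1, fun h' => hφ ⟨h', h.2⟩⟩
      obtain ⟨g, hg⟩ := hclass _ hV
      obtain ⟨φ', h⟩ := hspanZ U φ (g • X) ⟨g, rfl⟩ (hg ▸ Set.subset_union_left)
      exact ⟨φ', Subtype.ext h⟩
    · exact Or.inl ⟨⟨φ, h⟩, rfl⟩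
  -- The component hit by a spanning map is recovered as the top of the interval of its image, so
  -- the map to `P` determines the map to `T`.
  · intro U φ φ' h _ hπ
    have hπ : π.comp φ = π.comp φ' := congrArg (fun t : {φ // _} => t.1) hπ
    have hspan : Spans 𝒟 U (π.comp φ) := by
      by_contra h'
      exact h ⟨⟨φ, (hhorn U φ).2 h'⟩, rfl⟩
    obtain ⟨Z, hZ, hφZ⟩ := hcomp U φ
    obtain ⟨Z', hZ', hφZ'⟩ := hcomp U φ'
    have h1 := hcompsub U φ Z hφZ
    have h2 := hcompsub U φ' Z' hφZ'
    rw [← hπ] at h2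
    have h3 := hkey _ (hin _ hspan.1 Z hZ h1) Z hZ h1
    have h4 := hkey _ (hin _ hspan.1 Z' hZ' h2) Z' hZ' h2
    refine Hom.ext (funext fun w => Subtype.ext (Prod.ext ?_ ?_))
    · rw [hφZ, hφZ', ← h3, h4]
    · exact congrFun (congrArg Hom.toFun hπ) w

end Attach

end


/-! ### Refining a pairing, and the induction over intervals -/

section

open scoped Pointwise

variable {G : Type u} [Group G] {E : Type u} [MulAction G E]
  {P : PreBroadPoset E} {B : Box E}

namespace IsPairing

variable {𝒞 : Set (Set E)} {c : Set E → Set E} {k : Set E → ℕ} (hc : IsPairing G B 𝒞 c k)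
include hc

theorem hat_sdiff {V : Set E} (hV : V ∈ 𝒞) {E' : Set E} (hE' : E' ⊆ c V) :
    (V ∪ c V) \ E' ∪ c ((V ∪ c V) \ E') = V ∪ c V := by
  rw [hc.eq V hV E' hE']
  refine Set.Subset.antisymm ?_ ?_
  · rintro y (⟨hy, -⟩ | hy)
    · exact hy
    · exact Or.inr hy
  · rintro y (hy | hy)
    · by_cases h : y ∈ E'
      · exact Or.inr (hE' h)
      · exact Or.inl ⟨Or.inl hy, h⟩
    · exact Or.inr hy

/-- The condition `h` makes `𝒞'` a union of whole intervals, so toggling does not leave it. -/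
theorem mono {𝒞' : Set (Set E)} (hle : 𝒞' ⊆ 𝒞)
    (h : ∀ V ∈ 𝒞', ∀ U ∈ 𝒞, U ∪ c U = V ∪ c V → U ∈ 𝒞') : IsPairing G B 𝒞' c k where
  mem V hV E' hE' := h V hV _ (hc.mem V (hle hV) E' hE') (hc.hat_sdiff (hle hV) hE')
  eq V hV := hc.eq V (hle hV)
  smul g V hV := hc.smul g V (hle hV)
  nonempty V hV := hc.nonempty V (hle hV)
  above V hV := hc.above V (hle hV)
  below V hV := hc.below V (hle hV)
  key_smul g V hV := hc.key_smul g V (hle hV)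
  key U hU V hV := hc.key U (hle hU) V (hle hV)

/-- Shrinking the set of toggled edges, in the presence of a single orbit of intervals. -/
theorem shrink [Finite E] {X : Set E} (hX : X ∈ 𝒞)
    (hclass : ∀ V ∈ 𝒞, ∃ g : G, V ∪ c V = g • X) {x : E}
    (horbit : ¬ ∀ y ∈ c X, ∃ g : G, g • X = X ∧ g • x = y) :
    IsPairing G B 𝒞 (fun V => c V \ {y | ∃ g : G, g • X = V ∪ c V ∧ g • x = y})
      (fun V => V.ncard) := by
  have key : ∀ V ∈ 𝒞, ∀ E' ⊆ c V \ {y | ∃ g : G, g • X = V ∪ c V ∧ g • x = y},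
      ∃ E'' ⊆ c V, (V ∪ (c V \ {y | ∃ g : G, g • X = V ∪ c V ∧ g • x = y})) \ E' =
        (V ∪ c V) \ E'' := by
    intro V hV E' hE'
    -- The discarded edges that are absent from `V` count as removed from `V ∪ c V`.
    refine ⟨(c V ∩ {y | ∃ g : G, g • X = V ∪ c V ∧ g • x = y}) \ V ∪ E', ?_, ?_⟩
    · rintro y (h | h)
      · exact h.1.1
      · exact (hE' h).1
    · ext y
      have := @hE' y
      simp only [Set.mem_sdiff, Set.mem_union, Set.mem_inter_iff] at this ⊢
      tauto
  refine ⟨?_, ?_, ?_, ?_, ?_, ?_, ?_, ?_⟩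
  · intro V hV E' hE'
    obtain ⟨E'', h, h'⟩ := key V hV E' hE'
    rw [h']
    exact hc.mem V hV E'' h
  · intro V hV E' hE'
    obtain ⟨E'', h, h'⟩ := key V hV E' hE'
    rw [h', hc.hat_sdiff hV h, hc.eq V hV E'' h]
  · intro g V hV
    rw [hc.hat_smul g hV, hc.smul g V hV, Set.smul_set_sdiff]
    congr 1
    ext y
    rw [Set.mem_smul_set_iff_inv_smul_mem]
    constructor
    · rintro ⟨g', h1, rfl⟩
      exact ⟨g⁻¹ * g', by rw [mul_smul, h1, inv_smul_smul], mul_smul _ _ _⟩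
    · rintro ⟨g', h1, h2⟩
      exact ⟨g * g', by rw [mul_smul, h1], by rw [mul_smul, h2, smul_inv_smul]⟩
  · intro V hV
    push Not at horbit
    obtain ⟨y, hy, h⟩ := horbit
    obtain ⟨g, hg⟩ := hclass V hV
    refine ⟨g • y, ?_, ?_⟩
    · rw [← hc.hat_eq hV, hg, hc.smul g X hX]
      exact Set.smul_mem_smul_set hy
    · rintro ⟨g', h1, h2⟩
      rw [hg] at h1
      refine h (g⁻¹ * g') ?_ ?_
      · rw [mul_smul, h1, inv_smul_smul]
      · rw [mul_smul, h2, inv_smul_smul]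
  · exact fun V hV x hx => hc.above V hV x hx.1
  · exact fun V hV x hx => hc.below V hV x hx.1
  · exact fun g V _ => Set.ncard_smul_set g V
  -- All tops form one orbit, so the inclusion forces equal old tops and equal values of `c`. The
  -- new tops are then nested, and cardinality separates them unless they agree.
  · intro U hU V hV hVU
    have hhat : V ∪ c V = U ∪ c U := by
      rcases hc.key U hU V hV hVU with h | h
      · exact h
      · obtain ⟨g, hg⟩ := hclass V hV
        obtain ⟨g', hg'⟩ := hclass U hU
        rw [hg, hg', hc.key_smul g X hX, hc.key_smul g' X hX] at h
        exact absurd h (lt_irrefl _)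
    have hcc : c V = c U := by rw [← hc.hat_eq hV, ← hc.hat_eq hU, hhat]
    rw [hhat, hcc]
    have hsub := Set.union_subset_union_left (c U \ {y | ∃ g : G, g • X = U ∪ c U ∧ g • x = y}) hVU
    rcases hsub.eq_or_ssubset with h | h
    · exact Or.inl h
    · exact Or.inr (Set.ncard_lt_ncard h (Set.toFinite _))

end IsPairing

variable {hG : P.IsEquivariant G} {𝒟₀ : Set (Set E)} (hb : CellBase hG B 𝒟₀)
include hb

/-- Attaching cells along a pairing. -/
theorem CellBase.attach [Finite E] (W : MorphismProperty (DSetG G)) [W.IsMultiplicative]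
    [W.IsStableUnderCobaseChange] (hW : innerHorns G ≤ W) (n : ℕ) (𝒟 𝒟' : Set (Set E))
    (h𝒟 : IsUpper G 𝒟₀ 𝒟) (h𝒟' : IsUpper G 𝒟₀ 𝒟') (hle : 𝒟' ⊆ 𝒟) (c : Set E → Set E)
    (k : Set E → ℕ) (hc : IsPairing G B (𝒟 \ 𝒟') c k) (hn : ∀ V ∈ 𝒟 \ 𝒟', (c V).ncard ≤ n) :
    W ((hb.isGSieve h𝒟).incl (hb.isGSieve h𝒟') (fun _ _ h h' => h ⟨hle h'.1, h'.2⟩)) := by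
  -- Outer induction on the size of the toggled sets, which drops when the pairing is shrunk.
  induction n using Nat.strong_induction_on generalizing 𝒟 𝒟' c k with
  | _ n ihn =>
  -- For one orbit of intervals, either a single horn suffices or the orbit of an edge is discarded
  -- from the toggled sets and the outer induction applies.
  have hstep : ∀ (𝒟 𝒟' : Set (Set E)) (h𝒟 : IsUpper G 𝒟₀ 𝒟) (h𝒟' : IsUpper G 𝒟₀ 𝒟') (hle : 𝒟' ⊆ 𝒟),
      IsPairing G B (𝒟 \ 𝒟') c k → (∀ V ∈ 𝒟 \ 𝒟', (c V).ncard ≤ n) → ∀ X ∈ 𝒟 \ 𝒟', X ∪ c X = X →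
      (∀ V ∈ 𝒟 \ 𝒟', ∃ g : G, V ∪ c V = g • X) →
      W ((hb.isGSieve h𝒟).incl (hb.isGSieve h𝒟') (fun _ _ h h' => h ⟨hle h'.1, h'.2⟩)) := by
    clear hn hc
    intro 𝒟 𝒟' h𝒟 h𝒟' hle hc hn X hX hXc hclass
    obtain ⟨x, hx⟩ := hc.nonempty X hX
    by_cases horbit : ∀ y ∈ c X, ∃ g : G, g • X = X ∧ g • x = y
    · exact attach_orbit hb W hW h𝒟 h𝒟' hle hc hX hXc hclass hx horbit
    · have hc' := hc.shrink hX hclass horbit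
      have hlt : ∀ V ∈ 𝒟 \ 𝒟',
          (c V \ {y | ∃ g : G, g • X = V ∪ c V ∧ g • x = y}).ncard ≤ n - 1 := by
        intro V hV
        refine Nat.le_sub_one_of_lt (lt_of_lt_of_le (Set.ncard_lt_ncard ?_ (Set.toFinite _))
          (hn V hV))
        refine ⟨Set.sdiff_subset, fun h => ?_⟩
        obtain ⟨g, hg⟩ := hclass V hV
        have : g • x ∈ c V := by
          rw [← hc.hat_eq hV, hg, hc.smul g X hX]
          exact Set.smul_mem_smul_set hx
        exact (h this).2 ⟨g, hg.symm, rfl⟩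
      have hpos : n - 1 < n := by
        have := (Set.ncard_pos (Set.toFinite _)).2 (hc.nonempty X hX)
        have := hn X hX
        omega
      exact ihn (n - 1) hpos 𝒟 𝒟' h𝒟 h𝒟' hle _ _ hc' hlt
  -- Inner induction on the number of subtrees still to be attached.
  obtain ⟨m, hm⟩ : ∃ m, (𝒟 \ 𝒟').ncard = m := ⟨_, rfl⟩
  induction m using Nat.strong_induction_on generalizing 𝒟 with
  | _ m ihm =>
  rcases (𝒟 \ 𝒟').eq_empty_or_nonempty with h0 | hne
  · obtain rfl : 𝒟 = 𝒟' := Set.Subset.antisymm (Set.sdiff_eq_empty.1 h0) hle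
    exact W.id_mem _
  -- A top with the least key is chosen, so that removing its orbit of intervals from `𝒟` leaves a
  -- set closed under enlargement.
  · obtain ⟨V₀, hV₀, hmin⟩ := Set.exists_min_image (𝒟 \ 𝒟') (fun V => k (V ∪ c V))
      (Set.toFinite _) hne
    have hX := hc.hat_mem hV₀
    obtain ⟨X, hXdef⟩ : ∃ X, X = V₀ ∪ c V₀ := ⟨_, rfl⟩
    rw [← hXdef] at hX
    have hXc : X ∪ c X = X := by rw [hXdef, hc.hat_hat hV₀]
    let K : Set (Set E) := {U | U ∈ 𝒟 \ 𝒟' ∧ ∃ g : G, U ∪ c U = g • X}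
    have hK𝒟 : K ⊆ 𝒟 \ 𝒟' := fun U hU => hU.1
    have hXK : X ∈ K := ⟨hX, 1, by rw [hXc, one_smul]⟩
    have hKsmul : ∀ g : G, ∀ U ∈ K, g • U ∈ K := by
      rintro g U ⟨hU, g', hg'⟩
      refine ⟨CellBase.smul_mem_sdiff h𝒟 h𝒟' hU g, g * g', ?_⟩
      rw [hc.hat_smul g hU, hg', mul_smul]
    have h1 : 𝒟 \ (𝒟 \ K) = K := by
      rw [Set.sdiff_sdiff_cancel_left (hK𝒟.trans Set.sdiff_subset)]
    have hup : IsUpper G 𝒟₀ (𝒟 \ K) := by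
      refine ⟨Set.sdiff_subset.trans h𝒟.le, ?_, ?_⟩
      · intro V hV V' hV' hVV'
        refine ⟨h𝒟.up V hV.1 V' hV' hVV', ?_⟩
        rintro ⟨h, g, hg⟩
        have hV1 : V ∈ 𝒟 \ 𝒟' := ⟨hV.1, fun h' => h.2 (h𝒟'.up V h' V' hV' hVV')⟩
        rcases hc.key V' h V hV1 hVV' with h' | h'
        · exact hV.2 ⟨hV1, g, h'.trans hg⟩
        · rw [hg, hc.key_smul g X hX, hXdef] at h'
          exact absurd (hmin V hV1) (not_le.2 h')
      · intro g V hV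
        refine ⟨h𝒟.smul g V hV.1, fun h => hV.2 ?_⟩
        simpa using hKsmul g⁻¹ _ h
    have hle' : 𝒟' ⊆ 𝒟 \ K := fun V hV => ⟨hle hV, fun h => h.1.2 hV⟩
    have h2 : (𝒟 \ K) \ 𝒟' ⊆ 𝒟 \ 𝒟' := fun V hV => ⟨hV.1.1, hV.2⟩
    have W1 := hstep 𝒟 (𝒟 \ K) h𝒟 hup Set.sdiff_subset
      (by
        rw [h1]
        exact hc.mono hK𝒟 fun V hV U hU h => ⟨hU, by rw [h]; exact hV.2⟩)
      (by
        rw [h1]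
        exact fun V hV => hn V (hK𝒟 hV)) X (by rwa [h1]) hXc (by rw [h1]; exact fun V hV => hV.2)
    have W2 := ihm ((𝒟 \ K) \ 𝒟').ncard (by
        rw [← hm]
        exact Set.ncard_lt_ncard ⟨h2, fun h => (h hX).1.2 hXK⟩ (Set.toFinite _)) (𝒟 \ K) hup hle'
      (hc.mono h2 fun V hV U hU h => ⟨⟨hU.1, fun hUK => hV.1.2 ⟨h2 hV, by
        rw [← h]; exact hUK.2⟩⟩, hU.2⟩)
      (fun V hV => hn V (h2 hV)) rfl
    exact W.comp_mem _ _ W1 W2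

end


/-! ### The subtrees spanned by the cells outside of the pushout product -/

section

open scoped Pointwise

namespace GTree

variable {G : Type u} [Group G] {T : GTree G}

/-- If a face factors through another one, and the smaller one is obtained from a component by
removing inner edges, then so is the larger one. -/
theorem isComponentMinus_of_comp {V V' : Omega} {ψ : Hom V'.broad T.broad}
    (hψ : Function.Injective ψ.toFun) (a : V ⟶ V') {r : T.carrier} {E' : Set T.carrier}
    (hE : ∀ e ∈ E', T.IsInnerEdge e) (h : IsComponentMinus (ψ.comp a) r E') :
    IsComponentMinus ψ r (E' \ Set.range ψ.toFun) := by
  obtain ⟨hr, hrange, hfull⟩ := h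
  have hP := T.isForest.presents
  have hmem : ∀ e, (∃ x, ψ.toFun (a.toFun x) = e) ↔ T.broad.Desc e r ∧ e ∉ E' :=
    fun e => Set.ext_iff.1 hrange e
  obtain ⟨x, hx⟩ := (hmem r).2 ⟨Desc.refl r, fun h => (hE r h).2 hr⟩
  have hle : ∀ y, T.broad.Desc (ψ.toFun y) r := by
    intro y
    obtain ⟨ρ, hρ⟩ := V'.isTree.root
    have h1 := hP.mono ψ (hρ (a.toFun x))
    have h2 : ψ.toFun ρ = r := hr _ (hx ▸ h1)
    have := hP.mono ψ (hρ y)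
    rwa [h2] at this
  -- Only inner edges are missing, so the leaves of the smaller face are leaves of `T`.
  have hleaf : ∀ y, V.broad.IsLeaf y → T.broad.IsLeaf (ψ.toFun (a.toFun y)) := by
    intro y hy
    have h0 : Saturated (ψ.comp a) := fun l hl h0 => hl 0 ⟨(hfull 0 l).2 h0, by simp⟩
    obtain ⟨p, hp, hpy⟩ := hP.exists_of_saturated h0 hy
    obtain ⟨z, hz⟩ := (hmem p).2 ⟨Desc.trans hpy (hle _), fun h => (hE p h).1 hp⟩
    have := hP.minimal (ψ.comp a) V.isTree hy (x := z) (by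
      change T.broad.Desc (ψ.toFun (a.toFun z)) _
      rw [hz]
      exact hpy)
    have h' : ψ.toFun (a.toFun z) = ψ.toFun (a.toFun y) := this
    rw [← h', hz]
    exact hp
  refine ⟨hr, ?_, hP.full V'.isTree ψ hψ ?_⟩
  · ext e
    constructor
    · rintro ⟨y, rfl⟩
      exact ⟨hle y, fun h => h.2 ⟨y, rfl⟩⟩
    · rintro ⟨h1, h2⟩
      by_cases he : e ∈ E'
      · by_contra h3
        exact h2 ⟨he, h3⟩
      · obtain ⟨y, hy⟩ := (hmem e).2 ⟨h1, he⟩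
        exact ⟨_, hy⟩
  · intro l hl
    -- The root is expressed through leaves of the smaller face. A leaf of the larger face lies
    -- below the image of one of them, which is a leaf of `T`, and so has that same image.
    obtain ⟨s, hs, -, hs'⟩ := V.isTree.isForest.exists_rel_of_antichain (fun _ => False) x
      (fun x h => h.elim) (fun x _ h => h.elim)
    have hlx : V'.broad.Desc l (a.toFun x) := by
      refine hP.desc_leaf ψ V'.isTree hl (T.isForest.box.not_perp ?_)
      rw [hx]
      exact hle l
    obtain ⟨y, hy, hly⟩ := (V'.isTree.isForest.below_of_rel (a.map_rel s x hs)).cover l hl hlx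
    obtain ⟨y, hy', rfl⟩ := Multiset.mem_map.1 hy
    have hyl := hleaf y ((hs' y hy').resolve_left id).1
    exact ⟨_, hyl, by
      rw [IsForest.eq_of_desc_leaf hyl (hP.mono ψ hly)]
      exact Desc.refl _⟩

/-- By `isComponentMinus_of_comp` a face excluded from the horn is not contained in any face of the
horn, so membership can be read off from the face itself. -/
theorem mem_faceUnion_hornFace_iff {E : Set T.carrier} (hE : ∀ e ∈ E, T.IsInnerEdge e) {V : Omega}
    {v : Hom V.broad T.broad} (hv : Function.Injective v.toFun) :
    v ∈ (T.faceUnion (T.HornFace E)).obj (op V) ↔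
      ¬ ∃ r E', E' ⊆ E ∧ IsComponentMinus v r E' := by
  constructor
  · rintro ⟨V', ψ, a, hψ, hface, rfl⟩ ⟨r, E', hE', h⟩
    exact hface ⟨r, _, Set.sdiff_subset.trans hE',
      isComponentMinus_of_comp hψ a (fun e he => hE e (hE' he)) h⟩
  · exact fun h => ⟨V, v, 𝟙 V, hv, h, rfl⟩

theorem boundaryFace_eq : T.BoundaryFace = T.HornFace ∅ := by
  funext V ψ
  refine propext (not_congr ⟨?_, ?_⟩)
  · rintro ⟨r, h⟩
    exact ⟨r, ∅, subset_rfl, h⟩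
  · rintro ⟨r, E', hE', h⟩
    rw [Set.subset_empty_iff.1 hE'] at h
    exact ⟨r, h⟩

theorem isLeaf_smul (g : G) {e : T.carrier} (h : T.broad.IsLeaf e) : T.broad.IsLeaf (g • e) := by
  rintro s ⟨hs, hne⟩
  refine h (s.map (fun x => g⁻¹ • x)) ⟨?_, fun h => hne ?_⟩
  · simpa using T.smul_rel g⁻¹ s _ hs
  · have := congrArg (Multiset.map (fun x => g • x)) h
    simpa [Multiset.map_map] using this

theorem IsInnerEdge.smul (g : G) {e : T.carrier} (h : T.IsInnerEdge e) : T.IsInnerEdge (g • e) :=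
  ⟨fun h' => h.1 (by simpa using isLeaf_smul g⁻¹ h'),
    fun h' => h.2 (by simpa using isRoot_smul g⁻¹ h')⟩

theorem IsInnerEdge.orbit {ξ : T.carrier} (h : T.IsInnerEdge ξ) :
    ∀ e ∈ MulAction.orbit G ξ, T.IsInnerEdge e := by
  rintro _ ⟨g, rfl⟩
  exact h.smul g

end GTree

namespace PreBroadPoset

variable {D : Type w} {E : Type u} {F : Type v} {U : PreBroadPoset D}
    {P : PreBroadPoset E} {Q : PreBroadPoset F} {f : D → E} {g : D → F}

/-- If `Q` is chainlike, the image of a leaf of `U` is a face leaf, hence a leaf of `V`, whereas a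
nullary relation on it in `P` would lift to `V` by `hfull`. -/
theorem JointMap.exists_leaf_le (h : JointMap U P Q f g) (hU : U.IsTree) (hP : P.IsForest)
    (hPQ : P.LeafCovered ∨ Q.IsChainlike) {V : Omega} {v : Hom V.broad P}
    (hv : IsMinimalFace U P f v) (hfull : ∀ e, P.rel 0 (v.toFun e) → V.broad.rel 0 e) {l : D}
    (hl : U.IsLeaf l) : ∃ p, P.IsLeaf p ∧ P.Desc p (f l) := by
  rcases hPQ with h' | h'
  · exact h' (f l)
  by_contra hcon
  push Not at hcon
  have h0 : P.rel 0 (f l) := hP.presents.rel_zero_iff.2 hcon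
  obtain ⟨a, ha⟩ : f l ∈ Set.range v.toFun := hv.range ▸ ⟨l, rfl⟩
  have hleaf : FaceLeaf U P f (f l) := by
    refine ⟨⟨l, rfl⟩, fun u hu => ?_, Or.inl ⟨l, hl, rfl⟩⟩
    rcases h.comp (Or.inl hu) (h.swap.chain hU h' u l) with h1 | h1
    · rw [IsForest.eq_of_desc_leaf hl h1]
    · exact hP.desc_antisymm hu (h.mono₁ h1)
  rw [← ha] at h0 hleaf
  exact (hv.leaf a).2 hleaf 0 ⟨hfull a h0, by simp⟩

theorem IsMinimalFace.full {D : Type w} {U : PreBroadPoset D} {f : D → E} (hP : P.IsForest)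
    {V : Omega} {v : Hom V.broad P}
    (hv : IsMinimalFace U P f v) (h : ∀ l, U.IsLeaf l → ∃ p, P.IsLeaf p ∧ P.Desc p (f l)) :
    ∀ s e, V.broad.rel s e ↔ P.rel (s.map v.toFun) (v.toFun e) := by
  refine hP.presents.full V.isTree v hv.inj (fun a ha => ?_)
  rcases ((hv.leaf a).1 ha).leaf with ⟨l, hl, h'⟩ | h'
  · rw [← h']
    exact h l hl
  · exact h'

end PreBroadPoset

namespace GTree

variable {G : Type u} [Group G] (S T : GTree G) (ξ : T.carrier)

/-- The box poset of the tensor product. -/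
abbrev tensorBox : Box (S.carrier × T.carrier) := S.isForest.box.prod T.isForest.box

/-- The subtrees of `S ⊗ T` that are spanned by the cells outside of the pushout product. -/
def fullSubtrees : Set (Set (S.carrier × T.carrier)) :=
  {X | (S.tensorBox T).IsSubtree X ∧ ∃ r r', S.broad.IsRoot r ∧ T.broad.IsRoot r' ∧
    (∀ s, (∃ t, (s, t) ∈ X) ↔ S.broad.Desc s r) ∧
    (∀ t, T.broad.Desc t r' → t ∉ MulAction.orbit G ξ → ∃ s, (s, t) ∈ X) ∧
    ∀ s t, (s, t) ∈ X → T.broad.Desc t r'}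

variable {S T ξ}

/-- Minimality turns the left side into a condition on the minimal faces `v` and `w` alone. Their
images are the two projections of the image of `φ`, and their fullness corresponds to saturation of
`φ`. -/
theorem inPushoutProduct_iff (hST : Amenable S.broad T.broad) (hξ : T.IsInnerEdge ξ) (U : Omega)
    (φ : Hom U.broad (tensor S.broad T.broad)) :
    S.InPushoutProduct T ξ U φ ↔ ¬ Spans (S.fullSubtrees T ξ) U φ := by
  obtain ⟨V, W, v, w, h, hv, hw, hφ, hmin⟩ := exists_minimal_faces S.isForest T.isForest hST U φ
  have hU := U.isTree
  have J := JointMap.of_hom hU S.isForest T.isForest φ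
  have hS := S.isForest.presents
  have hT := T.isForest.presents
  have hB := Box.presents_tensor S.isForest T.isForest
  have h1 : S.InPushoutProduct T ξ U φ ↔ v ∈ (S.faceUnion S.BoundaryFace).obj (op V) ∨
      w ∈ (T.faceUnion (T.HornFace (MulAction.orbit G ξ))).obj (op W) := by
    constructor
    · rintro ⟨V', W', v', w', h', hφ', hvw⟩
      rcases hvw with ⟨V'', ψ, a, hψ, hface, rfl⟩ | ⟨W'', ψ, a, hψ, hface, rfl⟩
      · obtain ⟨W'', ψ', a', hψ', rfl, -⟩ := hT.exists_image W' w'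
        obtain ⟨⟨b, hb⟩, -⟩ := hmin V'' W'' ψ ψ' ((tensorMap a a').comp h') hψ hψ' hφ'
        exact Or.inl ⟨V'', ψ, b, hψ, hface, hb⟩
      · obtain ⟨V'', ψ', a', hψ', rfl, -⟩ := hS.exists_image V' v'
        obtain ⟨-, b, hb⟩ := hmin V'' W'' ψ' ψ ((tensorMap a' a).comp h') hψ' hψ hφ'
        exact Or.inr ⟨W'', ψ, b, hψ, hface, hb⟩
    · exact fun h' => ⟨V, W, v, w, h, hφ, h'⟩
  have hbd : v ∈ (S.faceUnion S.BoundaryFace).obj (op V) ↔ ¬ ∃ r, IsComponentMinus v r ∅ := by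
    rw [boundaryFace_eq, mem_faceUnion_hornFace_iff (by simp) hv.inj]
    refine not_congr ⟨?_, fun ⟨r, h⟩ => ⟨r, ∅, subset_rfl, h⟩⟩
    rintro ⟨r, E', hE', h⟩
    rw [Set.subset_empty_iff.1 hE'] at h
    exact ⟨r, h⟩
  rw [h1, hbd, mem_faceUnion_hornFace_iff hξ.orbit hw.inj, ← not_and_or, not_iff_not]
  have hrv : ∀ s, (∃ t, (s, t) ∈ Set.range φ.toFun) ↔ s ∈ Set.range v.toFun := by
    intro s
    rw [hv.range]
    constructor
    · rintro ⟨t, u, hu⟩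
      exact ⟨u, congrArg Prod.fst hu⟩
    · rintro ⟨u, rfl⟩
      exact ⟨_, u, rfl⟩
  have hrw : ∀ t, (∃ s, (s, t) ∈ Set.range φ.toFun) ↔ t ∈ Set.range w.toFun := by
    intro t
    rw [hw.range]
    constructor
    · rintro ⟨t, u, hu⟩
      exact ⟨u, congrArg Prod.snd hu⟩
    · rintro ⟨u, rfl⟩
      exact ⟨_, u, rfl⟩
  constructor
  · rintro ⟨⟨r, hr, hrr, hf⟩, r', E', hE', hr', hrr', hf'⟩
    refine ⟨⟨hB.isSubtree_range hU φ _ (fun p x hp hpx => ?_), r, r', hr, hr', ?_, ?_, ?_⟩, ?_⟩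
    · obtain ⟨l, hl, -, h⟩ := hB.cover φ hU.isForest hp hpx
      exact ⟨l, hl, h⟩
    · intro s
      rw [hrv, hrr]
      simp
    · intro t ht htξ
      rw [hrw, hrr']
      exact ⟨ht, fun h => htξ (hE' h)⟩
    · intro s t hst
      have := (hrw t).1 ⟨s, hst⟩
      rw [hrr'] at this
      exact this.1
    -- Fullness of the two faces puts a leaf of `S` and a leaf of `T` below the image of `l`, and
    -- this pair obstructs a nullary relation.
    · intro l hl h0
      obtain ⟨p, hp, hpl⟩ := J.exists_leaf_le hU S.isForest hST.symm.left hv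
        (fun e he => (hf 0 e).2 he) hl
      obtain ⟨m, hm, hml⟩ := J.swap.exists_leaf_le hU T.isForest hST.left hw
        (fun e he => (hf' 0 e).2 he) hl
      exact hB.rel_zero_iff.1 h0 (p, m) ⟨hp, hm⟩ ⟨hpl, hml⟩
  · rintro ⟨⟨-, r, r', hr, hr', h1, h2, h3⟩, hsat⟩
    have hleaf := fun l hl => hB.exists_of_saturated hsat (l := l) hl
    refine ⟨⟨r, hr, ?_, hv.full S.isForest fun l hl => ?_⟩, r', {t | T.broad.Desc t r' ∧
      t ∉ Set.range w.toFun}, ?_, hr', ?_, hw.full T.isForest fun l hl => ?_⟩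
    · ext s
      rw [← hrv, h1]
      simp
    · obtain ⟨p, hp, hpl⟩ := hleaf l hl
      exact ⟨p.1, hp.1, hpl.1⟩
    · rintro t ⟨ht, htw⟩
      by_contra hcon
      exact htw ((hrw t).1 (h2 t ht hcon))
    · ext t
      constructor
      · intro ht
        obtain ⟨s, hs⟩ := (hrw t).2 ht
        exact ⟨h3 s t hs, fun h => h.2 ht⟩
      · rintro ⟨h1, h2⟩
        by_contra hcon
        exact h2 ⟨h1, hcon⟩
    · obtain ⟨p, hp, hpl⟩ := hleaf l hl
      exact ⟨p.2, hp.2, hpl.2⟩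

theorem isLeaf_smul_iff (g : G) {e : T.carrier} : T.broad.IsLeaf (g • e) ↔ T.broad.IsLeaf e :=
  ⟨fun h => by simpa using isLeaf_smul g⁻¹ h, isLeaf_smul g⟩

theorem tensorBox_le_smul (g : G) {a b : S.carrier × T.carrier} :
    (S.tensorBox T).le (g • a) (g • b) ↔ (S.tensorBox T).le a b :=
  and_congr (desc_smul_iff g _ _) (desc_smul_iff g _ _)

theorem tensorBox_perp_smul (g : G) {a b : S.carrier × T.carrier} :
    (S.tensorBox T).perp (g • a) (g • b) ↔ (S.tensorBox T).perp a b :=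
  or_congr (and_congr (not_congr (desc_smul_iff g _ _)) (not_congr (desc_smul_iff g _ _)))
    (and_congr (not_congr (desc_smul_iff g _ _)) (not_congr (desc_smul_iff g _ _)))

theorem tensorBox_leaf_smul (g : G) {a : S.carrier × T.carrier} :
    (S.tensorBox T).leaf (g • a) ↔ (S.tensorBox T).leaf a :=
  and_congr (isLeaf_smul_iff g) (isLeaf_smul_iff g)

theorem smul_mem_fullSubtrees (g : G) {X : Set (S.carrier × T.carrier)}
    (hX : X ∈ S.fullSubtrees T ξ) : g • X ∈ S.fullSubtrees T ξ := by
  obtain ⟨⟨⟨x, hx, htop⟩, hcomp, hcover⟩, r, r', hr, hr', h1, h2, h3⟩ := hX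
  have hmem : ∀ s t, (s, t) ∈ g • X ↔ (g⁻¹ • s, g⁻¹ • t) ∈ X := fun s t =>
    Set.mem_smul_set_iff_inv_smul_mem
  have hd : ∀ (R : GTree G) (a b : R.carrier), R.broad.Desc a (g • b) ↔ R.broad.Desc (g⁻¹ • a) b := by
    intro R a b
    rw [← desc_smul_iff g (g⁻¹ • a) b, smul_inv_smul]
  refine ⟨⟨⟨g • x, Set.smul_mem_smul_set hx, ?_⟩, ?_, ?_⟩, g • r, g • r', isRoot_smul g hr,
    isRoot_smul g hr', ?_, ?_, ?_⟩
  · rintro _ ⟨y, hy, rfl⟩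
    exact (tensorBox_le_smul g).2 (htop y hy)
  · rintro _ ⟨y, hy, rfl⟩ _ ⟨z, hz, rfl⟩
    simp only [tensorBox_le_smul, tensorBox_perp_smul]
    exact hcomp y hy z hz
  · rintro _ ⟨y, hy, rfl⟩ p hp hpy
    rw [← smul_inv_smul g p, tensorBox_leaf_smul] at hp
    rw [← smul_inv_smul g p] at hpy
    obtain ⟨d, hd, hpd, hmin⟩ := hcover y hy _ hp ((tensorBox_le_smul g).1 hpy)
    refine ⟨g • d, Set.smul_mem_smul_set hd, ?_, ?_⟩
    · rw [← smul_inv_smul g p]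
      exact (tensorBox_le_smul g).2 hpd
    · rintro _ ⟨c, hc, rfl⟩ hcd
      exact congrArg (fun z => g • z) (hmin c hc ((tensorBox_le_smul g).1 hcd))
  · intro s
    rw [hd, ← h1]
    simp only [hmem]
    exact ⟨fun ⟨t, ht⟩ => ⟨_, ht⟩, fun ⟨t, ht⟩ => ⟨g • t, by rwa [inv_smul_smul]⟩⟩
  · intro t ht htξ
    obtain ⟨s, hs⟩ := h2 (g⁻¹ • t) ((hd T t r').1 ht) (fun h => htξ (by
      simpa using MulAction.mem_orbit_of_mem_orbit g h))
    exact ⟨g • s, (hmem _ _).2 (by rwa [inv_smul_smul])⟩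
  · intro s t hst
    rw [hd]
    exact h3 _ _ ((hmem _ _).1 hst)

/-- The pushout product is closed under precomposition, so its complement is closed under extension,
which is `reflect`. -/
theorem cellBase (hST : Amenable S.broad T.broad) (hξ : T.IsInnerEdge ξ) :
    CellBase (S.tensor_isEquivariant T) (S.tensorBox T) (S.fullSubtrees T ξ) where
  presents := Box.presents_tensor S.isForest T.isForest
  subtree _ hX := hX.1
  reflect U V a φ h := by
    by_contra h'
    rw [← inPushoutProduct_iff hST hξ] at h'
    exact (inPushoutProduct_iff hST hξ U _).1 ((S.isGSieve_inPushoutProduct T ξ).comp U V a φ h') h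

end GTree

end


/-! ### Pairings on the subtrees of a tensor product -/

section

open scoped Pointwise

/-- A criterion for pairings, where `c V` only depends on `V ∩ R`. -/
theorem isPairing_of {G : Type u} [Group G] {E : Type u} [MulAction G E] [Finite E] {B : Box E}
    {𝒞 : Set (Set E)} {c : Set E → Set E} (R : Set E) (hR : ∀ V, ∀ x ∈ c V, x ∉ R)
    (hdep : ∀ V V', V ∩ R = V' ∩ R → c V = c V') (hRs : ∀ (g : G), g • R = R)
    (mem : ∀ V ∈ 𝒞, ∀ E' ⊆ c V, (V ∪ c V) \ E' ∈ 𝒞)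
    (smul : ∀ g : G, ∀ V ∈ 𝒞, c (g • V) = g • c V)
    (nonempty : ∀ V ∈ 𝒞, (c V).Nonempty)
    (above : ∀ V ∈ 𝒞, ∀ x ∈ c V, ∃ y ∈ V, B.le x y ∧ y ≠ x)
    (below : ∀ V ∈ 𝒞, ∀ x ∈ c V, ∀ p, B.leaf p → B.le p x → ∃ y ∈ V, B.le y x ∧ y ≠ x) :
    ∃ k, IsPairing G B 𝒞 c k := by
  have hhat : ∀ V, ∀ E' ⊆ c V, (V ∪ c V) \ E' ∩ R = V ∩ R := by
    intro V E' hE'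
    ext x
    constructor
    · rintro ⟨⟨hx | hx, -⟩, hxR⟩
      · exact ⟨hx, hxR⟩
      · exact absurd hxR (hR V x hx)
    · rintro ⟨hx, hxR⟩
      exact ⟨⟨Or.inl hx, fun h => hR V x (hE' h) hxR⟩, hxR⟩
  -- Lexicographic order on the number of elements in `R` and the total number, the latter being
  -- less than the factor `|E| + 1`.
  refine ⟨fun V => (V ∩ R).ncard * ((Set.univ : Set E).ncard + 1) + V.ncard, mem,
    fun V _ E' hE' => hdep _ _ (hhat V E' hE'), smul, nonempty, above, below, ?_, ?_⟩
  · intro g V _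
    have : g • V ∩ R = g • (V ∩ R) := by rw [Set.smul_set_inter, hRs]
    rw [this, Set.ncard_smul_set, Set.ncard_smul_set]
  · intro U _ V _ hVU
    have h1 : ∀ V, (V ∪ c V) ∩ R = V ∩ R := by
      intro V
      simpa using hhat V ∅ (Set.empty_subset _)
    rw [h1, h1]
    have h2 : V ∩ R ⊆ U ∩ R := Set.inter_subset_inter_left R hVU
    rcases h2.eq_or_ssubset with h | h
    · rw [h, hdep V U h]
      rcases (Set.union_subset_union_left (c U) hVU).eq_or_ssubset with h' | h'
      · exact Or.inl h'
      · exact Or.inr (Nat.add_lt_add_left (Set.ncard_lt_ncard h' (Set.toFinite _)) _)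
    · right
      have h3 := Set.ncard_lt_ncard h (Set.toFinite _)
      have h4 : (V ∪ c V).ncard ≤ (Set.univ : Set E).ncard :=
        Set.ncard_le_ncard (Set.subset_univ _) (Set.toFinite _)
      have h5 := Nat.mul_le_mul_right ((Set.univ : Set E).ncard + 1) (Nat.succ_le_of_lt h3)
      rw [Nat.succ_mul] at h5
      omega

namespace GTree

variable {G : Type u} [Group G] {S T : GTree G} {ξ : T.carrier}

/-- Translation carries the edges below `t` bijectively to those below `g • t`, and an inclusion
between finite sets of the same size is an equality. -/
theorem eq_of_desc_smul {g : G} {t : T.carrier} (h : T.broad.Desc (g • t) t) : g • t = t := by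
  have := T.isForest.finite
  have h1 : {x | T.broad.Desc x (g • t)} = g • {x | T.broad.Desc x t} := by
    ext x
    rw [Set.mem_smul_set_iff_inv_smul_mem]
    change T.broad.Desc x (g • t) ↔ T.broad.Desc (g⁻¹ • x) t
    rw [← desc_smul_iff g (g⁻¹ • x) t, smul_inv_smul]
  have h2 : {x | T.broad.Desc x (g • t)} = {x | T.broad.Desc x t} := by
    refine Set.eq_of_subset_of_ncard_le (fun x hx => Desc.trans hx h) ?_ (Set.toFinite _)
    rw [h1, Set.ncard_smul_set]
  have h3 : T.broad.Desc t (g • t) := by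
    have : t ∈ {x | T.broad.Desc x t} := Desc.refl t
    rwa [← h2] at this
  exact T.isForest.desc_antisymm h h3

theorem eq_of_desc_of_mem_orbit {x y : T.carrier} (hx : x ∈ MulAction.orbit G ξ)
    (hy : y ∈ MulAction.orbit G ξ) (h : T.broad.Desc x y) : x = y := by
  rw [← MulAction.orbit_eq_iff.2 hy] at hx
  obtain ⟨g, rfl⟩ := hx
  exact eq_of_desc_smul h

theorem desc_root {x y r : T.carrier} (hr : T.broad.IsRoot r) (hyr : T.broad.Desc y r)
    (hyx : T.broad.Desc y x) : T.broad.Desc x r := by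
  rcases T.isForest.desc_total hyr hyx with h | h
  · rw [hr x h]
    exact Desc.refl r
  · exact h

/-- The edges over the orbit of `ξ` to be toggled in a subtree of `S ⊗ T`. -/
def toggles (ξ : T.carrier) (ρ : T.carrier → T.carrier → Prop)
    (l : S.carrier → S.carrier → Prop) (V : Set (S.carrier × T.carrier)) :
    Set (S.carrier × T.carrier) :=
  {x | x.2 ∈ MulAction.orbit G ξ ∧ (∃ z, ρ z x.2 ∧ (x.1, z) ∈ V) ∧
    ∀ a b, ρ b x.2 → (a, b) ∈ V → l x.1 a → a = x.1}

/-- A root is not in the orbit of the inner edge `ξ`, so `r'` occurs in the projection of `V` and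
the top of `V` is the pair of roots. -/
theorem exists_top (hξ : T.IsInnerEdge ξ) {V : Set (S.carrier × T.carrier)}
    (hV : V ∈ S.fullSubtrees T ξ) : ∃ r r', S.broad.IsRoot r ∧ T.broad.IsRoot r' ∧ (r, r') ∈ V ∧
      (∀ s, (∃ t, (s, t) ∈ V) ↔ S.broad.Desc s r) ∧
      (∀ t, T.broad.Desc t r' → t ∉ MulAction.orbit G ξ → ∃ s, (s, t) ∈ V) ∧
      ∀ s t, (s, t) ∈ V → T.broad.Desc t r' := by
  obtain ⟨⟨⟨⟨r₁, r₂⟩, hx, htop⟩, -, -⟩, r, r', hr, hr', h1, h2, h3⟩ := hV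
  have e1 : r₁ = r := by
    obtain ⟨t, ht⟩ := (h1 r).2 (Desc.refl r)
    exact hr _ (htop _ ht).1
  have e2 : r₂ = r' := by
    obtain ⟨s, hs⟩ := h2 r' (Desc.refl r') (fun h => (hξ.orbit r' h).2 hr')
    exact hr' _ (htop _ hs).2
  subst e1
  subst e2
  exact ⟨r₁, r₂, hr, hr', hx, h1, h2, h3⟩

/-- The common part of the two pairings: `ρ` says on which side of the orbit the supporting edges
lie, and `l` in which direction the first coordinate is extremal. Comparability, covering and the
presence of something below a toggled edge depend on the side and remain hypotheses. -/
theorem exists_isPairing_toggles (hξ : T.IsInnerEdge ξ) (ρ : T.carrier → T.carrier → Prop)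
    (l : S.carrier → S.carrier → Prop)
    (hρs : ∀ (g : G) a b, ρ a b → ρ (g • a) (g • b))
    (hρ : ∀ x ∈ MulAction.orbit G ξ, ∀ z, ρ z x → z ∉ MulAction.orbit G ξ)
    (hρd : ∀ x z, ρ z x → T.broad.Desc z x ∨ T.broad.Desc x z)
    (hls : ∀ (g : G) a b, l a b → l (g • a) (g • b))
    (hl : ∀ a b, S.broad.Desc a b → l a b ∨ l b a)
    (hne : ∀ V ∈ S.fullSubtrees T ξ, (toggles ξ ρ l V).Nonempty)
    (hcomp : ∀ V ∈ S.fullSubtrees T ξ, ∀ x ∈ toggles ξ ρ l V, ∀ a ∈ V,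
      (S.tensorBox T).le x a ∨ (S.tensorBox T).le a x ∨ (S.tensorBox T).perp x a)
    (hcov : ∀ V ∈ S.fullSubtrees T ξ, ∀ x ∈ toggles ξ ρ l V, ∀ d ∈ V,
      (∀ c ∈ V, (S.tensorBox T).le c d → c = d) → ∀ p, (S.tensorBox T).leaf p →
      (S.tensorBox T).le p d → ¬ (S.tensorBox T).le x d)
    (hbelow : ∀ V ∈ S.fullSubtrees T ξ, ∀ x ∈ toggles ξ ρ l V, ∀ p, (S.tensorBox T).leaf p →
      (S.tensorBox T).le p x → ∃ y ∈ V, (S.tensorBox T).le y x ∧ y ≠ x) :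
    ∃ k, IsPairing G (S.tensorBox T) (S.fullSubtrees T ξ) (toggles ξ ρ l) k := by
  have := S.isForest.finite
  have := T.isForest.finite
  let B := S.tensorBox T
  have htop : ∀ V ∈ S.fullSubtrees T ξ, ∀ x ∈ toggles ξ ρ l V, ∀ r r', S.broad.IsRoot r →
      T.broad.IsRoot r' → (∀ s, (∃ t, (s, t) ∈ V) ↔ S.broad.Desc s r) →
      (∀ s t, (s, t) ∈ V → T.broad.Desc t r') → S.broad.Desc x.1 r ∧ T.broad.Desc x.2 r' := by
    rintro V hV x ⟨-, ⟨z, hz, hxz⟩, -⟩ r r' hr hr' h1 h3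
    refine ⟨(h1 _).1 ⟨z, hxz⟩, ?_⟩
    rcases hρd _ _ hz with h | h
    · exact desc_root hr' (h3 _ _ hxz) h
    · exact h.trans (h3 _ _ hxz)
  -- `R` is the part over the edges that can support a toggled edge. It contains nothing over the
  -- orbit, so toggling leaves it unchanged.
  refine isPairing_of {x | ∃ y ∈ MulAction.orbit G ξ, ρ x.2 y} ?_ ?_ ?_ ?_ ?_ hne ?_ hbelow
  · rintro V x ⟨hx, -, -⟩ ⟨y, hy, h⟩
    exact hρ y hy _ h hx
  · intro V V' h
    have key : ∀ (V V' : Set (S.carrier × T.carrier)),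
        V ∩ {x | ∃ y ∈ MulAction.orbit G ξ, ρ x.2 y} = V' ∩ {x | ∃ y ∈ MulAction.orbit G ξ, ρ x.2 y} →
        ∀ a b x, x ∈ MulAction.orbit G ξ → ρ b x → (a, b) ∈ V → (a, b) ∈ V' := by
      intro V V' h a b x hx hb hab
      have : (a, b) ∈ V ∩ {x | ∃ y ∈ MulAction.orbit G ξ, ρ x.2 y} := ⟨hab, x, hx, hb⟩
      rw [h] at this
      exact this.1
    ext x
    constructor
    · rintro ⟨hx, ⟨z, hz, hxz⟩, hmax⟩
      exact ⟨hx, ⟨z, hz, key V V' h _ _ _ hx hz hxz⟩,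
        fun a b hb hab => hmax a b hb (key V' V h.symm _ _ _ hx hb hab)⟩
    · rintro ⟨hx, ⟨z, hz, hxz⟩, hmax⟩
      exact ⟨hx, ⟨z, hz, key V' V h.symm _ _ _ hx hz hxz⟩,
        fun a b hb hab => hmax a b hb (key V V' h _ _ _ hx hb hab)⟩
  · have key : ∀ (g : G) (x : S.carrier × T.carrier),
        (∃ y ∈ MulAction.orbit G ξ, ρ x.2 y) → ∃ y ∈ MulAction.orbit G ξ, ρ (g • x).2 y := by
      rintro g x ⟨y, hy, h⟩
      exact ⟨g • y, MulAction.mem_orbit_of_mem_orbit g hy, hρs g _ _ h⟩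
    intro g
    ext x
    rw [Set.mem_smul_set_iff_inv_smul_mem]
    exact ⟨fun h => by simpa using key g _ h, fun h => key g⁻¹ x h⟩
  · intro V hV E' hE'
    have hV' := hV
    obtain ⟨r, r', hr, hr', hrr, h1, h2, h3⟩ := exists_top hξ hV
    obtain ⟨⟨-, hVcomp, hVcover⟩, -⟩ := hV'
    have hT := fun x hx => htop V hV x hx r r' hr hr' h1 h3
    have hnot : ∀ a, ∀ b ∉ MulAction.orbit G ξ, (a, b) ∉ E' := fun a b hb h => hb (hE' h).1
    have hrX : (r, r') ∈ (V ∪ toggles ξ ρ l V) \ E' :=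
      ⟨Or.inl hrr, hnot _ _ (fun h => (hξ.orbit r' h).2 hr')⟩
    have hle : ∀ x ∈ V ∪ toggles ξ ρ l V, B.le x (r, r') := by
      rintro ⟨s, t⟩ (hx | hx)
      · exact ⟨(h1 s).1 ⟨t, hx⟩, h3 s t hx⟩
      · exact hT _ hx
    refine ⟨⟨⟨(r, r'), hrX, fun x hx => hle x hx.1⟩, ?_, ?_⟩, r, r', hr, hr', ?_, ?_, ?_⟩
    · rintro a ⟨ha | ha, -⟩ b ⟨hb | hb, -⟩
      · exact hVcomp a ha b hb
      · rcases hcomp V hV b hb a ha with h | h | h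
        · exact Or.inr (Or.inl h)
        · exact Or.inl h
        · exact Or.inr (Or.inr (B.perp_symm h))
      · exact hcomp V hV a ha b hb
      -- Over the same edge, first coordinates of toggled edges are extremal and so equal or
      -- incomparable. Over different edges they are disjoint, since the orbit is an antichain.
      · by_cases hab : a.2 = b.2
        · obtain ⟨a, x⟩ := a
          obtain ⟨b, y⟩ := b
          obtain rfl : x = y := hab
          obtain ⟨hx, ⟨z, hz, haz⟩, ha⟩ := ha
          obtain ⟨-, ⟨z', hz', hbz⟩, hb⟩ := hb
          have key : S.broad.Desc a b ∨ S.broad.Desc b a → a = b := by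
            intro h
            have h' : l a b ∨ l b a := h.elim (hl a b) (fun h => (hl b a h).symm)
            rcases h' with h' | h'
            · exact (ha b z' hz' hbz h').symm
            · exact hb a z hz haz h'
          by_cases h : S.broad.Desc a b ∨ S.broad.Desc b a
          · rw [key h]
            exact Or.inl (B.refl _)
          · push Not at h
            exact Or.inr (Or.inr (Or.inl h))
        · refine Or.inr (Or.inr (Or.inr ⟨fun h => ?_, fun h => ?_⟩))
          · exact hab (eq_of_desc_of_mem_orbit ha.1 hb.1 h)
          · exact hab (eq_of_desc_of_mem_orbit hb.1 ha.1 h).symm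
    · intro d hd p hp hpd
      -- By `hcov` the minimal element of `V` above `p` is not toggled and has no toggled edge below
      -- it, so it still covers `p`.
      obtain ⟨d', hd', hpd', hmin⟩ := hVcover _ hrr p hp (B.trans hpd (hle d hd.1))
      have hno := fun x hx => hcov V hV x hx d' hd' hmin p hp hpd'
      refine ⟨d', ⟨Or.inl hd', fun h => hno d' (hE' h) (B.refl _)⟩, hpd', ?_⟩
      rintro c ⟨hc | hc, -⟩ hcd
      · exact hmin c hc hcd
      · exact absurd hcd (hno c hc)
    · intro s
      constructor
      · rintro ⟨t, h⟩
        exact (hle _ h.1).1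
      · intro hs
        obtain ⟨t, ht⟩ := (h1 s).2 hs
        -- A removed `(s, t)` is replaced by its supporting element `(s, z)`, which does not lie
        -- over the orbit.
        by_cases h : (s, t) ∈ E'
        · obtain ⟨hx, ⟨z, hz, hsz⟩, -⟩ := hE' h
          exact ⟨z, Or.inl hsz, hnot _ _ (hρ t hx z hz)⟩
        · exact ⟨t, Or.inl ht, h⟩
    · intro t ht htξ
      obtain ⟨s, hs⟩ := h2 t ht htξ
      exact ⟨s, Or.inl hs, hnot _ _ htξ⟩
    · exact fun s t h => (hle _ h.1).2
  · have key : ∀ (g : G) (V : Set (S.carrier × T.carrier)) (x : S.carrier × T.carrier),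
        x ∈ toggles ξ ρ l V → g • x ∈ toggles ξ ρ l (g • V) := by
      rintro g V ⟨s, x⟩ ⟨hx, ⟨z, hz, hsz⟩, hmax⟩
      refine ⟨MulAction.mem_orbit_of_mem_orbit g hx, ⟨g • z, hρs g _ _ hz, ?_⟩, ?_⟩
      · exact Set.smul_mem_smul_set (a := g) hsz
      · intro a b hb hab hla
        have h1 := hρs g⁻¹ _ _ hb
        have h2 := hls g⁻¹ _ _ hla
        change ρ (g⁻¹ • b) (g⁻¹ • g • x) at h1
        change l (g⁻¹ • g • s) (g⁻¹ • a) at h2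
        rw [inv_smul_smul] at h1 h2
        have h3 : (g⁻¹ • a, g⁻¹ • b) ∈ V := Set.mem_smul_set_iff_inv_smul_mem.1 hab
        have h4 : g⁻¹ • a = s := hmax _ _ h1 h3 h2
        exact inv_smul_eq_iff.1 h4
    intro g V _
    ext x
    rw [Set.mem_smul_set_iff_inv_smul_mem]
    exact ⟨fun h => by simpa using key g⁻¹ _ x h, fun h => by simpa using key g V _ h⟩
  · intro V hV x hx
    obtain ⟨r, r', hr, hr', hrr, h1, -, h3⟩ := exists_top hξ hV
    refine ⟨_, hrr, htop V hV x hx r r' hr hr' h1 h3, ?_⟩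
    rintro rfl
    exact (hξ.orbit r' hx.1).2 hr'

/-- The roots form a single orbit, so `ξ` can be translated below any of them. -/
theorem exists_desc_root {r' : T.carrier} (hr' : T.broad.IsRoot r') (ξ : T.carrier) :
    ∃ x ∈ MulAction.orbit G ξ, T.broad.Desc x r' := by
  obtain ⟨ρ, ⟨hρ, hξρ⟩, -⟩ := T.isForest.root ξ
  obtain ⟨r, hr⟩ := T.root_orbit
  have h1 : ρ ∈ MulAction.orbit G r := hr ▸ hρ
  have h2 : r' ∈ MulAction.orbit G r := hr ▸ hr'
  rw [← MulAction.orbit_eq_iff.2 h1] at h2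
  obtain ⟨g, rfl⟩ := h2
  exact ⟨g • ξ, ⟨g, rfl⟩, (desc_smul_iff g _ _).2 hξρ⟩

/-- The pairing in which edges are added above edges below the orbit of `ξ`. -/
theorem exists_isPairing_below (hξ : T.IsInnerEdge ξ) {y : T.carrier} (hy : T.broad.Desc y ξ)
    (hyξ : y ≠ ξ) : ∃ c k, IsPairing G (S.tensorBox T) (S.fullSubtrees T ξ) c k := by
  have := S.isForest.finite
  let ρ : T.carrier → T.carrier → Prop := fun z x => T.broad.Desc z x ∧ z ≠ x
  have hρ : ∀ x ∈ MulAction.orbit G ξ, ∀ z, ρ z x → z ∉ MulAction.orbit G ξ :=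
    fun x hx z hz hzo => hz.2 (eq_of_desc_of_mem_orbit hzo hx hz.1)
  refine ⟨_, exists_isPairing_toggles hξ ρ S.broad.Desc
    (fun g a b h => ⟨(desc_smul_iff g a b).2 h.1, fun h' => h.2 (smul_left_cancel g h')⟩) hρ
    (fun x z hz => Or.inl hz.1) (fun g a b => (desc_smul_iff g a b).2) (fun a b h => Or.inl h)
    ?_ ?_ ?_ ?_⟩
  · intro V hV
    obtain ⟨r, r', hr, hr', hrr, h1, h2, h3⟩ := exists_top hξ hV
    obtain ⟨x, ⟨g, rfl⟩, hx⟩ := exists_desc_root hr' ξ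
    have hgy : ρ (g • y) (g • ξ) :=
      ⟨(desc_smul_iff g _ _).2 hy, fun h => hyξ (smul_left_cancel g h)⟩
    -- The translate of `y` is outside of the orbit, so it occurs in `V`; a maximal first coordinate
    -- over edges strictly below `g • ξ` then gives a toggled edge.
    obtain ⟨s, hs⟩ := h2 (g • y) (hgy.1.trans hx) (hρ _ ⟨g, rfl⟩ _ hgy)
    obtain ⟨a, -, ⟨b, hb, hab⟩, hmax⟩ := S.isForest.box.exists_maximal
      (fun a => ∃ b, ρ b (g • ξ) ∧ (a, b) ∈ V) ⟨_, hgy, hs⟩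
    exact ⟨(a, g • ξ), ⟨g, rfl⟩, ⟨b, hb, hab⟩, fun a' b' hb' hab' hl => hmax a' ⟨b', hb', hab'⟩ hl⟩
  · rintro V hV ⟨s, x⟩ ⟨hx, ⟨z, hz, hsz⟩, hmax⟩ ⟨a, b⟩ hab
    -- Over an edge strictly below `x`, maximality of `s` excludes a first coordinate strictly above
    -- `s`.
    have hlow : T.broad.Desc b x → b ≠ x → S.broad.Desc s a ∨ S.broad.Desc a s →
        (S.tensorBox T).le (a, b) (s, x) := by
      intro hbx hne h
      rcases h with h | h
      · obtain rfl : a = s := hmax a b ⟨hbx, hne⟩ hab h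
        exact ⟨Desc.refl _, hbx⟩
      · exact ⟨h, hbx⟩
    rcases hV.1.comp _ hsz _ hab with ⟨h1, h2⟩ | ⟨h1, h2⟩ | h | h
    · rcases T.isForest.desc_total hz.1 h2 with h | h
      · exact Or.inl ⟨h1, h⟩
      · by_cases hbx : b = x
        · exact Or.inl ⟨h1, hbx ▸ Desc.refl b⟩
        · exact Or.inr (Or.inl (hlow h hbx (Or.inl h1)))
    · exact Or.inr (Or.inl ⟨h1, h2.trans hz.1⟩)
    · exact Or.inr (Or.inr (Or.inl h))
    · by_cases hsa : S.broad.Desc s a ∨ S.broad.Desc a s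
      · by_cases hxb : T.broad.Desc x b
        · exact absurd (hz.1.trans hxb) h.1
        · by_cases hbx : T.broad.Desc b x
          · exact Or.inr (Or.inl (hlow hbx (fun h => hxb (h ▸ Desc.refl _)) hsa))
          · exact Or.inr (Or.inr (Or.inr ⟨hxb, hbx⟩))
      · push Not at hsa
        exact Or.inr (Or.inr (Or.inl hsa))
  -- The supporting `(s, z)` lies strictly below `(s, x)`, so nothing above `(s, x)` is minimal in
  -- `V`.
  · rintro V hV ⟨s, x⟩ ⟨hx, ⟨z, hz, hsz⟩, hmax⟩ ⟨a, b⟩ hab hmin p - - ⟨h1, h2⟩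
    have := hmin _ hsz ⟨h1, hz.1.trans h2⟩
    obtain rfl : z = b := congrArg Prod.snd this
    exact hz.2 (T.isForest.desc_antisymm hz.1 h2)
  · rintro V hV ⟨s, x⟩ ⟨hx, ⟨z, hz, hsz⟩, hmax⟩ p - -
    exact ⟨_, hsz, ⟨Desc.refl _, hz.1⟩, fun h => hz.2 (congrArg Prod.snd h)⟩

/-- The pairing in which edges are added below edges above the orbit of `ξ`. -/
theorem exists_isPairing_above (hξ : T.IsInnerEdge ξ) (hmin : ∀ y, T.broad.Desc y ξ → y = ξ)
    (hS : S.broad.IsChainlike) :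
    ∃ c k, IsPairing G (S.tensorBox T) (S.fullSubtrees T ξ) c k := by
  have := S.isForest.finite
  have hmin' : ∀ x ∈ MulAction.orbit G ξ, ∀ y, T.broad.Desc y x → y = x := by
    rintro _ ⟨g, rfl⟩ y hy
    have := hmin (g⁻¹ • y) ((desc_smul_iff g _ _).1 (by rwa [smul_inv_smul]))
    exact inv_smul_eq_iff.1 this
  let ρ : T.carrier → T.carrier → Prop := fun z x => T.broad.Desc x z ∧ x ≠ z
  have hρ : ∀ x ∈ MulAction.orbit G ξ, ∀ z, ρ z x → z ∉ MulAction.orbit G ξ :=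
    fun x hx z hz hzo => hz.2 (eq_of_desc_of_mem_orbit hx hzo hz.1)
  refine ⟨_, exists_isPairing_toggles hξ ρ (fun a b => S.broad.Desc b a)
    (fun g a b h => ⟨(desc_smul_iff g _ _).2 h.1, fun h' => h.2 (smul_left_cancel g h')⟩) hρ
    (fun x z hz => Or.inr hz.1) (fun g a b => (desc_smul_iff g b a).2) (fun a b h => Or.inr h)
    ?_ ?_ ?_ ?_⟩
  · intro V hV
    obtain ⟨r, r', hr, hr', hrr, h1, h2, h3⟩ := exists_top hξ hV
    obtain ⟨x, hxξ, hx⟩ := exists_desc_root hr' ξ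
    have hr'x : ρ r' x := ⟨hx, fun h => (hξ.orbit x hxξ).2 (h ▸ hr')⟩
    obtain ⟨a, -, ⟨b, hb, hab⟩, hmax⟩ := S.isForest.box.exists_minimal
      (fun a => ∃ b, ρ b x ∧ (a, b) ∈ V) ⟨_, hr'x, hrr⟩
    exact ⟨(a, x), hxξ, ⟨b, hb, hab⟩, fun a' b' hb' hab' hl => hmax a' ⟨b', hb', hab'⟩ hl⟩
  · rintro V hV ⟨s, x⟩ ⟨hx, ⟨z, hz, hsz⟩, hmax⟩ ⟨a, b⟩ hab
    obtain ⟨r, r', hr, hr', hrr, h1, h2, h3⟩ := exists_top hξ hV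
    -- As `S` is chainlike, first coordinates in `V` are always comparable, so disjointness can only
    -- come from `T`.
    have hsa : S.broad.Desc s a ∨ S.broad.Desc a s :=
      hS _ _ _ ((h1 s).1 ⟨z, hsz⟩) ((h1 a).1 ⟨b, hab⟩)
    by_cases hxb : T.broad.Desc x b
    · by_cases hne : x = b
      · rcases hsa with h | h
        · exact Or.inl ⟨h, hxb⟩
        · exact Or.inr (Or.inl ⟨h, hne ▸ Desc.refl x⟩)
      · rcases hsa with h | h
        · exact Or.inl ⟨h, hxb⟩
        · obtain rfl : a = s := hmax a b ⟨hxb, hne⟩ hab h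
          exact Or.inl ⟨Desc.refl _, hxb⟩
    · by_cases hbx : T.broad.Desc b x
      · exact absurd (hmin' x hx b hbx ▸ Desc.refl _) hxb
      · exact Or.inr (Or.inr (Or.inr ⟨hxb, hbx⟩))
  · rintro V hV ⟨s, x⟩ ⟨hx, -, -⟩ ⟨a, b⟩ hab hmn ⟨p₁, p₂⟩ ⟨-, hp⟩ ⟨-, hpb⟩ ⟨-, hxb⟩
    obtain ⟨r, r', hr, hr', hrr, h1, h2, h3⟩ := exists_top hξ hV
    have hpξ : p₂ ∉ MulAction.orbit G ξ := fun h => (hξ.orbit _ h).1 hp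
    obtain ⟨s', hs'⟩ := h2 p₂ (Desc.trans hpb (h3 _ _ hab)) hpξ
    -- The leaf `p₂` is outside of the orbit and hence occurs in `V`. Comparison with the minimal
    -- `(a, b)` gives `b = p₂`, and a toggled edge below `(a, b)` would lie over this leaf.
    have key : p₂ = b := by
      rcases hV.1.comp _ hs' _ hab with h | h | h | h
      · exact congrArg Prod.snd (hmn _ hs' h)
      · exact (IsForest.eq_of_desc_leaf hp h.2).symm
      · exact (hS _ _ _ ((h1 s').1 ⟨_, hs'⟩) ((h1 a).1 ⟨b, hab⟩)).elim
          (fun h' => absurd h' h.1) (fun h' => absurd h' h.2)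
      · exact absurd hpb h.1
    subst key
    have hxp : x = p₂ := IsForest.eq_of_desc_leaf hp hxb
    exact hpξ (hxp ▸ hx)
  -- Vacuous: nothing lies strictly below `x`, and `x` is not a leaf.
  · rintro V hV ⟨s, x⟩ ⟨hx, -, -⟩ ⟨p₁, p₂⟩ ⟨-, hp⟩ ⟨-, hpx⟩
    exact absurd (hmin' x hx p₂ hpx ▸ hp) (hξ.orbit x hx).1

end GTree

end


/-! ### Linear `G`-trees and the main theorem -/

namespace GTree

variable {G : Type u} [Group G] {S T : GTree G}

theorem IsLinear.isOpen (h : T.IsLinear) : T.IsOpen := by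
  obtain ⟨H, n, φ, -, hφ⟩ := h
  intro e he
  obtain ⟨⟨i, -, hi⟩, -⟩ := (hφ 0 e).1 he.1.1
  simp at hi

theorem IsLinear.isChainlike (h : T.IsLinear) : T.broad.IsChainlike := by
  obtain ⟨H, n, φ, -, hφ⟩ := h
  have h1 : ∀ a b, T.broad.Desc a b → (φ a).1 = (φ b).1 := by
    rintro a b ⟨s, hs, h⟩
    exact ((hφ s b).1 h).2 _ (Multiset.mem_map_of_mem φ hs)
  have h2 : ∀ a b, (φ a).1 = (φ b).1 → (φ a).2 ≤ (φ b).2 → T.broad.Desc a b := by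
    intro a b h h'
    exact ⟨{a}, by simp, (hφ _ _).2 ⟨⟨(φ a).2, h', by simp⟩, by simpa using h⟩⟩
  intro a b r ha hb
  have hab := (h1 a r ha).trans (h1 b r hb).symm
  exact (le_total (φ a).2 (φ b).2).imp (h2 a b hab) (h2 b a hab.symm)

theorem IsLinear.leafCovered (h : T.IsLinear) : T.broad.LeafCovered :=
  T.isForest.leafCovered h.isOpen

theorem amenable (hST : (S.IsOpen ∧ T.IsOpen) ∨ (S.IsLinear ∨ T.IsLinear)) :
    Amenable S.broad T.broad := by
  rcases hST with ⟨hS, hT⟩ | hS | hT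
  · exact Or.inl ⟨S.isForest.leafCovered hS, T.isForest.leafCovered hT⟩
  · exact Or.inr (Or.inl ⟨hS.leafCovered, hS.isChainlike⟩)
  · exact Or.inr (Or.inr ⟨hT.leafCovered, hT.isChainlike⟩)

/-- An open `T`, in particular a linear one, has a leaf below `ξ`, and it differs from the inner
edge `ξ`. Only for linear `S` is it possible that nothing lies below `ξ`, and then `S` is chainlike.
-/
theorem exists_isPairing {ξ : T.carrier} (hξ : T.IsInnerEdge ξ)
    (hST : (S.IsOpen ∧ T.IsOpen) ∨ (S.IsLinear ∨ T.IsLinear)) :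
    ∃ c k, IsPairing G (S.tensorBox T) (S.fullSubtrees T ξ) c k := by
  have key : T.IsOpen → ∃ c k, IsPairing G (S.tensorBox T) (S.fullSubtrees T ξ) c k := by
    intro hT
    obtain ⟨l, hl, hlξ⟩ := T.isForest.leafCovered hT ξ
    exact exists_isPairing_below hξ hlξ (fun h => hξ.1 (h ▸ hl))
  rcases hST with ⟨-, hT⟩ | hS | hT
  · exact key hT
  · by_cases hmin : ∀ y, T.broad.Desc y ξ → y = ξ
    · exact exists_isPairing_above hξ hmin hS.isChainlike
    · push Not at hmin
      obtain ⟨y, hy, hyξ⟩ := hmin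
      exact exists_isPairing_below hξ hy hyξ
  · exact key hT.isOpen

/-- The inclusion of the image of the pushout product is inner anodyne. -/
theorem incl_inPushoutProduct_mem {ξ : T.carrier} (hξ : T.IsInnerEdge ξ)
    (hST : (S.IsOpen ∧ T.IsOpen) ∨ (S.IsLinear ∨ T.IsLinear)) (W : MorphismProperty (DSetG G))
    [W.IsMultiplicative] [W.IsStableUnderCobaseChange] (hW : innerHorns G ≤ W) :
    W ((S.isGSieve_inPushoutProduct T ξ).incl (isGSieve_true (S.tensor_isEquivariant T))
      (fun _ _ _ => trivial)) := by
  have := S.isForest.finite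
  have := T.isForest.finite
  have hb := cellBase (amenable hST) hξ
  obtain ⟨c, k, hc⟩ := exists_isPairing hξ hST
  have h₀ : IsUpper G (S.fullSubtrees T ξ) (S.fullSubtrees T ξ) :=
    ⟨subset_rfl, fun _ _ V' hV' _ => hV', fun g _ => smul_mem_fullSubtrees g⟩
  have h₁ : IsUpper G (S.fullSubtrees T ξ) ∅ := ⟨by simp, by simp, by simp⟩
  have key := hb.attach W hW _ _ _ h₀ h₁ (Set.empty_subset _) c k (by rwa [Set.sdiff_empty])
    (fun V _ => Set.ncard_le_ncard (Set.subset_univ (c V)) (Set.toFinite _))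
  have e₀ : (fun U φ => ¬ Spans (S.fullSubtrees T ξ) U φ) = S.InPushoutProduct T ξ := by
    funext U φ
    exact propext (inPushoutProduct_iff (amenable hST) hξ U φ).symm
  have e₁ : (fun (U : Omega) (φ : Hom U.broad (tensor S.broad T.broad)) => ¬ Spans ∅ U φ) =
      fun _ _ => True := by
    funext U φ
    simp [Spans]
  -- The sieves agree only up to propositional equality of predicates, along which the inclusion is
  -- transported.
  have aux : ∀ {A A' B B' : ∀ U : Omega, Hom U.broad (tensor S.broad T.broad) → Prop}
      (hA : IsGSieve (S.tensor_isEquivariant T) A) (hA' : IsGSieve (S.tensor_isEquivariant T) A')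
      (hB : IsGSieve (S.tensor_isEquivariant T) B) (hB' : IsGSieve (S.tensor_isEquivariant T) B')
      (h : ∀ U φ, A U φ → A' U φ) (h' : ∀ U φ, B U φ → B' U φ), A = B → A' = B' →
      W (hA.incl hA' h) → W (hB.incl hB' h') := by
    rintro A A' B B' hA hA' hB hB' h h' rfl rfl hW
    exact hW
  exact aux _ _ _ _ _ _ e₀ e₁ key

end GTree

theorem mainTheorem4 {G : Type u} [Group G] [Finite G] (S T : GTree G) (ξ : T.carrier)
    (hξ : T.IsInnerEdge ξ)
    (hST : (S.IsOpen ∧ T.IsOpen) ∨ (S.IsLinear ∨ T.IsLinear))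
    (sq : (tensorG G).PushoutObjObj S.boundaryι (T.hornι ξ)) :
    innerAnodyne G sq.ι := by
  intro W hW _ _ _
  obtain ⟨e⟩ := GTree.nonempty_arrow_iso (GTree.amenable hST) sq
  -- Identities and binary composites are covered by stability under transfinite composition.
  have : W.IsMultiplicative := inferInstance
  exact (W.arrow_mk_iso_iff e).2 (GTree.incl_inPushoutProduct_mem hξ hST W hW)
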